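/- Let $a<b$, $J=[a,b]$, and let $f\in L^2(J)$ be real-valued. For a finite set $\Sigma\subset J$ let $u_\Sigma\in H^1_0((a,b)\setminus\Sigma)$ be the weak solution of $-u''=f$ in $(a,b)\setminus\Sigma$ with $u=0$ on $\Sigma\cup\{a,b\}$, that is, $\int_a^b u_\Sigma'\varphi'\,dx=\int_a^b f\varphi\,dx$ for all $\varphi\in H^1_0((a,b)\setminus\Sigma)$, and let $C(\Sigma)=\int_a^b f\,u_\Sigma\,dx$ be its compliance. Let $\mathcal P(J)$ be the set of Borel probability measures on $J$ with the weak* topology. For finite non-empty $\Sigma\subset J$ put $\mu_\Sigma=\frac1{\#\Sigma}\sum_{x\in\Sigma}\delta_x$ and, for $\mu\in\mathcal P(J)$, $$F_n(\mu)=\begin{cases}n^2\,C(\Sigma)&\text{if }\mu=\mu_\Sigma\text{ with }\#\Sigma\le n,\\+\infty&\text{otherwise.}\end{cases}$$ Then the functionals $F_n$ $\Gamma$-converge on $\mathcal P(J)$ to $$F(\mu)=\frac1{12}\int_J\frac{f^2}{\mu_a^2}\,dx ,$$ where $\mu_a$ is the density of the absolutely continuous part of $\mu$ with respect to Lebesgue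 measure and the integrand is understood to be $0$ where $f=0$ and $+\infty$ where $f\ne0=\mu_a$. That is, for every $\mu\in\mathcal P(J)$: $F(\mu)\le\liminf_n F_n(\mu_n)$ for every sequence $\mu_n\to\mu$, and $\limsup_nF_n(\mu_n)\le F(\mu)$ for some sequence $\mu_n\to\mu$. The same holds if the points are counted with multiplicity, that is, for the functionals equal to $n^2\,C(\{x_1,\dots,x_n\})$ if $\mu=\frac1n\sum_{i=1}^n\delta_{x_i}$ with $x_1,\dots,x_n\in J$ not necessarily distinct, and to $+\infty$ otherwise. Moreover, if $f$ is not almost everywhere $0$, then $F$ has a unique minimizer on $\mathcal P(J)$, namely $$\mu_{\mathrm{opt}}=c\,|f|^{2/3}\,dx,\qquad c=\Big(\int_J|f|^{2/3}\,dx\Big)^{-1}.$$ -/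

import Mathlib

open MeasureTheory Filter Topology
open scoped ENNReal

namespace DirichletPoints

/-- `Γ`-convergence of `F n : X → [0, +∞]` to `F`, in sequential form. On a first countable space,
such as the space of probability measures on a compact interval with the weak* topology, this is
the same as the definition through neighbourhoods. -/
def GammaConverges {X : Type*} [TopologicalSpace X] (F : ℕ → X → ℝ≥0∞) (G : X → ℝ≥0∞) : Prop :=
  ∀ x : X,
    (∀ y : ℕ → X, Tendsto y atTop (𝓝 x) → G x ≤ liminf (fun n => F n (y n)) atTop) ∧
    (∃ y : ℕ → X, Tendsto y atTop (𝓝 x) ∧ limsup (fun n => F n (y n)) atTop ≤ G x)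

/-- `φ ∈ C_c^∞(U)`. -/
def IsTestFunction (U : Set ℝ) (φ : ℝ → ℝ) : Prop :=
  ContDiff ℝ ((⊤ : ℕ∞) : WithTop ℕ∞) φ ∧ HasCompactSupport φ ∧ tsupport φ ⊆ U

/-- `u ∈ H₀¹(U)`, with weak derivative `u'`: the pair `(u, u')` is the limit in `L²(U) × L²(U)` of
pairs `(φ, φ')` with `φ ∈ C_c^∞(U)`. -/
def MemH10 (U : Set ℝ) (u u' : ℝ → ℝ) : Prop :=
  MemLp u 2 (volume.restrict U) ∧ MemLp u' 2 (volume.restrict U) ∧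
  ∃ φ : ℕ → ℝ → ℝ, (∀ k, IsTestFunction U (φ k)) ∧
    Tendsto (fun k => eLpNorm (fun x => u x - φ k x) 2 (volume.restrict U)) atTop (𝓝 0) ∧
    Tendsto (fun k => eLpNorm (fun x => u' x - deriv (φ k) x) 2 (volume.restrict U)) atTop (𝓝 0)

/-- `u`, with weak derivative `u'`, is the weak solution in `H₀¹(U)` of `-u'' = f` in `U`,
`u = 0` on `∂U`. -/
def IsWeakSolution (U : Set ℝ) (f u u' : ℝ → ℝ) : Prop :=
  MemH10 U u u' ∧
  ∀ φ φ' : ℝ → ℝ, MemH10 U φ φ' → ∫ x in U, u' x * φ' x = ∫ x in U, f x * φ x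

/-- The number `∫ f u` does not depend on the weak solution. -/
theorem IsWeakSolution.integral_eq {U : Set ℝ} {f u u' v v' : ℝ → ℝ}
    (hu : IsWeakSolution U f u u') (hv : IsWeakSolution U f v v') :
    ∫ x in U, f x * u x = ∫ x in U, f x * v x := by
  rw [← hu.2 v v' hv.1, ← hv.2 u u' hu.1]
  simp only [mul_comm]

/-- It is also the energy `∫ (u')²`, hence nonnegative. -/
theorem IsWeakSolution.integral_eq_energy {U : Set ℝ} {f u u' : ℝ → ℝ}
    (hu : IsWeakSolution U f u u') :
    ∫ x in U, f x * u x = ∫ x in U, u' x ^ 2 := by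
  rw [← hu.2 u u' hu.1]
  simp only [sq]

/-- The compliance `∫_U f u`, with `u` the weak solution of `-u'' = f` in `U`, `u = 0` on `∂U`.
The infimum only serves to select the common value of `∫_U f u`. -/
noncomputable def compliance (U : Set ℝ) (f : ℝ → ℝ) : ℝ≥0∞ :=
  ⨅ (u : ℝ → ℝ) (u' : ℝ → ℝ) (_ : IsWeakSolution U f u u'), ENNReal.ofReal (∫ x in U, f x * u x)

theorem IsWeakSolution.compliance_eq {U : Set ℝ} {f u u' : ℝ → ℝ}
    (hu : IsWeakSolution U f u u') :
    compliance U f = ENNReal.ofReal (∫ x in U, f x * u x) := by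
  refine le_antisymm (iInf_le_of_le u (iInf_le_of_le u' (iInf_le_of_le hu le_rfl))) ?_
  refine le_iInf fun v => le_iInf fun v' => le_iInf fun hv => ?_
  rw [hu.integral_eq hv]

/-- The compliance of `(a, b) \ S`, where `S ⊆ [a, b]` is a set of Dirichlet points. -/
noncomputable def pointCompliance (a b : ℝ) (f : ℝ → ℝ) (S : Set (Set.Icc a b)) : ℝ≥0∞ :=
  compliance (Set.Ioo a b \ (Subtype.val '' S)) f

/-- `F_n(μ) = n² · compliance of (a, b) \ S` if `μ = μ_S`, the uniform probability measure on a
finite set `S ⊆ [a, b]` with at most `n` elements, and `F_n(μ) = +∞` if there is no such `S`.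
(The set `S` is unique if it exists: it is the support of `μ`.) -/
noncomputable def pointFunctional (a b : ℝ) (f : ℝ → ℝ) (n : ℕ)
    (μ : ProbabilityMeasure (Set.Icc a b)) : ℝ≥0∞ :=
  ⨅ (S : Finset (Set.Icc a b))
    (_ : S.card ≤ n ∧
      (μ : Measure (Set.Icc a b)) = (S.card : ℝ≥0∞)⁻¹ • ∑ x ∈ S, Measure.dirac x),
    (n : ℝ≥0∞) ^ 2 * pointCompliance a b f (S : Set (Set.Icc a b))

/-- The variant of `pointFunctional` in which the points are counted with multiplicity:
`F_n(μ) = n² · compliance of (a, b) \ {x₁, …, xₙ}` if `μ = n⁻¹ (δ_{x₁} + … + δ_{xₙ})` for some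
points `x₁, …, xₙ ∈ [a, b]`, not necessarily distinct, and `F_n(μ) = +∞` otherwise. -/
noncomputable def multiPointFunctional (a b : ℝ) (f : ℝ → ℝ) (n : ℕ)
    (μ : ProbabilityMeasure (Set.Icc a b)) : ℝ≥0∞ :=
  ⨅ (x : Fin n → Set.Icc a b)
    (_ : (μ : Measure (Set.Icc a b)) = (n : ℝ≥0∞)⁻¹ • ∑ i, Measure.dirac (x i)),
    (n : ℝ≥0∞) ^ 2 * pointCompliance a b f (Set.range x)

/-- A probability measure on `[a, b]`, seen as a measure on `ℝ`. -/
noncomputable def toReal {a b : ℝ} (μ : ProbabilityMeasure (Set.Icc a b)) : Measure ℝ :=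
  (μ : Measure (Set.Icc a b)).map Subtype.val

/-- `F(μ) = (1/12) ∫_J f² / μ_a²`, where `μ_a` is the density of the absolutely continuous part of
`μ`. In `[0, +∞]` one has `t / 0 = +∞` for `t ≠ 0` and `0 / 0 = 0`, so that the integrand is `0`
where `f = 0`. -/
noncomputable def limitFunctional (a b : ℝ) (f : ℝ → ℝ)
    (μ : ProbabilityMeasure (Set.Icc a b)) : ℝ≥0∞ :=
  (1 / 12) * ∫⁻ x in Set.Icc a b, ENNReal.ofReal (f x ^ 2) / ((toReal μ).rnDeriv volume x) ^ 2

end DirichletPoints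

/-! A finite set cuts `(a, b)` into gaps, and on each gap the Dirichlet problem is solved
explicitly: the derivative of the solution is the mean-zero primitive of `-f`. For a constant load
`c` a gap of length `l` has energy `c² l³ / 12`. Replacing `f` by a constant on a gap costs at most
`l² ∫ (f - c)²`, up to weights `1 + θ` and `1 + θ⁻¹` (`gapEnergy_le_of_const`,
`const_le_gapEnergy`). With `g` continuous and close to `f` in `L²`, the scaled compliance is thus
about `(1/12) ∑ g(tᵢ)² n² lᵢ³`, and `1 / (n lᵢ)` plays the role of the local density of points.

Lower bound. The tangent inequality `l³ ≥ 3 s² l - 2 s³` at `s = ψ(tᵢ) / n` bounds the sum below by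
`3 ∫ g² ψ² - 2 ∫ g² ψ³ dμₙ`, which passes to the weak* limit. The best `ψ` is `1 / ρ`, where `ρ` is
the density of the limit, cut to zero on the null set that carries its singular part; the value is
`∫ g² / ρ²`. Gaps need not be short, so a uniform grid of about `n / m` points is adjoined
beforehand: this only lowers the compliance, bounds the mesh by `m (b - a) / n`, and replaces `ρ` by
`ρ + κ` with `κ = 1 / (m (b - a))`. The limits are taken in the order `n → ∞`, `g → f`, `θ → 0`, `m
→ ∞`.

Upper bound. If the density is at least `δ > 0`, the points are the `n`-quantiles of the measure:
each gap has mass at most `1 / n`, hence length at most `1 / (n δ)`, and Jensen's inequality gives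
`n² l³ ≤ ∫ ρ⁻²` over the gap (`energy_le`). Coinciding quantiles are moved apart without losing any
of them, so one sequence serves both functionals. A general measure is mixed with a little of the
uniform one, and a diagonal argument concludes.

The minimizer comes from Young's inequality `t³ / ρ² + 2 C³ ρ ≥ 3 C² t` with `t = |f|^(2/3)` and `C
= ∫ t`, where equality means `ρ = t / C`. -/

namespace DirichletPoints

/-! ### Cauchy–Schwarz and convergence in `L²` -/

section LTwo

variable {α : Type*} [MeasurableSpace α] {μ : Measure α} {h k : α → ℝ}

theorem eLpNorm_two_eq (hh : MemLp h 2 μ) :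
    eLpNorm h 2 μ = ENNReal.ofReal (√(∫ x, h x ^ 2 ∂μ)) := by
  rw [hh.eLpNorm_eq_integral_rpow_norm two_ne_zero ENNReal.ofNat_ne_top, Real.sqrt_eq_rpow]
  simp

theorem integrable_mul_of_memLp_two (hh : MemLp h 2 μ) (hk : MemLp k 2 μ) :
    Integrable (fun x => h x * k x) μ :=
  hh.integrable_mul hk

theorem abs_integral_mul_le (hh : MemLp h 2 μ) (hk : MemLp k 2 μ) :
    |∫ x, h x * k x ∂μ| ≤ √(∫ x, h x ^ 2 ∂μ) * √(∫ x, k x ^ 2 ∂μ) := by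
  refine (abs_integral_le_integral_abs).trans ?_
  have := integral_mul_norm_le_Lp_mul_Lq (μ := μ) (f := h) (g := k) Real.HolderConjugate.two_two
    (by simpa using hh) (by simpa using hk)
  simpa [abs_mul, Real.sqrt_eq_rpow] using this

theorem sq_integral_mul_le (hh : MemLp h 2 μ) (hk : MemLp k 2 μ) :
    (∫ x, h x * k x ∂μ) ^ 2 ≤ (∫ x, h x ^ 2 ∂μ) * ∫ x, k x ^ 2 ∂μ := by
  have h1 := abs_integral_mul_le hh hk
  have h2 : 0 ≤ ∫ x, h x ^ 2 ∂μ := integral_nonneg fun _ => sq_nonneg _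
  have h3 : 0 ≤ ∫ x, k x ^ 2 ∂μ := integral_nonneg fun _ => sq_nonneg _
  rw [← sq_abs, ← Real.sq_sqrt h2, ← Real.sq_sqrt h3, ← mul_pow]
  exact pow_le_pow_left₀ (abs_nonneg _) h1 2

theorem tendsto_integral_mul {k' : ℕ → α → ℝ} (hh : MemLp h 2 μ) (hk : MemLp k 2 μ)
    (hk' : ∀ n, MemLp (k' n) 2 μ)
    (hlim : Tendsto (fun n => eLpNorm (fun x => k x - k' n x) 2 μ) atTop (𝓝 0)) :
    Tendsto (fun n => ∫ x, h x * k' n x ∂μ) atTop (𝓝 (∫ x, h x * k x ∂μ)) := by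
  have h1 : Tendsto (fun n => √(∫ x, (k x - k' n x) ^ 2 ∂μ)) atTop (𝓝 0) := by
    have := (ENNReal.tendsto_toReal ENNReal.zero_ne_top).comp hlim
    refine this.congr fun n => ?_
    have h2 := eLpNorm_two_eq (hk.sub (hk' n))
    simp only [Pi.sub_apply] at h2
    change (eLpNorm (k - k' n) 2 μ).toReal = _
    rw [h2, ENNReal.toReal_ofReal (Real.sqrt_nonneg _)]
  rw [tendsto_iff_dist_tendsto_zero]
  refine squeeze_zero (fun _ => dist_nonneg) (fun n => ?_)
    (by simpa using h1.const_mul (√(∫ x, h x ^ 2 ∂μ)))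
  rw [dist_comm, Real.dist_eq, 
    ← integral_sub (integrable_mul_of_memLp_two hh hk) (integrable_mul_of_memLp_two hh (hk' n))]
  have := abs_integral_mul_le hh (hk.sub (hk' n))
  simpa [mul_sub] using this

end LTwo

/-! ### Test functions, `H₀¹` and monotonicity of the compliance -/

theorem IsTestFunction.memLp {U : Set ℝ} {φ : ℝ → ℝ} (hφ : IsTestFunction U φ) (μ : Measure ℝ)
    [IsFiniteMeasureOnCompacts μ] : MemLp φ 2 μ :=
  hφ.1.continuous.memLp_of_hasCompactSupport hφ.2.1

theorem IsTestFunction.memLp_deriv {U : Set ℝ} {φ : ℝ → ℝ} (hφ : IsTestFunction U φ)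
    (μ : Measure ℝ) [IsFiniteMeasureOnCompacts μ] : MemLp (deriv φ) 2 μ :=
  (contDiff_infty_iff_deriv.1 hφ.1).2.continuous.memLp_of_hasCompactSupport hφ.2.1.deriv

/-- Both sides of the weak equation are `L²`-continuous in the pair `(φ, φ')`, so density of the
test functions suffices. -/
theorem isWeakSolution_of_test {U : Set ℝ} {f u u' : ℝ → ℝ}
    (hf : MemLp f 2 (volume.restrict U)) (hu : MemH10 U u u')
    (h : ∀ φ, IsTestFunction U φ → ∫ x in U, u' x * deriv φ x = ∫ x in U, f x * φ x) :
    IsWeakSolution U f u u' := by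
  refine ⟨hu, fun v v' hv => ?_⟩
  obtain ⟨hv1, hv2, φ, hφ, hφ1, hφ2⟩ := hv
  have h1 := tendsto_integral_mul hf hv1 (fun n => (hφ n).memLp _) hφ1
  have h2 := tendsto_integral_mul hu.2.1 hv2 (fun n => (hφ n).memLp_deriv _) hφ2
  refine tendsto_nhds_unique h2 (h1.congr fun n => (h _ (hφ n)).symm)

theorem memH10_of_approx {U : Set ℝ} {u u' : ℝ → ℝ} (hu : MemLp u 2 (volume.restrict U))
    (hu' : MemLp u' 2 (volume.restrict U))
    (h : ∀ ε : ℝ, 0 < ε → ∃ φ, IsTestFunction U φ ∧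
      eLpNorm (fun x => u x - φ x) 2 (volume.restrict U) ≤ ENNReal.ofReal ε ∧
      eLpNorm (fun x => u' x - deriv φ x) 2 (volume.restrict U) ≤ ENNReal.ofReal ε) :
    MemH10 U u u' := by
  choose! φ h1 h2 h3 using h
  have hpos : ∀ k : ℕ, (0 : ℝ) < 1 / ((k : ℝ) + 1) := fun k => by positivity
  have hlim : Tendsto (fun k : ℕ => ENNReal.ofReal (1 / ((k : ℝ) + 1))) atTop (𝓝 0) := by
    simpa using ENNReal.tendsto_ofReal tendsto_one_div_add_atTop_nhds_zero_nat
  exact ⟨hu, hu', fun k => φ (1 / ((k : ℝ) + 1)), fun k => h1 _ (hpos k),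
    tendsto_of_tendsto_of_tendsto_of_le_of_le tendsto_const_nhds hlim (fun _ => zero_le)
      fun k => h2 _ (hpos k),
    tendsto_of_tendsto_of_tendsto_of_le_of_le tendsto_const_nhds hlim (fun _ => zero_le)
      fun k => h3 _ (hpos k)⟩

theorem IsTestFunction.add {U : Set ℝ} {φ ψ : ℝ → ℝ} (hφ : IsTestFunction U φ)
    (hψ : IsTestFunction U ψ) : IsTestFunction U (φ + ψ) :=
  ⟨hφ.1.add hψ.1, hφ.2.1.add hψ.2.1,
    (tsupport_add φ ψ).trans (Set.union_subset hφ.2.2 hψ.2.2)⟩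

theorem isTestFunction_zero (U : Set ℝ) : IsTestFunction U 0 :=
  ⟨contDiff_const, HasCompactSupport.zero, by simp [tsupport]⟩

theorem memH10_zero (U : Set ℝ) : MemH10 U 0 0 :=
  memH10_of_approx MemLp.zero MemLp.zero fun ε _ => ⟨0, isTestFunction_zero U, by simp, by simp⟩

theorem MemH10.add {U : Set ℝ} {u u' v v' : ℝ → ℝ} (hu : MemH10 U u u') (hv : MemH10 U v v') :
    MemH10 U (u + v) (u' + v') := by
  obtain ⟨hu1, hu2, φ, hφ, hφ1, hφ2⟩ := hu
  obtain ⟨hv1, hv2, ψ, hψ, hψ1, hψ2⟩ := hv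
  refine ⟨hu1.add hv1, hu2.add hv2, fun k => φ k + ψ k, fun k => (hφ k).add (hψ k), ?_, ?_⟩
  · refine tendsto_of_tendsto_of_tendsto_of_le_of_le tendsto_const_nhds
      (by simpa using hφ1.add hψ1) (fun _ => zero_le) fun k => ?_
    refine le_trans (le_of_eq ?_) (eLpNorm_add_le (hu1.sub ((hφ k).memLp _)).1
      (hv1.sub ((hψ k).memLp _)).1 one_le_two)
    congr 1; ext x; simp; ring
  · refine tendsto_of_tendsto_of_tendsto_of_le_of_le tendsto_const_nhds
      (by simpa using hφ2.add hψ2) (fun _ => zero_le) fun k => ?_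
    refine le_trans (le_of_eq ?_) (eLpNorm_add_le (hu2.sub ((hφ k).memLp_deriv _)).1
      (hv2.sub ((hψ k).memLp_deriv _)).1 one_le_two)
    congr 1; ext x
    have h1 := ((hφ k).1.differentiable (by simp)) x
    have h2 := ((hψ k).1.differentiable (by simp)) x
    simp [deriv_add h1 h2]; ring

theorem memH10_sum {U : Set ℝ} {ι : Type*} (s : Finset ι) {u u' : ι → ℝ → ℝ}
    (h : ∀ i ∈ s, MemH10 U (u i) (u' i)) :
    MemH10 U (fun x => ∑ i ∈ s, u i x) (fun x => ∑ i ∈ s, u' i x) := by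
  classical
  induction s using Finset.induction_on with
  | empty => simpa using! memH10_zero U
  | insert i s hi ih =>
    simp only [Finset.sum_insert hi]
    exact (h i (Finset.mem_insert_self i s)).add
      (ih fun j hj => h j (Finset.mem_insert_of_mem hj))

theorem MemH10.mono {U V : Set ℝ} {u u' : ℝ → ℝ} (hu : MemH10 U u u') (hUV : U ⊆ V)
    (hnull : volume (V \ U) = 0) : MemH10 V u u' := by
  have hae : volume.restrict V = volume.restrict U := by
    refine Measure.restrict_congr_set ?_
    exact (ae_le_set.2 hnull).antisymm (LE.le.eventuallyLE hUV)
  obtain ⟨h1, h2, φ, hφ, h3, h4⟩ := hu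
  refine ⟨hae ▸ h1, hae ▸ h2, φ, fun k => ⟨(hφ k).1, (hφ k).2.1, (hφ k).2.2.trans hUV⟩,
    hae ▸ h3, hae ▸ h4⟩

/-- The solution `v` on the smaller set is admissible as a test function on the larger one, so `∫ u'
v' = ∫ f v = ∫ v'²`, and `∫ (u' - v')² ≥ 0` gives `∫ v'² ≤ ∫ u'²`. Solvability on `U` has to be
supplied: without it the infimum defining `compliance U f` is `⊤`. -/
theorem compliance_mono {U V : Set ℝ} {f v v' : ℝ → ℝ} (hUV : U ⊆ V)
    (hnull : volume (V \ U) = 0) (hv : IsWeakSolution U f v v') :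
    compliance U f ≤ compliance V f := by
  have hae : volume.restrict V = volume.restrict U := by
    refine Measure.restrict_congr_set ?_
    exact (ae_le_set.2 hnull).antisymm (LE.le.eventuallyLE hUV)
  refine le_iInf fun u => le_iInf fun u' => le_iInf fun hu => ?_
  rw [hv.compliance_eq, hu.integral_eq_energy, hae]
  refine ENNReal.ofReal_le_ofReal ?_
  have h1 := hu.2 v v' (hv.1.mono hUV hnull)
  rw [hae] at h1
  have h2 := hv.integral_eq_energy
  have hu' : MemLp u' 2 (volume.restrict U) := hae ▸ hu.1.2.1
  have h3 : 0 ≤ ∫ x in U, (u' x - v' x) ^ 2 := integral_nonneg fun _ => sq_nonneg _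
  have h4 : ∫ x in U, (u' x - v' x) ^ 2 = (∫ x in U, u' x ^ 2) + (∫ x in U, v' x ^ 2)
      - 2 * ∫ x in U, u' x * v' x := by
    have i1 := hu'.integrable_sq
    have i2 := hv.1.2.1.integrable_sq
    have i3 := (integrable_mul_of_memLp_two hu' hv.1.2.1).const_mul 2
    rw [← integral_const_mul, ← integral_add i1 i2]
    refine Eq.trans ?_ (integral_sub (i1.add i2) i3)
    refine integral_congr_ae (ae_of_all _ fun x => ?_)
    simp only; ring
  rw [h2]
  linarith

/-! ### Primitives of mean-zero functions belong to `H₀¹` -/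

theorem abs_intervalIntegral_le_sqrt_mul {p q x N : ℝ} {F : ℝ → ℝ} (hx : x ∈ Set.Icc p q)
    (hF : MemLp F 2 volume) (hN : 0 ≤ N) (hle : eLpNorm F 2 volume ≤ ENNReal.ofReal N) :
    |∫ y in p..x, F y| ≤ √(q - p) * N := by
  rw [intervalIntegral.integral_of_le hx.1]
  have h1 := abs_integral_mul_le (μ := volume.restrict (Set.Ioc p x)) (h := fun _ => (1 : ℝ)) (k := F)
    (memLp_const 1) (hF.restrict _)
  simp only [one_mul, one_pow, integral_const, MeasurableSet.univ, measureReal_restrict_apply,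
    Set.univ_inter, Real.volume_real_Ioc_of_le hx.1, smul_eq_mul, mul_one] at h1
  refine h1.trans (mul_le_mul (Real.sqrt_le_sqrt (by linarith [hx.2])) ?_ (Real.sqrt_nonneg _)
    (Real.sqrt_nonneg _))
  rw [eLpNorm_two_eq hF] at hle
  refine le_trans (Real.sqrt_le_sqrt ?_) ((ENNReal.ofReal_le_ofReal_iff hN).1 hle)
  exact setIntegral_le_integral hF.integrable_sq (ae_of_all _ fun _ => sq_nonneg _)

/-- A smooth `L²` approximation is multiplied by a cut-off that equals one except near the
endpoints, where `G` has little `L²` mass. The radius `r < (q - p) / 2` keeps the support compactly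
inside `(p, q)`. -/
theorem exists_smooth_approx_Ioo {p q ε : ℝ} (hpq : p < q) {G : ℝ → ℝ} (hG : MemLp G 2 volume)
    (hG0 : ∀ x, x ∉ Set.Ioo p q → G x = 0) (hε : 0 < ε) :
    ∃ (ψ : ℝ → ℝ) (r : ℝ), 0 < r ∧ r < (q - p) / 2 ∧ ContDiff ℝ ((⊤ : ℕ∞) : WithTop ℕ∞) ψ ∧
      tsupport ψ ⊆ Metric.closedBall ((p + q) / 2) r ∧
      eLpNorm (G - ψ) 2 volume ≤ ENNReal.ofReal ε := by
  obtain ⟨δ, hδ, hδ2⟩ := hG.eLpNorm_indicator_le one_le_two ENNReal.ofNat_ne_top (half_pos hε)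
  set m := (p + q) / 2 with hm
  -- The part of `(p, q)` where the cut-off can differ from one has length `4 * η`, below `δ`; the
  -- bound `(q - p) / 8` keeps both radii positive.
  set η := min ((q - p) / 8) (δ / 8) with hη
  have hη0 : 0 < η := lt_min (by linarith) (by linarith)
  have hη1 : η ≤ (q - p) / 8 := min_le_left _ _
  have hη2 : η ≤ δ / 8 := min_le_right _ _
  let χ : ContDiffBump m := ⟨(q - p) / 2 - 2 * η, (q - p) / 2 - η, by linarith, by linarith⟩
  obtain ⟨h, hh1, hh2, hh3⟩ := hG.exist_eLpNorm_sub_le ENNReal.ofNat_ne_top one_le_two (half_pos hε)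
  have hhL : MemLp h 2 volume := hh2.continuous.memLp_of_hasCompactSupport hh1
  have hχc : Continuous χ := χ.continuous
  have hχ1 : ∀ x, |χ x| ≤ 1 := fun x => by
    rw [abs_of_nonneg χ.nonneg]; exact χ.le_one
  refine ⟨fun x => χ x * h x, (q - p) / 2 - η, by linarith, by linarith, χ.contDiff.mul hh2,
    (tsupport_mul_subset_left).trans (by rw [χ.tsupport_eq]), ?_⟩
  set s := Set.Ioo p q \ Metric.closedBall m ((q - p) / 2 - 2 * η) with hs
  have hsm : MeasurableSet s := measurableSet_Ioo.diff measurableSet_closedBall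
  have hsv : volume s ≤ ENNReal.ofReal δ := by
    rw [hs, measure_sdiff _ measurableSet_closedBall.nullMeasurableSet
      measure_closedBall_lt_top.ne,
      Real.volume_Ioo, Real.volume_closedBall, ← ENNReal.ofReal_sub _ (by linarith)]
    · exact ENNReal.ofReal_le_ofReal (by linarith)
    · intro x hx
      rw [Metric.mem_closedBall, Real.dist_eq, abs_le] at hx
      constructor <;> linarith [hx.1, hx.2]
  have e1 : eLpNorm (fun x => (1 - χ x) * G x) 2 volume ≤ ENNReal.ofReal (ε / 2) := by
    refine le_trans (eLpNorm_mono fun x => ?_) (hδ2 s hsm hsv)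
    by_cases hx : x ∈ s
    · rw [Set.indicator_of_mem hx, norm_mul]
      refine mul_le_of_le_one_left (norm_nonneg _) ?_
      rw [Real.norm_eq_abs, abs_of_nonneg (by linarith [χ.le_one (x := x)])]
      linarith [χ.nonneg (x := x)]
    · rw [Set.indicator_of_notMem hx]
      by_cases hx2 : x ∈ Set.Ioo p q
      · have : x ∈ Metric.closedBall m χ.rIn := by
          by_contra h; exact hx ⟨hx2, h⟩
        simp [χ.one_of_mem_closedBall this]
      · simp [hG0 x hx2]
  have e2 : eLpNorm (fun x => χ x * (G - h) x) 2 volume ≤ ENNReal.ofReal (ε / 2) := by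
    refine le_trans (eLpNorm_mono fun x => ?_) hh3
    rw [norm_mul]
    exact mul_le_of_le_one_left (norm_nonneg _) (hχ1 x)
  have e3 : (G - fun x => χ x * h x) = (fun x => (1 - χ x) * G x) + fun x => χ x * (G - h) x := by
    ext x; simp; ring
  rw [e3]
  refine (eLpNorm_add_le ?_ ?_ one_le_two).trans ((add_le_add e1 e2).trans ?_)
  · exact (continuous_const.sub hχc).aestronglyMeasurable.mul hG.1
  · exact hχc.aestronglyMeasurable.mul (hG.1.sub hhL.1)
  · rw [← ENNReal.ofReal_add (by linarith) (by linarith), add_halves]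

/-- Mean zero is restored by subtracting a multiple of a normalised bump. Since `G` has mean zero,
the integral of `ψ` is at most `√(q - p)` times the approximation error, so the correction is of the
order of that error. -/
theorem exists_smooth_approx_Ioo_integral_zero {p q ε : ℝ} (hpq : p < q) {G : ℝ → ℝ}
    (hG : MemLp G 2 volume) (hG0 : ∀ x, x ∉ Set.Ioo p q → G x = 0) (hGi : ∫ x in p..q, G x = 0)
    (hε : 0 < ε) :
    ∃ (ψ : ℝ → ℝ) (r : ℝ), 0 < r ∧ r < (q - p) / 2 ∧ ContDiff ℝ ((⊤ : ℕ∞) : WithTop ℕ∞) ψ ∧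
      tsupport ψ ⊆ Metric.closedBall ((p + q) / 2) r ∧ ∫ x in p..q, ψ x = 0 ∧
      eLpNorm (G - ψ) 2 volume ≤ ENNReal.ofReal ε := by
  set m := (p + q) / 2 with hm
  let χ : ContDiffBump m := ⟨(q - p) / 8, (q - p) / 4, by linarith, by linarith⟩
  set κ : ℝ → ℝ := χ.normed volume with hκ
  have hκs : ContDiff ℝ ((⊤ : ℕ∞) : WithTop ℕ∞) κ := χ.contDiff_normed
  have hκL : MemLp κ 2 volume :=
    hκs.continuous.memLp_of_hasCompactSupport χ.hasCompactSupport_normed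
  have hκi : ∫ x in p..q, κ x = 1 := by
    rw [intervalIntegral.integral_eq_integral_of_support_subset, χ.integral_normed]
    refine (subset_tsupport _).trans ?_
    rw [χ.tsupport_normed_eq]
    intro x hx
    rw [Metric.mem_closedBall, Real.dist_eq, abs_le] at hx
    have h4 : χ.rOut = (q - p) / 4 := rfl
    rw [h4] at hx
    constructor <;> linarith [hx.1, hx.2]
  set K := (eLpNorm κ 2 volume).toReal with hK
  have hK0 : 0 ≤ K := ENNReal.toReal_nonneg
  have hKe : eLpNorm κ 2 volume = ENNReal.ofReal K := (ENNReal.ofReal_toReal hκL.2.ne).symm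
  have hc : 0 < 1 + √(q - p) * K := by positivity
  -- The total error will be `ε' + √(q - p) * ε' * K = ε`.
  set ε' := ε / (1 + √(q - p) * K) with hε'
  have hε'0 : 0 < ε' := div_pos hε hc
  obtain ⟨ψ, r, hr0, hr1, hψ, hψs, hψe⟩ := exists_smooth_approx_Ioo hpq hG hG0 hε'0
  have hψc : HasCompactSupport ψ :=
    (isCompact_closedBall m r).of_isClosed_subset (isClosed_tsupport _) hψs
  have hψL : MemLp ψ 2 volume := hψ.continuous.memLp_of_hasCompactSupport hψc
  set J := ∫ x in p..q, ψ x with hJ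
  have hJle : |J| ≤ √(q - p) * ε' := by
    have h1 := abs_intervalIntegral_le_sqrt_mul (p := p) (q := q) (x := q) ⟨hpq.le, le_rfl⟩
      (hG.sub hψL) hε'0.le hψe
    have h2 : ∫ y in p..q, (G - ψ) y = -J := by
      simp only [Pi.sub_apply]
      rw [intervalIntegral.integral_sub, hGi, zero_sub]
      · rw [intervalIntegrable_iff_integrableOn_Ioc_of_le hpq.le]
        exact (hG.restrict _).integrable one_le_two
      · exact hψ.continuous.intervalIntegrable _ _
    rwa [h2, abs_neg] at h1
  refine ⟨fun x => ψ x - J * κ x, max r ((q - p) / 4), lt_max_of_lt_left hr0,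
    max_lt hr1 (by linarith), hψ.sub (contDiff_const.mul hκs), ?_, ?_, ?_⟩
  · refine closure_minimal (fun x hx => ?_) Metric.isClosed_closedBall
    by_contra hx2
    rw [Metric.mem_closedBall, le_max_iff, not_or] at hx2
    have h1 : ψ x = 0 := by
      by_contra h
      exact hx2.1 (hψs (subset_tsupport _ h))
    have h2 : κ x = 0 := by
      by_contra h
      refine hx2.2 ?_
      have : x ∈ tsupport κ := subset_tsupport _ h
      rw [hκ, χ.tsupport_normed_eq] at this
      exact this
    simp [h1, h2] at hx
  · rw [intervalIntegral.integral_sub (hψ.continuous.intervalIntegrable _ _)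
      ((hκs.continuous.intervalIntegrable _ _).const_mul _), intervalIntegral.integral_const_mul,
      hκi, mul_one, ← hJ, sub_self]
  · have e : (G - fun x => ψ x - J * κ x) = (G - ψ) + J • κ := by
      ext x; simp; ring
    rw [e]
    refine (eLpNorm_add_le (hG.sub hψL).1 (hκL.const_smul J).1 one_le_two).trans ?_
    rw [eLpNorm_const_smul, hKe]
    have h5 : ‖J‖ₑ ≤ ENNReal.ofReal (√(q - p) * ε') := by
      rw [← ofReal_norm]; exact ENNReal.ofReal_le_ofReal hJle
    calc _ ≤ ENNReal.ofReal ε' + ENNReal.ofReal (√(q - p) * ε') * ENNReal.ofReal K := by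
          gcongr
      _ = ENNReal.ofReal ε := by
          rw [← ENNReal.ofReal_mul (by positivity), ← ENNReal.ofReal_add hε'0.le (by positivity)]
          congr 1
          rw [hε']; field_simp

/-- The primitive of a smooth mean-zero function compactly supported in `(p, q)` is a test function,
and primitives depend continuously on the integrand in `L²`. So it suffices to approximate `g` by
such functions. -/
theorem memH10_indicator {U : Set ℝ} {p q : ℝ} (hpq : p ≤ q) (hU : Set.Ioo p q ⊆ U) {g : ℝ → ℝ}
    (hg : MemLp g 2 (volume.restrict (Set.Ioo p q))) (hg0 : ∫ x in p..q, g x = 0) :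
    MemH10 U ((Set.Ioo p q).indicator fun x => ∫ y in p..x, g y) ((Set.Ioo p q).indicator g) := by
  rcases hpq.eq_or_lt with rfl | hpq
  · simpa using! memH10_zero U
  set I := Set.Ioo p q with hI
  set G := I.indicator g with hGdef
  have hGL : MemLp G 2 volume := (memLp_indicator_iff_restrict measurableSet_Ioo).2 hg
  have hG0 : ∀ x, x ∉ I → G x = 0 := fun x hx => Set.indicator_of_notMem hx _
  have hprim : ∀ x ∈ Set.Icc p q, ∫ y in p..x, g y = ∫ y in p..x, G y := by
    intro x hx
    rw [intervalIntegral.integral_of_le hx.1, intervalIntegral.integral_of_le hx.1,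
      integral_Ioc_eq_integral_Ioo, integral_Ioc_eq_integral_Ioo]
    refine setIntegral_congr_fun measurableSet_Ioo fun y hy => ?_
    exact (Set.indicator_of_mem (show y ∈ I from ⟨hy.1, hy.2.trans_le hx.2⟩) g).symm
  have hGi : ∫ x in p..q, G x = 0 := by rw [← hprim q ⟨hpq.le, le_rfl⟩, hg0]
  have hGii : ∀ c d, IntervalIntegrable G volume c d := fun c d => by
    rw [intervalIntegrable_iff]
    exact (hGL.restrict (Set.Ioc (min c d) (max c d))).integrable one_le_two
  have hu : I.indicator (fun x => ∫ y in p..x, g y) = I.indicator fun x => ∫ y in p..x, G y :=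
    Set.indicator_congr fun x hx => hprim x (Set.Ioo_subset_Icc_self hx)
  -- Passing from the pointwise bound to the `L²` norm over a set of length `q - p` costs a second
  -- factor `√(q - p)`.
  have hdom : ∀ {v : ℝ → ℝ} {N : ℝ}, 0 ≤ N → (∀ x ∈ I, |v x| ≤ √(q - p) * N) →
      (∀ x, x ∉ I → v x = 0) → eLpNorm v 2 (volume.restrict U) ≤ ENNReal.ofReal ((q - p) * N) := by
    intro v N hN hv hv0
    have h1 : eLpNorm v 2 (volume.restrict U) ≤
        eLpNorm (I.indicator fun _ => √(q - p) * N) 2 volume := by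
      refine (eLpNorm_mono_measure _ Measure.restrict_le_self).trans (eLpNorm_mono fun x => ?_)
      by_cases hx : x ∈ I
      · rw [Set.indicator_of_mem hx, Real.norm_eq_abs]
        exact (hv x hx).trans (le_abs_self _)
      · simp [hv0 x hx]
    refine h1.trans (le_of_eq ?_)
    rw [eLpNorm_indicator_const measurableSet_Ioo two_ne_zero ENNReal.ofNat_ne_top, Real.volume_Ioo,
      ENNReal.ofReal_rpow_of_nonneg (by linarith) (by positivity), ← ofReal_norm,
      ← ENNReal.ofReal_mul (norm_nonneg _)]
    congr 1
    rw [Real.norm_of_nonneg (by positivity), ENNReal.toReal_ofNat, ← Real.sqrt_eq_rpow, mul_right_comm,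
      Real.mul_self_sqrt (by linarith)]
  have hbig : ENNReal.ofReal (eLpNorm G 2 volume).toReal = eLpNorm G 2 volume :=
    ENNReal.ofReal_toReal hGL.2.ne
  rw [hu]
  refine memH10_of_approx ⟨?_, ?_⟩ (hGL.restrict _) fun ε hε => ?_
  · exact ((intervalIntegral.continuous_primitive hGii p).aestronglyMeasurable).indicator
      measurableSet_Ioo
  · refine (hdom (N := (eLpNorm G 2 volume).toReal) ENNReal.toReal_nonneg (fun x hx => ?_)
      fun x hx => Set.indicator_of_notMem hx _).trans_lt ENNReal.ofReal_lt_top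
    rw [Set.indicator_of_mem hx]
    exact abs_intervalIntegral_le_sqrt_mul (Set.Ioo_subset_Icc_self hx) hGL ENNReal.toReal_nonneg
      hbig.ge
  -- Makes both `N ≤ ε`, for the derivatives, and `(q - p) * N ≤ ε`, for the primitives.
  set N := ε / (1 + (q - p)) with hN
  have hc : 0 < 1 + (q - p) := by linarith
  have hN0 : 0 < N := div_pos hε hc
  have hN1 : N ≤ ε := div_le_self hε.le (by linarith)
  have hN2 : (q - p) * N ≤ ε := by
    rw [hN, mul_div_assoc', div_le_iff₀ hc]; nlinarith
  obtain ⟨ψ, r, hr0, hr1, hψ, hψs, hψi, hψe⟩ :=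
    exists_smooth_approx_Ioo_integral_zero hpq hGL hG0 hGi hN0
  have hψc : HasCompactSupport ψ :=
    (isCompact_closedBall _ r).of_isClosed_subset (isClosed_tsupport _) hψs
  have hψL : MemLp ψ 2 volume := hψ.continuous.memLp_of_hasCompactSupport hψc
  have hψ0 : ∀ x, x < (p + q) / 2 - r ∨ (p + q) / 2 + r < x → ψ x = 0 := by
    intro x hx
    by_contra h
    have := hψs (subset_tsupport _ h)
    rw [Metric.mem_closedBall, Real.dist_eq, abs_le] at this
    rcases hx with hx | hx <;> linarith [this.1, this.2]
  -- To the left of the support of `ψ` the integrand vanishes; to the right of it the primitive has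
  -- reached the full integral, which is zero.
  have hφ0 : ∀ x, x < (p + q) / 2 - r ∨ (p + q) / 2 + r < x → ∫ y in p..x, ψ y = 0 := by
    rintro x (hx | hx)
    · refine intervalIntegral.integral_zero_ae (ae_of_all _ fun y hy => hψ0 y (Or.inl ?_))
      rcases le_total p x with h | h
      · rw [Set.uIoc_of_le h] at hy; linarith [hy.2]
      · rw [Set.uIoc_of_ge h] at hy; linarith [hy.2]
    · rw [← hψi, intervalIntegral.integral_eq_integral_of_support_subset,
        intervalIntegral.integral_eq_integral_of_support_subset]
      · intro y hy
        have : ¬ (y < (p + q) / 2 - r ∨ (p + q) / 2 + r < y) := fun h => hy (hψ0 y h)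
        push Not at this
        constructor <;> linarith [this.1, this.2]
      · intro y hy
        have : ¬ (y < (p + q) / 2 - r ∨ (p + q) / 2 + r < y) := fun h => hy (hψ0 y h)
        push Not at this
        constructor <;> linarith [this.1, this.2]
  have hderiv : ∀ x, HasDerivAt (fun x => ∫ y in p..x, ψ y) (ψ x) x := fun x =>
    intervalIntegral.integral_hasDerivAt_right (hψ.continuous.intervalIntegrable _ _)
      hψ.continuous.aestronglyMeasurable.stronglyMeasurableAtFilter hψ.continuous.continuousAt
  have hderiv' : deriv (fun x => ∫ y in p..x, ψ y) = ψ := funext fun x => (hderiv x).deriv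
  have hsupp : tsupport (fun x => ∫ y in p..x, ψ y) ⊆ Metric.closedBall ((p + q) / 2) r := by
    refine closure_minimal (fun x hx => ?_) Metric.isClosed_closedBall
    have : ¬ (x < (p + q) / 2 - r ∨ (p + q) / 2 + r < x) := fun h => hx (hφ0 x h)
    push Not at this
    rw [Metric.mem_closedBall, Real.dist_eq, abs_le]
    constructor <;> linarith [this.1, this.2]
  have hballI : Metric.closedBall ((p + q) / 2) r ⊆ I := by
    intro x hx
    rw [Metric.mem_closedBall, Real.dist_eq, abs_le] at hx
    constructor <;> linarith [hx.1, hx.2]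
  refine ⟨fun x => ∫ y in p..x, ψ y, ⟨?_, ?_, ?_⟩, ?_, ?_⟩
  · rw [contDiff_infty_iff_deriv, hderiv']
    exact ⟨fun x => (hderiv x).differentiableAt, hψ⟩
  · exact (isCompact_closedBall _ r).of_isClosed_subset (isClosed_tsupport _) hsupp
  · exact hsupp.trans (hballI.trans hU)
  · refine (hdom hN0.le (fun x hx => ?_) fun x hx => ?_).trans (ENNReal.ofReal_le_ofReal hN2)
    · rw [Set.indicator_of_mem hx, ← intervalIntegral.integral_sub (hGii _ _)
        (hψ.continuous.intervalIntegrable _ _)]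
      exact abs_intervalIntegral_le_sqrt_mul (Set.Ioo_subset_Icc_self hx) (hGL.sub hψL) hN0.le hψe
    · rw [Set.indicator_of_notMem hx, zero_sub, neg_eq_zero]
      by_contra h
      exact hx (hballI (hsupp (subset_tsupport _ h)))
  · rw [hderiv']
    exact (eLpNorm_mono_measure _ Measure.restrict_le_self).trans
      (hψe.trans (ENNReal.ofReal_le_ofReal hN1))

/-! ### The explicit solution on one gap -/

/-- The mean over `(p, q)` of the primitive of `f` vanishing at `p`. -/
noncomputable def gapMean (f : ℝ → ℝ) (p q : ℝ) : ℝ :=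
  (q - p)⁻¹ * ∫ x in p..q, ∫ y in p..x, f y

/-- The derivative on `(p, q)` of the solution of `-u'' = f`, `u(p) = u(q) = 0`. -/
noncomputable def gapSlope (f : ℝ → ℝ) (p q x : ℝ) : ℝ :=
  gapMean f p q - ∫ y in p..x, f y

/-- The compliance of the interval `(p, q)`. -/
noncomputable def gapEnergy (f : ℝ → ℝ) (p q : ℝ) : ℝ :=
  ∫ x in p..q, gapSlope f p q x ^ 2

section Gap

variable {f : ℝ → ℝ} {p q : ℝ}

theorem continuousOn_primitive_Icc (hpq : p ≤ q) (hf : IntervalIntegrable f volume p q) :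
    ContinuousOn (fun x => ∫ y in p..x, f y) (Set.Icc p q) := by
  have := intervalIntegral.continuousOn_primitive_interval (μ := volume) (f := f) (a := p) (b := q)
    (by rw [Set.uIcc_of_le hpq, integrableOn_Icc_iff_integrableOn_Ioc]; exact hf.1)
  rwa [Set.uIcc_of_le hpq] at this

theorem continuousOn_gapSlope (hpq : p ≤ q) (hf : IntervalIntegrable f volume p q) :
    ContinuousOn (gapSlope f p q) (Set.Icc p q) :=
  continuousOn_const.sub (continuousOn_primitive_Icc hpq hf)

theorem integral_gapSlope (hpq : p ≤ q) (hf : IntervalIntegrable f volume p q) :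
    ∫ x in p..q, gapSlope f p q x = 0 := by
  rcases hpq.eq_or_lt with rfl | hlt
  · simp
  · simp only [gapSlope]
    rw [intervalIntegral.integral_sub (by simp)
      ((continuousOn_primitive_Icc hpq hf).intervalIntegrable_of_Icc hpq)]
    simp only [intervalIntegral.integral_const, smul_eq_mul, gapMean]
    have : q - p ≠ 0 := by linarith
    field_simp; ring

theorem memLp_gapSlope (hpq : p ≤ q) (hf : IntervalIntegrable f volume p q) :
    MemLp (gapSlope f p q) 2 (volume.restrict (Set.Ioo p q)) := by
  have hc := continuousOn_gapSlope hpq hf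
  obtain ⟨C, hC⟩ := isCompact_Icc.exists_bound_of_continuousOn hc
  refine MemLp.of_bound ((hc.mono Set.Ioo_subset_Icc_self).aestronglyMeasurable measurableSet_Ioo) C ?_
  exact (ae_restrict_mem measurableSet_Ioo).mono fun x hx => hC x (Set.Ioo_subset_Icc_self hx)

/-- Integration by parts against the primitive of `f`, which is absolutely continuous with
derivative `f` almost everywhere. The constant `gapMean f p q` drops out because `φ` vanishes at
both ends. -/
theorem integral_gapSlope_mul_deriv (hpq : p ≤ q) (hf : IntervalIntegrable f volume p q)
    {φ : ℝ → ℝ} (hφ : ContDiff ℝ 1 φ) (hp : φ p = 0) (hq : φ q = 0) :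
    ∫ x in p..q, gapSlope f p q x * deriv φ x = ∫ x in p..q, f x * φ x := by
  have hφ' : Continuous (deriv φ) := hφ.continuous_deriv le_rfl
  have hV : AbsolutelyContinuousOnInterval (fun x => ∫ y in p..x, f y) p q :=
    hf.absolutelyContinuousOnInterval_intervalIntegral (by simp)
  have h1 := hV.integral_mul_deriv_eq_deriv_mul hφ.contDiffOn.absolutelyContinuousOnInterval
  have h2 : ∫ x in p..q, deriv (fun x => ∫ y in p..x, f y) x * φ x = ∫ x in p..q, f x * φ x := by
    refine intervalIntegral.integral_congr_ae ?_
    filter_upwards [hf.ae_hasDerivAt_integral] with x hx hx2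
    rw [(hx (Set.uIoc_subset_uIcc hx2) p (by simp)).deriv]
  have h3 : ∫ x in p..q, deriv φ x = 0 := by
    rw [intervalIntegral.integral_deriv_eq_sub
      (fun x _ => (hφ.differentiable (by simp)) x) (hφ'.intervalIntegrable _ _), hp, hq, sub_zero]
  rw [h2, hp, hq] at h1
  simp only [gapSlope, sub_mul]
  have h4 : ContinuousOn (fun x => (∫ y in p..x, f y) * deriv φ x) (Set.Icc p q) :=
    (continuousOn_primitive_Icc hpq hf).mul hφ'.continuousOn
  rw [intervalIntegral.integral_sub ((hφ'.intervalIntegrable _ _).const_mul _)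
    (h4.intervalIntegrable_of_Icc hpq), intervalIntegral.integral_const_mul, h3, h1]
  ring

end Gap

/-! ### Compliance of the complement of a partition -/

section Partition

variable {t : ℕ → ℝ} {a b : ℝ} {N : ℕ}

theorem partition_mem (ht : Monotone t) (h0 : t 0 = a) (hN : t N = b) {i : ℕ} (hi : i < N) :
    Set.Icc (t i) (t (i + 1)) ⊆ Set.Icc a b :=
  Set.Icc_subset_Icc (h0 ▸ ht (Nat.zero_le i)) (hN ▸ ht hi)

/-- Monotonicity over all of `ℕ` prevents any `t j`, even with `j > N`, from lying strictly between
consecutive values. Repeated values are allowed and give empty gaps. -/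
theorem gap_subset (ht : Monotone t) (h0 : t 0 = a) (hN : t N = b) {i : ℕ} (hi : i < N) :
    Set.Ioo (t i) (t (i + 1)) ⊆ Set.Ioo a b \ Set.range t := by
  intro x hx
  refine ⟨⟨(h0 ▸ ht (Nat.zero_le i)).trans_lt hx.1, hx.2.trans_le (hN ▸ ht hi)⟩, ?_⟩
  rintro ⟨j, rfl⟩
  rcases Nat.lt_or_ge i j with h | h
  · exact absurd (ht h) (not_le.2 hx.2)
  · exact absurd (ht h) (not_le.2 hx.1)

theorem restrict_compl_range :
    volume.restrict (Set.Ioo a b \ Set.range t) = volume.restrict (Set.Ioc a b) := by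
  rw [← Measure.restrict_congr_set (Ioo_ae_eq_Ioc (μ := volume) (a := a) (b := b))]
  exact Measure.restrict_congr_set
    (sdiff_null_ae_eq_self ((Set.countable_range t).measure_zero volume))

theorem integral_compl_range (ht : Monotone t) (h0 : t 0 = a) (hN : t N = b) {h : ℝ → ℝ}
    (hh : Integrable h (volume.restrict (Set.Ioo a b \ Set.range t))) :
    ∫ x in Set.Ioo a b \ Set.range t, h x =
      ∑ i ∈ Finset.range N, ∫ x in t i..t (i + 1), h x := by
  have hab : a ≤ b := h0 ▸ hN ▸ ht (Nat.zero_le N)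
  rw [restrict_compl_range] at hh ⊢
  rw [intervalIntegral.sum_integral_adjacent_intervals, h0, hN, intervalIntegral.integral_of_le hab]
  intro i hi
  rw [intervalIntegrable_iff_integrableOn_Ioc_of_le (ht (Nat.le_succ i))]
  exact IntegrableOn.mono_set hh (Set.Ioc_subset_Ioc (h0 ▸ ht (Nat.zero_le i)) (hN ▸ ht hi))

theorem sum_indicator_gap (ht : Monotone t) {i : ℕ} (hi : i < N) (g : ℕ → ℝ → ℝ) {x : ℝ}
    (hx : x ∈ Set.Ioo (t i) (t (i + 1))) :
    ∑ j ∈ Finset.range N, (Set.Ioo (t j) (t (j + 1))).indicator (g j) x = g i x := by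
  rw [Finset.sum_eq_single i, Set.indicator_of_mem hx]
  · intro j _ hji
    refine Set.indicator_of_notMem (fun hx2 => ?_) _
    rcases lt_or_gt_of_ne hji with h | h
    · exact absurd (hx2.2.trans_le (ht h)) (not_lt.2 hx.1.le)
    · exact absurd (hx.2.trans_le (ht h)) (not_lt.2 hx2.1.le)
  · intro h; exact absurd (Finset.mem_range.2 hi) h

theorem intervalIntegral_congr_Ioo {p q : ℝ} (hpq : p ≤ q) {g h : ℝ → ℝ}
    (hgh : ∀ x ∈ Set.Ioo p q, g x = h x) : ∫ x in p..q, g x = ∫ x in p..q, h x := by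
  rw [intervalIntegral.integral_of_le hpq, intervalIntegral.integral_of_le hpq,
    integral_Ioc_eq_integral_Ioo, integral_Ioc_eq_integral_Ioo]
  exact setIntegral_congr_fun measurableSet_Ioo hgh

theorem intervalIntegrable_gap {f : ℝ → ℝ} (ht : Monotone t) (h0 : t 0 = a) (hN : t N = b)
    (hf : MemLp f 2 (volume.restrict (Set.Icc a b))) {i : ℕ} (hi : i < N) :
    IntervalIntegrable f volume (t i) (t (i + 1)) := by
  rw [intervalIntegrable_iff_integrableOn_Ioc_of_le (ht (Nat.le_succ i))]
  exact IntegrableOn.mono_set (hf.integrable one_le_two)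
    (Set.Ioc_subset_Icc_self.trans (partition_mem ht h0 hN hi))

/-- The gap solutions, extended by zero, add up to the weak solution: a test function vanishes at
every partition point, so the weak equation splits over the gaps. -/
theorem exists_isWeakSolution {f : ℝ → ℝ} (ht : Monotone t) (h0 : t 0 = a) (hN : t N = b)
    (hf : MemLp f 2 (volume.restrict (Set.Icc a b))) :
    ∃ u u', IsWeakSolution (Set.Ioo a b \ Set.range t) f u u' ∧
      ∫ x in Set.Ioo a b \ Set.range t, u' x ^ 2 =
        ∑ i ∈ Finset.range N, gapEnergy f (t i) (t (i + 1)) := by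
  set U := Set.Ioo a b \ Set.range t with hU
  set w : ℝ → ℝ := fun x => ∑ i ∈ Finset.range N,
    (Set.Ioo (t i) (t (i + 1))).indicator (gapSlope f (t i) (t (i + 1))) x with hw
  have hfU : MemLp f 2 (volume.restrict U) :=
    hf.mono_measure (Measure.restrict_mono (Set.sdiff_subset.trans Set.Ioo_subset_Icc_self) le_rfl)
  have hii : ∀ i < N, IntervalIntegrable f volume (t i) (t (i + 1)) := fun i hi =>
    intervalIntegrable_gap ht h0 hN hf hi
  have hstep : ∀ i, t i ≤ t (i + 1) := fun i => ht (Nat.le_succ i)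
  have hmem : MemH10 U _ w := memH10_sum (Finset.range N) fun i hi =>
    memH10_indicator (hstep i) (gap_subset ht h0 hN (Finset.mem_range.1 hi))
      (memLp_gapSlope (hstep i) (hii i (Finset.mem_range.1 hi)))
      (integral_gapSlope (hstep i) (hii i (Finset.mem_range.1 hi)))
  have hweq : ∀ i < N, ∀ x ∈ Set.Ioo (t i) (t (i + 1)), w x = gapSlope f (t i) (t (i + 1)) x :=
    fun i hi x hx => sum_indicator_gap ht hi _ hx
  refine ⟨_, w, isWeakSolution_of_test hfU hmem fun φ hφ => ?_, ?_⟩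
  · have hφ0 : ∀ i ≤ N, φ (t i) = 0 := fun i hi => by
      by_contra h
      exact (hφ.2.2 (subset_tsupport _ h)).2 ⟨i, rfl⟩
    rw [integral_compl_range ht h0 hN (integrable_mul_of_memLp_two hmem.2.1 (hφ.memLp_deriv _)),
      integral_compl_range ht h0 hN (integrable_mul_of_memLp_two hfU (hφ.memLp _))]
    refine Finset.sum_congr rfl fun i hi => ?_
    rw [Finset.mem_range] at hi
    rw [← integral_gapSlope_mul_deriv (hstep i) (hii i hi) (hφ.1.of_le (by simp)) (hφ0 i hi.le)
      (hφ0 (i + 1) hi)]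
    exact intervalIntegral_congr_Ioo (hstep i) fun x hx => by rw [hweq i hi x hx]
  · rw [integral_compl_range ht h0 hN hmem.2.1.integrable_sq]
    refine Finset.sum_congr rfl fun i hi => ?_
    exact intervalIntegral_congr_Ioo (hstep i) fun x hx => by
      rw [hweq i (Finset.mem_range.1 hi) x hx]

theorem compliance_compl_range {f : ℝ → ℝ} (ht : Monotone t) (h0 : t 0 = a) (hN : t N = b)
    (hf : MemLp f 2 (volume.restrict (Set.Icc a b))) :
    compliance (Set.Ioo a b \ Set.range t) f =
      ENNReal.ofReal (∑ i ∈ Finset.range N, gapEnergy f (t i) (t (i + 1))) := by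
  obtain ⟨u, u', hu, he⟩ := exists_isWeakSolution ht h0 hN hf
  rw [hu.compliance_eq, hu.integral_eq_energy, he]

/-- Adding Dirichlet points decreases the compliance. -/
theorem compliance_compl_range_le {f : ℝ → ℝ} (ht : Monotone t) (h0 : t 0 = a) (hN : t N = b)
    (hf : MemLp f 2 (volume.restrict (Set.Icc a b))) {S : Set ℝ}
    (hS : S ∩ Set.Ioo a b ⊆ Set.range t) :
    ENNReal.ofReal (∑ i ∈ Finset.range N, gapEnergy f (t i) (t (i + 1))) ≤
      compliance (Set.Ioo a b \ S) f := by
  obtain ⟨u, u', hu, he⟩ := exists_isWeakSolution ht h0 hN hf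
  rw [← compliance_compl_range ht h0 hN hf]
  refine compliance_mono (fun x hx => ⟨hx.1, fun h => hx.2 (hS ⟨h, hx.1⟩)⟩) ?_ hu
  refine measure_mono_null (fun x hx => ?_) ((Set.countable_range t).measure_zero volume)
  by_contra h
  exact hx.2 ⟨hx.1.1, h⟩

end Partition

/-! ### Comparison of gap energies with those of constant loads -/

section GapEstimates

variable {f g : ℝ → ℝ} {p q : ℝ}

theorem gapSlope_sub (hpq : p ≤ q) (hf : IntervalIntegrable f volume p q)
    (hg : IntervalIntegrable g volume p q) {x : ℝ} (hx : x ∈ Set.Icc p q) :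
    gapSlope (fun y => f y - g y) p q x = gapSlope f p q x - gapSlope g p q x := by
  have h1 : ∀ x ∈ Set.Icc p q, ∫ y in p..x, (f y - g y) = (∫ y in p..x, f y) - ∫ y in p..x, g y := by
    intro x hx
    have hsub : Set.uIcc p x ⊆ Set.uIcc p q := by
      rw [Set.uIcc_of_le hx.1, Set.uIcc_of_le hpq]
      exact Set.Icc_subset_Icc_right hx.2
    exact intervalIntegral.integral_sub (hf.mono_set hsub) (hg.mono_set hsub)
  have h2 : ∫ x in p..q, ∫ y in p..x, (f y - g y) =
      (∫ x in p..q, ∫ y in p..x, f y) - ∫ x in p..q, ∫ y in p..x, g y := by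
    rw [← intervalIntegral.integral_sub
      ((continuousOn_primitive_Icc hpq hf).intervalIntegrable_of_Icc hpq)
      ((continuousOn_primitive_Icc hpq hg).intervalIntegrable_of_Icc hpq)]
    refine intervalIntegral.integral_congr fun x hx => ?_
    rw [Set.uIcc_of_le hpq] at hx
    exact h1 x hx
  simp only [gapSlope, gapMean, h1 x hx, h2]
  ring

/-- The slope is linear in the load, and `X² ≤ (1 + θ) Y² + (1 + θ⁻¹) (X - Y)²`. -/
theorem gapEnergy_le_add (hpq : p ≤ q) (hf : IntervalIntegrable f volume p q)
    (hg : IntervalIntegrable g volume p q) {θ : ℝ} (hθ : 0 < θ) :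
    gapEnergy f p q ≤
      (1 + θ) * gapEnergy g p q + (1 + θ⁻¹) * gapEnergy (fun y => f y - g y) p q := by
  have hcf := continuousOn_gapSlope hpq hf
  have hcg := continuousOn_gapSlope hpq hg
  have hch := continuousOn_gapSlope hpq (hf.sub hg)
  have i1 : IntervalIntegrable (fun x => gapSlope g p q x ^ 2) volume p q :=
    (hcg.pow 2).intervalIntegrable_of_Icc hpq
  have i2 : IntervalIntegrable (fun x => gapSlope (fun y => f y - g y) p q x ^ 2) volume p q :=
    (hch.pow 2).intervalIntegrable_of_Icc hpq
  simp only [gapEnergy]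
  rw [← intervalIntegral.integral_const_mul, ← intervalIntegral.integral_const_mul,
    ← intervalIntegral.integral_add (i1.const_mul _) (i2.const_mul _)]
  refine intervalIntegral.integral_mono_on hpq ((hcf.pow 2).intervalIntegrable_of_Icc hpq)
    ((i1.const_mul _).add (i2.const_mul _)) fun x hx => ?_
  rw [gapSlope_sub hpq hf hg hx]
  set X := gapSlope f p q x
  set Y := gapSlope g p q x
  have h1 : 0 ≤ θ⁻¹ * (θ * Y - (X - Y)) ^ 2 := by positivity
  have h2 : θ⁻¹ * (θ * Y - (X - Y)) ^ 2 = θ * Y ^ 2 - 2 * Y * (X - Y) + θ⁻¹ * (X - Y) ^ 2 := by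
    field_simp
    ring
  nlinarith

/-- Subtracting the mean only decreases `∫ V²`, where `V` is the primitive of `f`, and
Cauchy–Schwarz gives `V(x)² ≤ (q - p) ∫ f²`. -/
theorem gapEnergy_le_sq_mul (hpq : p ≤ q) (hf : MemLp f 2 (volume.restrict (Set.Ioc p q))) :
    gapEnergy f p q ≤ (q - p) ^ 2 * ∫ x in p..q, f x ^ 2 := by
  have hfi : IntervalIntegrable f volume p q :=
    (intervalIntegrable_iff_integrableOn_Ioc_of_le hpq).2 (hf.integrable one_le_two)
  rcases hpq.eq_or_lt with rfl | hlt
  · simp [gapEnergy]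
  set V : ℝ → ℝ := fun x => ∫ y in p..x, f y with hV
  have hVc : ContinuousOn V (Set.Icc p q) := continuousOn_primitive_Icc hpq hfi
  have hVi := hVc.intervalIntegrable_of_Icc (μ := volume) hpq
  have hV2 : IntervalIntegrable (fun x => V x ^ 2) volume p q :=
    (hVc.pow 2).intervalIntegrable_of_Icc hpq
  set m := gapMean f p q with hm
  have hmV : ∫ x in p..q, V x = (q - p) * m := by
    rw [hm, gapMean]
    have : q - p ≠ 0 := by linarith
    rw [mul_inv_cancel_left₀ this]
  have h1 : gapEnergy f p q = (∫ x in p..q, V x ^ 2) - (q - p) * m ^ 2 := by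
    have e : ∀ x, gapSlope f p q x ^ 2 = V x ^ 2 - (2 * m * V x - m ^ 2) := fun x => by
      simp only [gapSlope, hV, ← hm]; ring
    simp only [gapEnergy, e]
    rw [intervalIntegral.integral_sub hV2 ((hVi.const_mul _).sub intervalIntegrable_const),
      intervalIntegral.integral_sub (hVi.const_mul _) intervalIntegrable_const,
      intervalIntegral.integral_const_mul, hmV]
    simp only [intervalIntegral.integral_const, smul_eq_mul]
    ring
  have h2 : ∀ x ∈ Set.Icc p q, V x ^ 2 ≤ (q - p) * ∫ x in p..q, f x ^ 2 := by
    intro x hx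
    have hsub : Set.Ioc p x ⊆ Set.Ioc p q := Set.Ioc_subset_Ioc_right hx.2
    have hfx : MemLp f 2 (volume.restrict (Set.Ioc p x)) :=
      hf.mono_measure (Measure.restrict_mono hsub le_rfl)
    have h3 := sq_integral_mul_le (memLp_const (1 : ℝ)) hfx
    simp only [one_mul, one_pow, integral_const, MeasurableSet.univ, measureReal_restrict_apply,
      Set.univ_inter, Real.volume_real_Ioc_of_le hx.1, smul_eq_mul, mul_one] at h3
    simp only [hV, intervalIntegral.integral_of_le hx.1, intervalIntegral.integral_of_le hpq]
    refine h3.trans (mul_le_mul (by linarith [hx.2]) ?_ (integral_nonneg fun _ => sq_nonneg _)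
      (by linarith))
    exact setIntegral_mono_set hf.integrable_sq (ae_of_all _ fun _ => sq_nonneg _)
      (ae_of_all _ hsub)
  have h4 : ∫ x in p..q, V x ^ 2 ≤ ∫ x in p..q, (q - p) * ∫ x in p..q, f x ^ 2 :=
    intervalIntegral.integral_mono_on hpq hV2 (by simp) h2
  rw [intervalIntegral.integral_const, smul_eq_mul] at h4
  rw [h1]
  have : 0 ≤ (q - p) * m ^ 2 := mul_nonneg (by linarith) (sq_nonneg _)
  nlinarith

theorem gapEnergy_const (hpq : p ≤ q) (c : ℝ) :
    gapEnergy (fun _ => c) p q = c ^ 2 * (q - p) ^ 3 / 12 := by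
  rcases hpq.eq_or_lt with rfl | hlt
  · simp [gapEnergy]
  have h1 : ∫ x in p..q, (x - p) * c = (q - p) ^ 2 / 2 * c := by
    rw [intervalIntegral.integral_mul_const, intervalIntegral.integral_sub (by simp) (by simp), integral_id,
      intervalIntegral.integral_const, smul_eq_mul]
    ring
  have h2 : ∀ x, gapSlope (fun _ => c) p q x = c * ((p + q) / 2 - x) := fun x => by
    simp only [gapSlope, gapMean, intervalIntegral.integral_const, smul_eq_mul, h1]
    have : q - p ≠ 0 := by linarith
    field_simp; ring
  simp only [gapEnergy, h2]
  rw [intervalIntegral.integral_eq_sub_of_hasDerivAt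
    (f := fun x => -(c ^ 2 * ((p + q) / 2 - x) ^ 3 / 3)) (fun x _ => ?_)
    (by apply Continuous.intervalIntegrable; fun_prop)]
  · ring
  · have := (((((hasDerivAt_id x).const_sub ((p + q) / 2)).pow 3).const_mul (c ^ 2)).div_const 3).neg
    refine this.congr_deriv ?_
    simp; ring

theorem gapEnergy_le_of_const (hpq : p ≤ q) (hf : MemLp f 2 (volume.restrict (Set.Ioc p q)))
    (c : ℝ) {θ : ℝ} (hθ : 0 < θ) :
    gapEnergy f p q ≤ (1 + θ) * (c ^ 2 * (q - p) ^ 3 / 12) +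
      (1 + θ⁻¹) * ((q - p) ^ 2 * ∫ x in p..q, (f x - c) ^ 2) := by
  have hfi : IntervalIntegrable f volume p q :=
    (intervalIntegrable_iff_integrableOn_Ioc_of_le hpq).2 (hf.integrable one_le_two)
  refine (gapEnergy_le_add (g := fun _ => c) hpq hfi (by simp) hθ).trans ?_
  rw [gapEnergy_const hpq]
  gcongr
  exact gapEnergy_le_sq_mul hpq (hf.sub (memLp_const c))

theorem const_le_gapEnergy (hpq : p ≤ q) (hf : MemLp f 2 (volume.restrict (Set.Ioc p q)))
    (c : ℝ) {θ : ℝ} (hθ : 0 < θ) :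
    c ^ 2 * (q - p) ^ 3 / 12 ≤ (1 + θ) * gapEnergy f p q +
      (1 + θ⁻¹) * ((q - p) ^ 2 * ∫ x in p..q, (f x - c) ^ 2) := by
  have hfi : IntervalIntegrable f volume p q :=
    (intervalIntegrable_iff_integrableOn_Ioc_of_le hpq).2 (hf.integrable one_le_two)
  rw [← gapEnergy_const hpq]
  refine (gapEnergy_le_add (f := fun _ => c) hpq (by simp) hfi hθ).trans ?_
  gcongr
  have h := gapEnergy_le_sq_mul hpq ((memLp_const c).sub hf)
  have e : ∀ x, (f x - c) ^ 2 = (c - f x) ^ 2 := fun x => by ring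
  simp only [e]
  exact h

end GapEstimates

/-! ### Partitions from finite sets and grids -/

/-- A finite set containing both endpoints of an interval is the range of a partition. -/
theorem exists_partition_of_finset {a b : ℝ} (S : Finset ℝ) (ha : a ∈ S) (hb : b ∈ S)
    (hS : ∀ x ∈ S, x ∈ Set.Icc a b) :
    ∃ (t : ℕ → ℝ) (N : ℕ), Monotone t ∧ t 0 = a ∧ t N = b ∧ Set.range t = S ∧
      ∀ G : ℝ → ℝ, ∑ i ∈ Finset.range N, G (t i) = ∑ s ∈ S.erase b, G s := by
  classical
  obtain ⟨k, hk⟩ : ∃ k, S.card = k + 1 :=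
    ⟨S.card - 1, (Nat.succ_pred_eq_of_pos (Finset.card_pos.2 ⟨a, ha⟩)).symm⟩
  set e := S.orderEmbOfFin hk with he
  -- Frozen at its last value `b` beyond `k`: the sequence stays monotone and its range is exactly
  -- `S`.
  set t : ℕ → ℝ := fun i => e ⟨min i k, by omega⟩ with ht
  have hmin : e ⟨0, by omega⟩ = a := by
    rw [he, Finset.orderEmbOfFin_zero hk (by omega)]
    exact le_antisymm (Finset.min'_le _ _ ha) (Finset.le_min' _ _ _ fun y hy => (hS y hy).1)
  have hmax : e ⟨k, by omega⟩ = b := by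
    have := Finset.orderEmbOfFin_last hk (by omega)
    rw [he]
    refine Eq.trans ?_ (this.trans ?_)
    · rfl
    · exact le_antisymm (Finset.max'_le _ _ _ fun y hy => (hS y hy).2) (Finset.le_max' _ _ hb)
  have htk : t k = b := by rw [← hmax]; simp [ht]
  refine ⟨t, k, fun i j hij => ?_, by simpa [ht] using hmin, htk, ?_, fun G => ?_⟩
  · exact e.monotone (by simp only [Fin.mk_le_mk]; omega)
  · rw [← Finset.range_orderEmbOfFin S hk]
    refine Set.Subset.antisymm ?_ ?_
    · rintro _ ⟨i, rfl⟩; exact ⟨_, rfl⟩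
    · rintro _ ⟨i, rfl⟩
      refine ⟨i, ?_⟩
      simp only [ht, ← he]
      congr 1
      ext; simp; omega
  · refine Finset.sum_bij (fun i _ => t i) (fun i hi => ?_) (fun i hi j hj hij => ?_)
      (fun s hs => ?_) (fun i hi => rfl)
    · rw [Finset.mem_range] at hi
      refine Finset.mem_erase.2 ⟨fun h => ?_, Finset.orderEmbOfFin_mem _ _ _⟩
      rw [← hmax] at h
      have := e.injective h
      simp only [Fin.mk.injEq] at this
      omega
    · rw [Finset.mem_range] at hi hj
      have := e.injective hij
      simp only [Fin.mk.injEq] at this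
      omega
    · obtain ⟨hsb, hsS⟩ := Finset.mem_erase.1 hs
      rw [← Finset.mem_coe, ← Finset.range_orderEmbOfFin S hk] at hsS
      obtain ⟨i, rfl⟩ := hsS
      have hik : (i : ℕ) ≠ k := by
        intro h; apply hsb; rw [← hmax, ← he]; congr 1; ext; exact h
      refine ⟨i, Finset.mem_range.2 (by omega), ?_⟩
      simp only [ht, ← he]
      congr 1
      ext; simp; omega

/-- Adjoining the points of a uniform grid to a finite set. -/
theorem exists_partition_with_grid {a b : ℝ} (hab : a < b) (S : Finset ℝ)
    (hS : ∀ x ∈ S, x ∈ Set.Icc a b) {M : ℕ} (hM : 0 < M) :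
    ∃ (t : ℕ → ℝ) (N : ℕ), Monotone t ∧ t 0 = a ∧ t N = b ∧ ↑S ⊆ Set.range t ∧
      (∀ i < N, t (i + 1) - t i ≤ (b - a) / M) ∧
      ∀ G : ℝ → ℝ, (∀ x, 0 ≤ G x) → ∑ i ∈ Finset.range N, G (t i) ≤
        ∑ s ∈ S, G s + ∑ j ∈ Finset.range M, G (a + j * ((b - a) / M)) := by
  classical
  set h := (b - a) / M with hh
  have hM' : (0 : ℝ) < M := Nat.cast_pos.2 hM
  have hh0 : 0 < h := div_pos (by linarith) hM'
  have hMh : M * h = b - a := by rw [hh]; field_simp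
  set Q : Finset ℝ := (Finset.range M).image fun j : ℕ => a + j * h with hQ
  have hQmem : ∀ x ∈ Q, x ∈ Set.Icc a b := by
    intro x hx
    obtain ⟨j, hj, rfl⟩ := Finset.mem_image.1 hx
    have hj' : (j : ℝ) ≤ M := by exact_mod_cast (Finset.mem_range.1 hj).le
    constructor
    · nlinarith [show (0 : ℝ) ≤ j from Nat.cast_nonneg j]
    · nlinarith
  have haQ : a ∈ Q := Finset.mem_image.2 ⟨0, Finset.mem_range.2 hM, by simp⟩
  obtain ⟨t, N, ht, h0, hN, hr, hsum⟩ := exists_partition_of_finset (a := a) (b := b)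
    (insert b (S ∪ Q)) (by simp [haQ]) (by simp) (by
      intro x hx
      rcases Finset.mem_insert.1 hx with rfl | hx
      · exact ⟨hab.le, le_rfl⟩
      rcases Finset.mem_union.1 hx with hx | hx
      · exact hS x hx
      · exact hQmem x hx)
  refine ⟨t, N, ht, h0, hN, ?_, fun i hi => ?_, fun G hG => ?_⟩
  · rw [hr]; intro x hx; simp [Finset.mem_coe.1 hx]
  -- In a gap longer than `h` the first grid point to the right of `t i` would be interior, although
  -- grid points belong to the range of `t`.
  · by_contra! hlt
    have hta : 0 ≤ (t i - a) / h :=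
      div_nonneg (by have := ht (Nat.zero_le i); rw [h0] at this; linarith) hh0.le
    set j := ⌊(t i - a) / h⌋₊ with hj
    have h1 : (j : ℝ) * h ≤ t i - a := (le_div_iff₀ hh0).1 (Nat.floor_le hta)
    have h2 : t i - a < (j + 1) * h := (div_lt_iff₀ hh0).1 (Nat.lt_floor_add_one _)
    have h3 : a + (j + 1 : ℕ) * h ∈ Set.Ioo (t i) (t (i + 1)) := by
      push_cast; constructor <;> nlinarith
    refine (gap_subset ht h0 hN hi h3).2 ?_
    rw [hr]
    have h4 : (((j + 1 : ℕ) : ℝ)) < M := by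
      have := (partition_mem ht h0 hN hi (Set.Ioo_subset_Icc_self h3)).2
      have h5 := (gap_subset ht h0 hN hi h3).1.2
      by_contra! h6
      nlinarith
    have h5 : j + 1 < M := by exact_mod_cast h4
    refine Finset.mem_coe.2 (Finset.mem_insert_of_mem (Finset.mem_union_right _ ?_))
    exact Finset.mem_image.2 ⟨j + 1, Finset.mem_range.2 h5, rfl⟩
  · rw [hsum]
    have h1 : ∑ j ∈ Finset.range M, G (a + j * h) = ∑ s ∈ Q, G s := by
      rw [hQ, Finset.sum_image]
      intro i _ j _ hij
      have : (i : ℝ) * h = j * h := by linarith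
      exact_mod_cast mul_right_cancel₀ hh0.ne' this
    rw [h1]
    calc ∑ s ∈ (insert b (S ∪ Q)).erase b, G s ≤ ∑ s ∈ S ∪ Q, G s :=
          Finset.sum_le_sum_of_subset_of_nonneg (Finset.erase_insert_subset _ _) fun x _ _ => hG x
      _ ≤ ∑ s ∈ S ∪ Q, G s + ∑ s ∈ S ∩ Q, G s :=
          le_add_of_nonneg_right (Finset.sum_nonneg fun x _ => hG x)
      _ = _ := Finset.sum_union_inter

/-! ### Riemann sums over fine partitions -/

section Riemann

variable {t : ℕ → ℝ} {a b δ ω : ℝ} {N : ℕ}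

theorem sum_gap_lengths (h0 : t 0 = a) (hN : t N = b) :
    ∑ i ∈ Finset.range N, (t (i + 1) - t i) = b - a := by
  rw [Finset.sum_range_sub, h0, hN]

theorem sum_integral_gaps {h : ℝ → ℝ} (ht : Monotone t) (h0 : t 0 = a) (hN : t N = b)
    (hh : IntegrableOn h (Set.Icc a b)) :
    ∑ i ∈ Finset.range N, ∫ x in t i..t (i + 1), h x = ∫ x in a..b, h x := by
  rw [intervalIntegral.sum_integral_adjacent_intervals, h0, hN]
  intro i hi
  rw [intervalIntegrable_iff_integrableOn_Ioc_of_le (ht (Nat.le_succ i))]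
  exact hh.mono_set (Set.Ioc_subset_Icc_self.trans (partition_mem ht h0 hN hi))

theorem abs_riemann_sum_sub_le {G : ℝ → ℝ} (hG : Continuous G) (ht : Monotone t) (h0 : t 0 = a)
    (hN : t N = b) (hmesh : ∀ i < N, t (i + 1) - t i ≤ δ)
    (hosc : ∀ x y, |x - y| ≤ δ → |G x - G y| ≤ ω) :
    |∑ i ∈ Finset.range N, G (t i) * (t (i + 1) - t i) - ∫ x in a..b, G x| ≤ ω * (b - a) := by
  rw [← sum_integral_gaps ht h0 hN (hG.continuousOn.integrableOn_compact isCompact_Icc),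
    ← Finset.sum_sub_distrib, ← sum_gap_lengths h0 hN, Finset.mul_sum]
  refine (Finset.abs_sum_le_sum_abs _ _).trans (Finset.sum_le_sum fun i hi => ?_)
  rw [Finset.mem_range] at hi
  have hle : t i ≤ t (i + 1) := ht (Nat.le_succ i)
  have h1 : G (t i) * (t (i + 1) - t i) - ∫ x in t i..t (i + 1), G x =
      ∫ x in t i..t (i + 1), (G (t i) - G x) := by
    rw [intervalIntegral.integral_sub (by simp) (hG.intervalIntegrable _ _)]
    simp [mul_comm]
  rw [h1]
  have h2 := intervalIntegral.norm_integral_le_of_norm_le_const (a := t i) (b := t (i + 1)) (C := ω)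
    (f := fun x => G (t i) - G x) (fun x hx => ?_)
  · rwa [Real.norm_eq_abs, abs_of_nonneg (show 0 ≤ t (i + 1) - t i by linarith)] at h2
  · rw [Set.uIoc_of_le hle] at hx
    refine hosc _ _ ?_
    have := hmesh i hi
    rw [abs_le]; constructor <;> linarith [hx.1, hx.2]

theorem memLp_gap {f : ℝ → ℝ} (ht : Monotone t) (h0 : t 0 = a) (hN : t N = b)
    (hf : MemLp f 2 (volume.restrict (Set.Icc a b))) {i : ℕ} (hi : i < N) :
    MemLp f 2 (volume.restrict (Set.Ioc (t i) (t (i + 1)))) :=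
  hf.mono_measure (Measure.restrict_mono
    (Set.Ioc_subset_Icc_self.trans (partition_mem ht h0 hN hi)) le_rfl)

theorem sum_integral_sub_const_sq_le {f g : ℝ → ℝ} (hg : Continuous g)
    (hf : MemLp f 2 (volume.restrict (Set.Icc a b))) (ht : Monotone t) (h0 : t 0 = a)
    (hN : t N = b) (hmesh : ∀ i < N, t (i + 1) - t i ≤ δ)
    (hosc : ∀ x y, |x - y| ≤ δ → |g x - g y| ≤ ω) :
    ∑ i ∈ Finset.range N, ∫ x in t i..t (i + 1), (f x - g (t i)) ^ 2 ≤
      2 * (∫ x in a..b, (f x - g x) ^ 2) + 2 * ω ^ 2 * (b - a) := by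
  have hgL : MemLp g 2 (volume.restrict (Set.Icc a b)) := by
    obtain ⟨C, hC⟩ := isCompact_Icc.exists_bound_of_continuousOn (hg.continuousOn (s := Set.Icc a b))
    exact MemLp.of_bound hg.aestronglyMeasurable C
      ((ae_restrict_mem measurableSet_Icc).mono fun x hx => hC x hx)
  have hfg := (hf.sub hgL).integrable_sq
  simp only [Pi.sub_apply] at hfg
  rw [← sum_integral_gaps ht h0 hN hfg, ← sum_gap_lengths h0 hN, Finset.mul_sum, Finset.mul_sum,
    ← Finset.sum_add_distrib]
  refine Finset.sum_le_sum fun i hi => ?_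
  rw [Finset.mem_range] at hi
  have hle : t i ≤ t (i + 1) := ht (Nat.le_succ i)
  have i1 : IntervalIntegrable (fun x => (f x - g x) ^ 2) volume (t i) (t (i + 1)) :=
    (intervalIntegrable_iff_integrableOn_Ioc_of_le hle).2 <|
      IntegrableOn.mono_set hfg (Set.Ioc_subset_Icc_self.trans (partition_mem ht h0 hN hi))
  have i2 : IntervalIntegrable (fun x => (f x - g (t i)) ^ 2) volume (t i) (t (i + 1)) :=
    (intervalIntegrable_iff_integrableOn_Ioc_of_le hle).2 <|
      ((memLp_gap ht h0 hN hf hi).sub (memLp_const (g (t i)))).integrable_sq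
  calc ∫ x in t i..t (i + 1), (f x - g (t i)) ^ 2
      ≤ ∫ x in t i..t (i + 1), (2 * (f x - g x) ^ 2 + 2 * ω ^ 2) := by
        refine intervalIntegral.integral_mono_on hle i2
          ((i1.const_mul 2).add intervalIntegrable_const) fun x hx => ?_
        have h1 : |g x - g (t i)| ≤ ω := hosc _ _ (by
          have := hmesh i hi
          rw [abs_le]; constructor <;> linarith [hx.1, hx.2])
        have h2 : (g x - g (t i)) ^ 2 ≤ ω ^ 2 := sq_le_sq' (by linarith [(abs_le.1 h1).1])
          (abs_le.1 h1).2
        nlinarith [sq_nonneg ((f x - g x) - (g x - g (t i)))]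
    _ = _ := by
        rw [intervalIntegral.integral_add (i1.const_mul 2) intervalIntegrable_const,
          intervalIntegral.integral_const_mul]
        simp; ring

end Riemann

/-! ### The linearised lower bound for the compliance -/

/-- The tangent line to `l³` at `s`; the difference is `(l - s)² (l + 2 s)`. -/
theorem three_mul_sq_mul_sub_le {l s : ℝ} (hl : 0 ≤ l) (hs : 0 ≤ s) :
    3 * s ^ 2 * l - 2 * s ^ 3 ≤ l ^ 3 := by
  nlinarith [mul_nonneg (sq_nonneg (l - s)) (show 0 ≤ l + 2 * s by linarith)]

/-- With the tangent taken at `s = ψ (t i) / n`, the factor `n²` turns the cubic energy into one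
term linear in the gap length, giving a Riemann sum, and one term of weight `n⁻¹` at each partition
point, comparable with an empirical integral. -/
theorem riemann_sum_le_energy {t : ℕ → ℝ} {a b δ ω : ℝ} {N : ℕ} {f g ψ : ℝ → ℝ}
    (hf : MemLp f 2 (volume.restrict (Set.Icc a b))) (hg : Continuous g) (hψ : Continuous ψ)
    (hψ0 : ∀ x, 0 ≤ ψ x) (ht : Monotone t) (h0 : t 0 = a) (hN : t N = b)
    (hmesh : ∀ i < N, t (i + 1) - t i ≤ δ)
    (hosc : ∀ x y, |x - y| ≤ δ → |g x - g y| ≤ ω)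
    (hosc2 : ∀ x y, |x - y| ≤ δ → |g x ^ 2 * ψ x ^ 2 - g y ^ 2 * ψ y ^ 2| ≤ ω)
    {n θ : ℝ} (hn : 0 < n) (hθ : 0 < θ) :
    (1 / 12) * (3 * ((∫ x in a..b, g x ^ 2 * ψ x ^ 2) - ω * (b - a)) -
        2 * (n⁻¹ * ∑ i ∈ Finset.range N, g (t i) ^ 2 * ψ (t i) ^ 3)) ≤
      (1 + θ) * (n ^ 2 * ∑ i ∈ Finset.range N, gapEnergy f (t i) (t (i + 1))) +
      (1 + θ⁻¹) * ((n * δ) ^ 2 *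
        (2 * (∫ x in a..b, (f x - g x) ^ 2) + 2 * ω ^ 2 * (b - a))) := by
  have h1 := abs_riemann_sum_sub_le (G := fun x => g x ^ 2 * ψ x ^ 2) (by fun_prop) ht h0 hN hmesh
    hosc2
  have h2 := sum_integral_sub_const_sq_le hg hf ht h0 hN hmesh hosc
  have h3 : ∀ i ∈ Finset.range N,
      (1 / 12) * (3 * (g (t i) ^ 2 * ψ (t i) ^ 2 * (t (i + 1) - t i)) -
        2 * (n⁻¹ * (g (t i) ^ 2 * ψ (t i) ^ 3))) ≤
      (1 + θ) * (n ^ 2 * gapEnergy f (t i) (t (i + 1))) +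
      (1 + θ⁻¹) * ((n * δ) ^ 2 * ∫ x in t i..t (i + 1), (f x - g (t i)) ^ 2) := by
    intro i hi
    rw [Finset.mem_range] at hi
    have hle : t i ≤ t (i + 1) := ht (Nat.le_succ i)
    have hl : 0 ≤ t (i + 1) - t i := by linarith
    have h4 := const_le_gapEnergy hle (memLp_gap ht h0 hN hf hi) (g (t i)) hθ
    have h5 := three_mul_sq_mul_sub_le hl (div_nonneg (hψ0 (t i)) hn.le)
    have h6 : 0 ≤ ∫ x in t i..t (i + 1), (f x - g (t i)) ^ 2 :=
      intervalIntegral.integral_nonneg hle fun _ _ => sq_nonneg _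
    have h7 : (t (i + 1) - t i) ^ 2 ≤ δ ^ 2 := pow_le_pow_left₀ hl (hmesh i hi) 2
    set l := t (i + 1) - t i
    set I := ∫ x in t i..t (i + 1), (f x - g (t i)) ^ 2
    set E := gapEnergy f (t i) (t (i + 1))
    set c := g (t i)
    set s := ψ (t i)
    calc (1 / 12) * (3 * (c ^ 2 * s ^ 2 * l) - 2 * (n⁻¹ * (c ^ 2 * s ^ 3)))
        = n ^ 2 * c ^ 2 / 12 * (3 * (s / n) ^ 2 * l - 2 * (s / n) ^ 3) := by
          field_simp
      _ ≤ n ^ 2 * c ^ 2 / 12 * l ^ 3 := by gcongr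
      _ = n ^ 2 * (c ^ 2 * l ^ 3 / 12) := by ring
      _ ≤ n ^ 2 * ((1 + θ) * E + (1 + θ⁻¹) * (l ^ 2 * I)) := by gcongr
      _ ≤ n ^ 2 * ((1 + θ) * E + (1 + θ⁻¹) * (δ ^ 2 * I)) := by gcongr
      _ = _ := by ring
  have h8 := Finset.sum_le_sum h3
  rw [← Finset.mul_sum, Finset.sum_sub_distrib, ← Finset.mul_sum, ← Finset.mul_sum,
    ← Finset.mul_sum, Finset.sum_add_distrib, ← Finset.mul_sum, ← Finset.mul_sum, ← Finset.mul_sum,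
    ← Finset.mul_sum] at h8
  refine le_trans ?_ (h8.trans ?_)
  · have := (abs_le.1 h1).1
    gcongr
    linarith
  · gcongr

/-- Joint continuity at the origin allows `ω` to be fixed before `n` tends to infinity. -/
theorem exists_pos_eventually_lt {err : ℝ × ℝ → ℝ} (hc : Continuous err) {ε : ℝ}
    (h0 : err (0, 0) < ε) : ∃ ω > 0, ∀ᶠ n : ℕ in atTop, err (ω, (n : ℝ)⁻¹) < ε := by
  have h1 : ∀ᶠ p in 𝓝 (0 : ℝ) ×ˢ 𝓝 (0 : ℝ), err p < ε := by
    rw [← nhds_prod_eq]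
    exact hc.tendsto (0, 0) (gt_mem_nhds h0)
  have h2 : ∀ᶠ ω in 𝓝[>] (0 : ℝ), ∀ᶠ y in 𝓝 (0 : ℝ), err (ω, y) < ε :=
    nhdsWithin_le_nhds h1.curry
  obtain ⟨ω, hω, hω0⟩ := (h2.and self_mem_nhdsWithin).exists
  exact ⟨ω, hω0, (tendsto_inv_atTop_zero.comp tendsto_natCast_atTop_atTop).eventually hω⟩

/-- Asymptotic lower bound for the compliance in terms of the empirical measure, tested against
continuous functions. -/
theorem eventually_le_compliance {a b : ℝ} (hab : a < b) {f g ψ : ℝ → ℝ}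
    (hf : MemLp f 2 (volume.restrict (Set.Icc a b))) (hg : Continuous g)
    (hgc : HasCompactSupport g) (hψ : Continuous ψ) (hψ0 : ∀ x, 0 ≤ ψ x)
    {m : ℕ} (hm : 0 < m) {θ ε : ℝ} (hθ : 0 < θ) (hε : 0 < ε) :
    ∀ᶠ n : ℕ in atTop, ∀ S : Finset ℝ, (∀ x ∈ S, x ∈ Set.Icc a b) → ∀ B : ℝ,
      (n : ℝ)⁻¹ * ∑ s ∈ S, g s ^ 2 * ψ s ^ 3 ≤ B →
      ENNReal.ofReal (((1 / 12) * (3 * (∫ x in a..b, g x ^ 2 * ψ x ^ 2) - 2 * B -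
          2 * ((m * (b - a))⁻¹ * ∫ x in a..b, g x ^ 2 * ψ x ^ 3)) -
        (1 + θ⁻¹) * ((m * (b - a)) ^ 2 * (2 * ∫ x in a..b, (f x - g x) ^ 2)) - ε) / (1 + θ)) ≤
      (n : ℝ≥0∞) ^ 2 * compliance (Set.Ioo a b \ S) f := by
  have hm' : (0 : ℝ) < m := Nat.cast_pos.2 hm
  have hba : 0 < b - a := by linarith
  set P := ∫ x in a..b, g x ^ 2 * ψ x ^ 2 with hP
  set Q := ∫ x in a..b, g x ^ 2 * ψ x ^ 3 with hQ
  set D := ∫ x in a..b, (f x - g x) ^ 2 with hD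
  -- All errors depending on the oscillation `ω` and on `n⁻¹`. The limiting grid contribution `(m *
  -- (b - a))⁻¹ * Q` is part of the claimed bound, so only the excess over it is counted and `err`
  -- vanishes at the origin.
  let err : ℝ × ℝ → ℝ := fun p =>
    (1 / 12) * (3 * (p.1 * (b - a)) +
      2 * ((1 / m + p.2) * (b - a)⁻¹ * (Q + p.1 * (b - a)) - (m * (b - a))⁻¹ * Q)) +
      (1 + θ⁻¹) * ((m * (b - a)) ^ 2 * (2 * p.1 ^ 2 * (b - a)))
  have herr0 : err (0, 0) = 0 := by
    simp only [err]; field_simp; ring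
  have hc : Continuous err := by fun_prop
  obtain ⟨ω, hω0, hω⟩ := exists_pos_eventually_lt hc (by rw [herr0]; exact hε)
  have huc : ∀ G : ℝ → ℝ, Continuous G → HasCompactSupport G →
      ∃ δ > 0, ∀ x y, |x - y| ≤ δ → |G x - G y| ≤ ω := by
    intro G hG hGc
    obtain ⟨δ, hδ, h⟩ := Metric.uniformContinuous_iff.1 (hGc.uniformContinuous_of_continuous hG) ω hω0
    exact ⟨δ / 2, half_pos hδ, fun x y hxy => (h (by rw [Real.dist_eq]; linarith)).le⟩
  obtain ⟨δ₁, hδ₁, ho1⟩ := huc g hg hgc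
  obtain ⟨δ₂, hδ₂, ho2⟩ := huc (fun x => g x ^ 2 * ψ x ^ 2) (by fun_prop)
    (hgc.mono fun x hx hgx => hx (by simp [hgx]))
  obtain ⟨δ₃, hδ₃, ho3⟩ := huc (fun x => g x ^ 2 * ψ x ^ 3) (by fun_prop)
    (hgc.mono fun x hx hgx => hx (by simp [hgx]))
  have hdelta : ∀ᶠ n : ℕ in atTop, m * (b - a) / (n : ℝ) ≤ min δ₁ (min δ₂ δ₃) := by
    have : Tendsto (fun n : ℕ => m * (b - a) / (n : ℝ)) atTop (𝓝 0) :=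
      tendsto_const_nhds.div_atTop tendsto_natCast_atTop_atTop
    exact (this.eventually (gt_mem_nhds (lt_min hδ₁ (lt_min hδ₂ hδ₃)))).mono fun _ h => h.le
  -- The threshold for `n` is independent of `S` and `B`, so the point set may vary with `n`.
  filter_upwards [hω, hdelta, eventually_gt_atTop 0] with n hn1 hn2 hn0 S hS B hB
  have hn0' : (0 : ℝ) < n := Nat.cast_pos.2 hn0
  -- Large enough for the mesh `(b - a) / M` to be at most `m * (b - a) / n`, small enough for `M /
  -- n ≤ 1 / m + 1 / n`.
  set M := n / m + 1 with hM
  have hM0 : (0 : ℝ) < M := Nat.cast_pos.2 (Nat.succ_pos _)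
  have hM1 : (n : ℝ) ≤ m * M := by
    have : n ≤ m * M := by
      rw [hM]; have := Nat.div_add_mod n m; have := Nat.mod_lt n hm; nlinarith
    exact_mod_cast this
  have hM2 : (M : ℝ) ≤ n / m + 1 := by
    rw [hM]; push_cast; gcongr; exact Nat.cast_div_le
  have hmesh0 : (b - a) / M ≤ m * (b - a) / n := by
    rw [div_le_div_iff₀ hM0 hn0']; nlinarith
  obtain ⟨t, N, ht, h0, hN, hSt, hmesh, hsum⟩ :=
    exists_partition_with_grid hab S hS (M := M) (Nat.succ_pos _)
  have hmesh' : ∀ i < N, t (i + 1) - t i ≤ m * (b - a) / n := fun i hi =>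
    (hmesh i hi).trans hmesh0
  have hlow := riemann_sum_le_energy hf hg hψ hψ0 ht h0 hN hmesh'
    (fun x y h => ho1 x y (h.trans (hn2.trans (min_le_left _ _))))
    (fun x y h => ho2 x y (h.trans (hn2.trans ((min_le_right _ _).trans (min_le_left _ _))))) hn0' hθ
  have hsum' := hsum (fun x => g x ^ 2 * ψ x ^ 3)
    (fun x => mul_nonneg (sq_nonneg _) (pow_nonneg (hψ0 x) 3))
  -- the contribution of the grid
  have hgrid : (n : ℝ)⁻¹ * ∑ j ∈ Finset.range M, g (a + j * ((b - a) / M)) ^ 2 *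
      ψ (a + j * ((b - a) / M)) ^ 3 ≤
      (1 / m + (n : ℝ)⁻¹) * (b - a)⁻¹ * (Q + ω * (b - a)) := by
    have hr := abs_riemann_sum_sub_le (G := fun x => g x ^ 2 * ψ x ^ 3) (by fun_prop)
      (t := fun j : ℕ => a + j * ((b - a) / M)) (a := a) (b := b) (N := M) (δ := (b - a) / M)
      (ω := ω) (fun i j hij => by simp only; gcongr) (by simp) (by field_simp; ring)
      (fun i _ => by push_cast; linarith)
      (fun x y h => ho3 x y (h.trans (hmesh0.trans
        (hn2.trans ((min_le_right _ _).trans (min_le_right _ _))))))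
    have e : ∀ j : ℕ, a + ((j + 1 : ℕ) : ℝ) * ((b - a) / M) - (a + j * ((b - a) / M)) =
      (b - a) / M := fun j => by push_cast; ring
    simp only [e] at hr
    rw [← Finset.sum_mul] at hr
    have hr2 := (abs_le.1 hr).2
    set T := ∑ j ∈ Finset.range M, g (a + j * ((b - a) / M)) ^ 2 * ψ (a + j * ((b - a) / M)) ^ 3
    have hT : T ≤ M * (b - a)⁻¹ * (Q + ω * (b - a)) := by
      have : T * ((b - a) / M) ≤ Q + ω * (b - a) := by linarith
      calc T = M * (b - a)⁻¹ * (T * ((b - a) / M)) := by field_simp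
        _ ≤ _ := by gcongr
    have hQ0 : 0 ≤ Q + ω * (b - a) := by
      have : 0 ≤ Q := intervalIntegral.integral_nonneg hab.le fun x _ =>
        mul_nonneg (sq_nonneg _) (pow_nonneg (hψ0 x) 3)
      have := hω0.le
      positivity
    calc (n : ℝ)⁻¹ * T ≤ (n : ℝ)⁻¹ * (M * (b - a)⁻¹ * (Q + ω * (b - a))) := by gcongr
      _ ≤ (n : ℝ)⁻¹ * ((n / m + 1) * (b - a)⁻¹ * (Q + ω * (b - a))) := by gcongr
      _ = _ := by field_simp
  have hE := compliance_compl_range_le ht h0 hN hf (S := ↑S)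
    (Set.inter_subset_left.trans hSt)
  set E := ∑ i ∈ Finset.range N, gapEnergy f (t i) (t (i + 1)) with hEdef
  refine le_trans ?_ (mul_le_mul_right hE _)
  have hcast : (n : ℝ≥0∞) ^ 2 = ENNReal.ofReal ((n : ℝ) ^ 2) := by
    rw [ENNReal.ofReal_pow hn0'.le, ENNReal.ofReal_natCast]
  rw [hcast, ← ENNReal.ofReal_mul (by positivity)]
  refine ENNReal.ofReal_le_ofReal ?_
  rw [div_le_iff₀ (by positivity)]
  have hnδ : (n : ℝ) * (m * (b - a) / n) = m * (b - a) := by field_simp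
  rw [hnδ] at hlow
  have hsum2 : (n : ℝ)⁻¹ * ∑ i ∈ Finset.range N, g (t i) ^ 2 * ψ (t i) ^ 3 ≤
      B + (1 / m + (n : ℝ)⁻¹) * (b - a)⁻¹ * (Q + ω * (b - a)) := by
    calc _ ≤ (n : ℝ)⁻¹ * (∑ s ∈ S, g s ^ 2 * ψ s ^ 3 + ∑ j ∈ Finset.range M,
          g (a + j * ((b - a) / M)) ^ 2 * ψ (a + j * ((b - a) / M)) ^ 3) := by gcongr
      _ = _ := mul_add _ _ _
      _ ≤ _ := add_le_add hB hgrid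
  simp only [err] at hn1
  linarith

/-! ### Optimizing over the multiplier -/

/-- Continuous functions are dense in `L¹`, a subsequence converges almost everywhere, and
truncation to `[0, C]` does not affect a limit with values there. -/
theorem exists_continuous_tendsto_ae (M : Measure ℝ) [IsFiniteMeasure M] {φ : ℝ → ℝ}
    (hφ : Measurable φ) {C : ℝ} (hφ0 : ∀ x, 0 ≤ φ x) (hφC : ∀ x, φ x ≤ C) :
    ∃ ψ : ℕ → ℝ → ℝ, (∀ k, Continuous (ψ k)) ∧ (∀ k x, 0 ≤ ψ k x) ∧ (∀ k x, ψ k x ≤ C) ∧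
      ∀ᵐ x ∂M, Tendsto (fun k => ψ k x) atTop (𝓝 (φ x)) := by
  have hC : 0 ≤ C := (hφ0 0).trans (hφC 0)
  have hL : MemLp φ 1 M := MemLp.of_bound hφ.aestronglyMeasurable C (ae_of_all _ fun x => by
    rw [Real.norm_of_nonneg (hφ0 x)]; exact hφC x)
  have hex : ∀ k : ℕ, ∃ h : ℝ → ℝ, Continuous h ∧
      eLpNorm (h - φ) 1 M ≤ ENNReal.ofReal (1 / ((k : ℝ) + 1)) := fun k => by
    obtain ⟨h, _, h2, h3, _⟩ := hL.exists_hasCompactSupport_eLpNorm_sub_le ENNReal.one_ne_top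
      (ε := ENNReal.ofReal (1 / ((k : ℝ) + 1))) (by simp; positivity)
    exact ⟨h, h3, by rwa [eLpNorm_sub_comm]⟩
  choose h hc hle using hex
  have hlim : Tendsto (fun k : ℕ => ENNReal.ofReal (1 / ((k : ℝ) + 1))) atTop (𝓝 0) := by
    simpa using ENNReal.tendsto_ofReal tendsto_one_div_add_atTop_nhds_zero_nat
  have hm : TendstoInMeasure M h atTop φ :=
    tendstoInMeasure_of_tendsto_eLpNorm one_ne_zero (fun k => (hc k).aestronglyMeasurable) hL.1
      (tendsto_of_tendsto_of_tendsto_of_le_of_le tendsto_const_nhds hlim (fun _ => zero_le) hle)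
  obtain ⟨ns, -, hns⟩ := hm.exists_seq_tendsto_ae
  refine ⟨fun k x => max 0 (min (h (ns k) x) C), fun k => ?_, fun k x => le_max_left _ _,
    fun k x => max_le hC (min_le_right _ _), hns.mono fun x hx => ?_⟩
  · have := hc (ns k); fun_prop
  · have := (tendsto_const_nhds (x := (0 : ℝ))).max (hx.min (tendsto_const_nhds (x := C)))
    rwa [min_eq_left (hφC x), max_eq_right (hφ0 x)] at this

/-- On `s` the measure `ν` reduces to its absolutely continuous part, and discarding `sᶜ` changes
nothing for Lebesgue measure. -/
theorem integral_indicator_eq_integral_rnDeriv {a b : ℝ} (ν : Measure ℝ) [IsFiniteMeasure ν]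
    {s : Set ℝ} (hs : MeasurableSet s) (hs1 : ν.singularPart volume s = 0)
    (hs2 : volume sᶜ = 0) (h : ℝ → ℝ) :
    ∫ x, (Set.Icc a b ∩ s).indicator h x ∂ν =
      ∫ x in Set.Icc a b, (ν.rnDeriv volume x).toReal * h x := by
  have hm : MeasurableSet (Set.Icc a b ∩ s) := measurableSet_Icc.inter hs
  have h1 : ν.restrict (Set.Icc a b ∩ s) =
      (volume.restrict (Set.Icc a b)).withDensity (ν.rnDeriv volume) := by
    conv_lhs => rw [ν.haveLebesgueDecomposition_add volume]
    rw [Measure.restrict_add, Measure.restrict_eq_zero.2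
      (measure_mono_null Set.inter_subset_right hs1), zero_add, restrict_withDensity hm]
    congr 1
    refine Measure.restrict_congr_set ?_
    exact inter_ae_eq_left_of_ae_eq_univ (by rwa [ae_eq_univ])
  rw [integral_indicator hm, h1, integral_withDensity_eq_integral_toReal_smul
    (Measure.measurable_rnDeriv _ _) ?_]
  · rfl
  · exact ae_restrict_of_ae (Measure.rnDeriv_lt_top _ _)

/-- Optimizing a family of linear lower bounds over the continuous multiplier `ψ`. -/
theorem integral_le_of_forall_continuous {a b : ℝ} (hab : a ≤ b) (ν : Measure ℝ)
    [IsFiniteMeasure ν] {g : ℝ → ℝ} (hg : Continuous g) (hgc : HasCompactSupport g) {κ R : ℝ}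
    (hκ : 0 < κ)
    (H : ∀ ψ : ℝ → ℝ, Continuous ψ → (∀ x, 0 ≤ ψ x) →
      3 * (∫ x in a..b, g x ^ 2 * ψ x ^ 2) - 2 * (∫ x, g x ^ 2 * ψ x ^ 3 ∂ν) -
        2 * (κ * ∫ x in a..b, g x ^ 2 * ψ x ^ 3) ≤ R) :
    ∫ x in Set.Icc a b, g x ^ 2 / ((ν.rnDeriv volume x).toReal + κ) ^ 2 ≤ R := by
  obtain ⟨s₀, hs₀, hs01, hs02⟩ := Measure.mutuallySingular_singularPart ν volume
  set ρ : ℝ → ℝ := fun x => (ν.rnDeriv volume x).toReal with hρ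
  have hρm : Measurable ρ := (Measure.measurable_rnDeriv _ _).ennreal_toReal
  have hρ0 : ∀ x, 0 ≤ ρ x := fun x => ENNReal.toReal_nonneg
  -- The pointwise maximizer of `3 ψ² - 2 ψ³ (ρ + κ)`, with maximum `(ρ + κ)⁻²`.
  set w : ℝ → ℝ := fun x => (ρ x + κ)⁻¹ with hw
  have hwm : Measurable w := (hρm.add_const κ).inv
  have hw0 : ∀ x, 0 ≤ w x := fun x => inv_nonneg.2 (by linarith [hρ0 x])
  have hwC : ∀ x, w x ≤ κ⁻¹ := fun x => inv_anti₀ hκ (by linarith [hρ0 x])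
  -- Vanishing off `s₀` makes the multiplier blind to the singular part of `ν`.
  set φ : ℝ → ℝ := (Set.Icc a b ∩ s₀).indicator w with hφ
  have hm : MeasurableSet (Set.Icc a b ∩ s₀) := measurableSet_Icc.inter hs₀
  have hκi : 0 ≤ κ⁻¹ := inv_nonneg.2 hκ.le
  -- One sequence has to converge almost everywhere for Lebesgue measure and for `ν`, hence the sum
  -- of the two.
  obtain ⟨ψ, hψc, hψ0, hψC, hψlim⟩ := exists_continuous_tendsto_ae
    (volume.restrict (Set.Icc a b) + ν) (hwm.indicator hm) (C := κ⁻¹)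
    (fun x => Set.indicator_nonneg (fun x _ => hw0 x) x)
    (fun x => by
      by_cases hx : x ∈ Set.Icc a b ∩ s₀
      · rw [Set.indicator_of_mem hx]; exact hwC x
      · rw [Set.indicator_of_notMem hx]; exact hκi)
  rw [ae_add_measure_iff] at hψlim
  obtain ⟨C, hC⟩ := hgc.exists_bound_of_continuous hg
  have hdct : ∀ (M : Measure ℝ) [IsFiniteMeasure M] (j : ℕ),
      (∀ᵐ x ∂M, Tendsto (fun k => ψ k x) atTop (𝓝 (φ x))) →
      Tendsto (fun k => ∫ x, g x ^ 2 * ψ k x ^ j ∂M) atTop (𝓝 (∫ x, g x ^ 2 * φ x ^ j ∂M)) := by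
    intro M _ j hM
    refine tendsto_integral_of_dominated_convergence (fun _ => C ^ 2 * κ⁻¹ ^ j) (fun k => ?_)
      (integrable_const _) (fun k => ae_of_all _ fun x => ?_) ?_
    · have := hψc k
      exact Continuous.aestronglyMeasurable (by fun_prop)
    · rw [norm_mul, norm_pow, norm_pow, Real.norm_of_nonneg (hψ0 k x)]
      gcongr
      · exact pow_nonneg (hψ0 k x) j
      · exact hC x
      · exact hψ0 k x
      · exact hψC k x
    · exact hM.mono fun x hx => tendsto_const_nhds.mul (hx.pow j)
  have hint : ∀ h : ℝ → ℝ, ∫ x in a..b, h x = ∫ x in Set.Icc a b, h x := fun h => by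
    rw [intervalIntegral.integral_of_le hab, integral_Icc_eq_integral_Ioc]
  have hlim := (((hdct _ 2 hψlim.1).const_mul 3).sub ((hdct _ 3 hψlim.2).const_mul 2)).sub
    (((hdct _ 3 hψlim.1).const_mul κ).const_mul 2)
  have hle := le_of_tendsto hlim (Eventually.of_forall fun k => by
    have := H (ψ k) (hψc k) (hψ0 k)
    rwa [hint, hint] at this)
  have hφae : ∀ᵐ x ∂(volume.restrict (Set.Icc a b)), φ x = w x := by
    have h1 : ∀ᵐ x ∂(volume.restrict (Set.Icc a b)), x ∈ s₀ :=
      ae_restrict_of_ae (by rw [ae_iff]; exact hs02)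
    filter_upwards [h1, ae_restrict_mem measurableSet_Icc] with x hx1 hx2
    exact Set.indicator_of_mem (s := Set.Icc a b ∩ s₀) ⟨hx2, hx1⟩ w
  have e1 : ∀ j : ℕ, ∫ x in Set.Icc a b, g x ^ 2 * φ x ^ j = ∫ x in Set.Icc a b, g x ^ 2 * w x ^ j :=
    fun j => integral_congr_ae (hφae.mono fun x hx => by simp only [hx])
  have e2 : ∫ x, g x ^ 2 * φ x ^ 3 ∂ν = ∫ x in Set.Icc a b, ρ x * (g x ^ 2 * w x ^ 3) := by
    rw [← integral_indicator_eq_integral_rnDeriv ν hs₀ hs01 hs02]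
    refine integral_congr_ae (ae_of_all _ fun x => ?_)
    by_cases hx : x ∈ Set.Icc a b ∩ s₀
    · simp [hφ, hx]
    · simp [hφ, hx]
  rw [e1, e1, e2] at hle
  have hwb : ∀ j : ℕ, Integrable (fun x => g x ^ 2 * w x ^ j) (volume.restrict (Set.Icc a b)) := by
    intro j
    refine Integrable.of_bound ((hg.measurable.pow_const 2).mul (hwm.pow_const j)).aestronglyMeasurable
      (C ^ 2 * κ⁻¹ ^ j) (ae_of_all _ fun x => ?_)
    rw [norm_mul, norm_pow, norm_pow, Real.norm_of_nonneg (hw0 x)]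
    gcongr
    · exact hC x
    · exact hwC x
  -- By this identity the two terms in `κ` cancel, and of the `3 - 2` copies of `∫ g² w²` one is
  -- left.
  have e3 : ∀ x, ρ x * (g x ^ 2 * w x ^ 3) = g x ^ 2 * w x ^ 2 - κ * (g x ^ 2 * w x ^ 3) := by
    intro x
    have : ρ x + κ ≠ 0 := by linarith [hρ0 x]
    simp only [hw]
    field_simp
    ring
  simp only [e3] at hle
  rw [integral_sub (hwb 2) ((hwb 3).const_mul κ), integral_const_mul] at hle
  have e4 : ∀ x, g x ^ 2 / ((ν.rnDeriv volume x).toReal + κ) ^ 2 = g x ^ 2 * w x ^ 2 := fun x => by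
    simp only [hw, inv_pow, div_eq_mul_inv, hρ]
  simp only [e4]
  linarith

/-! ### Measures on the interval seen on the line, and approximation of `f` -/

theorem toReal_apply {a b : ℝ} (μ : ProbabilityMeasure (Set.Icc a b)) {s : Set ℝ}
    (hs : MeasurableSet s) : toReal μ s = (μ : Measure (Set.Icc a b)) (Subtype.val ⁻¹' s) :=
  Measure.map_apply measurable_subtype_coe hs

instance {a b : ℝ} (μ : ProbabilityMeasure (Set.Icc a b)) : IsProbabilityMeasure (toReal μ) :=
  Measure.isProbabilityMeasure_map measurable_subtype_coe.aemeasurable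

theorem integral_toReal {a b : ℝ} (μ : ProbabilityMeasure (Set.Icc a b)) (G : ℝ → ℝ) :
    ∫ x, G x ∂(toReal μ) = ∫ x : Set.Icc a b, G x ∂(μ : Measure (Set.Icc a b)) :=
  (MeasurableEmbedding.subtype_coe measurableSet_Icc).integral_map G

theorem tendsto_integral_toReal {a b : ℝ} {y : ℕ → ProbabilityMeasure (Set.Icc a b)}
    {μ : ProbabilityMeasure (Set.Icc a b)} (hy : Tendsto y atTop (𝓝 μ)) {G : ℝ → ℝ}
    (hG : Continuous G) :
    Tendsto (fun n => ∫ x, G x ∂(toReal (y n))) atTop (𝓝 (∫ x, G x ∂(toReal μ))) := by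
  simp only [integral_toReal]
  exact ProbabilityMeasure.tendsto_iff_forall_integral_tendsto.1 hy
    (BoundedContinuousFunction.mkOfCompact ⟨fun x : Set.Icc a b => G x, by fun_prop⟩)

theorem exists_continuous_integral_sub_sq_le {a b : ℝ} {f : ℝ → ℝ}
    (hf : MemLp f 2 (volume.restrict (Set.Icc a b))) {η : ℝ} (hη : 0 < η) :
    ∃ g : ℝ → ℝ, Continuous g ∧ HasCompactSupport g ∧
      ∫ x in Set.Icc a b, (f x - g x) ^ 2 ≤ η := by
  obtain ⟨g, hgc, hle, hg, hgL⟩ := hf.exists_hasCompactSupport_eLpNorm_sub_le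
    ENNReal.ofNat_ne_top (ε := ENNReal.ofReal (√η)) (by simpa using Real.sqrt_pos.2 hη)
  refine ⟨g, hg, hgc, ?_⟩
  rw [eLpNorm_two_eq (hf.sub hgL), ENNReal.ofReal_le_ofReal_iff (Real.sqrt_nonneg _),
    Real.sqrt_le_sqrt_iff hη.le] at hle
  exact hle

theorem memLp_two_of_continuous {a b : ℝ} {g : ℝ → ℝ} (hg : Continuous g) :
    MemLp g 2 (volume.restrict (Set.Icc a b)) := by
  obtain ⟨C, hC⟩ := isCompact_Icc.exists_bound_of_continuousOn (hg.continuousOn (s := Set.Icc a b))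
  exact MemLp.of_bound hg.aestronglyMeasurable C
    ((ae_restrict_mem measurableSet_Icc).mono fun x hx => hC x hx)

/-- A functional bounded below by `n² · compliance` of the complements of the finite sets whose
points carry mass at least `1 / n`. -/
def IsPointBounded (a b : ℝ) (f : ℝ → ℝ)
    (F : ℕ → ProbabilityMeasure (Set.Icc a b) → ℝ≥0∞) : Prop :=
  ∀ n : ℕ, 0 < n → ∀ μ c, (∀ S : Finset ℝ, (∀ x ∈ S, x ∈ Set.Icc a b) →
    (∀ G : ℝ → ℝ, (∀ x, 0 ≤ G x) → (n : ℝ)⁻¹ * ∑ s ∈ S, G s ≤ ∫ x, G x ∂(toReal μ)) →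
    c ≤ (n : ℝ≥0∞) ^ 2 * compliance (Set.Ioo a b \ S) f) → c ≤ F n μ

/-! ### The liminf inequality -/

section Liminf

variable {a b : ℝ} {f : ℝ → ℝ} {F : ℕ → ProbabilityMeasure (Set.Icc a b) → ℝ≥0∞}
  {y : ℕ → ProbabilityMeasure (Set.Icc a b)} {μ : ProbabilityMeasure (Set.Icc a b)}

/-- For fixed `g` and `ψ` the lower bound involves `y n` only through the integral of the continuous
function `g² ψ³`, which converges under weak* convergence. -/
theorem linear_bound_le_liminf (hab : a < b) (hf : MemLp f 2 (volume.restrict (Set.Icc a b)))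
    (hF : IsPointBounded a b f F) (hy : Tendsto y atTop (𝓝 μ))
    (hL : liminf (fun n => F n (y n)) atTop ≠ ⊤) {g ψ : ℝ → ℝ} (hg : Continuous g)
    (hgc : HasCompactSupport g) (hψ : Continuous ψ) (hψ0 : ∀ x, 0 ≤ ψ x) {m : ℕ} (hm : 0 < m)
    {θ : ℝ} (hθ : 0 < θ) :
    (1 / 12) * (3 * (∫ x in a..b, g x ^ 2 * ψ x ^ 2) - 2 * (∫ x, g x ^ 2 * ψ x ^ 3 ∂(toReal μ)) -
          2 * ((m * (b - a))⁻¹ * ∫ x in a..b, g x ^ 2 * ψ x ^ 3)) -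
        (1 + θ⁻¹) * ((m * (b - a)) ^ 2 * (2 * ∫ x in a..b, (f x - g x) ^ 2)) ≤
      (1 + θ) * (liminf (fun n => F n (y n)) atTop).toReal := by
  refine le_of_forall_pos_le_add fun ε hε => ?_
  set B := ∫ x, g x ^ 2 * ψ x ^ 3 ∂(toReal μ) with hB
  have hlim := tendsto_integral_toReal hy (G := fun x => g x ^ 2 * ψ x ^ 3) (by fun_prop)
  -- Enlarging `B` by `ε` costs `ε / 6` and the discretization costs `ε / 2`, together less than
  -- `ε`.
  have hev1 : ∀ᶠ n in atTop, ∫ x, g x ^ 2 * ψ x ^ 3 ∂(toReal (y n)) ≤ B + ε :=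
    (hlim.eventually (gt_mem_nhds (show B < B + ε by linarith))).mono fun _ h => h.le
  have hev2 := eventually_le_compliance hab hf hg hgc hψ hψ0 hm hθ (half_pos hε)
  have hle := le_liminf_of_le (f := atTop) (u := fun n => F n (y n)) (by isBoundedDefault) (by
    filter_upwards [hev1, hev2, eventually_gt_atTop 0] with n h1 h2 h3
    exact hF n h3 (y n) _ fun S hS hSG => h2 S hS (B + ε) ((hSG _ fun x =>
      mul_nonneg (sq_nonneg _) (pow_nonneg (hψ0 x) 3)).trans h1))
  rw [ENNReal.ofReal_le_iff_le_toReal hL, div_le_iff₀ (by linarith)] at hle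
  linarith

/-- The added constant is the density of the adjoined grid. It keeps the weight bounded, so for
fixed `m` the passage from `g` to `f` is controlled by the `L²` distance alone. -/
theorem integral_div_sq_le_liminf (hab : a < b) (hf : MemLp f 2 (volume.restrict (Set.Icc a b)))
    (hF : IsPointBounded a b f F) (hy : Tendsto y atTop (𝓝 μ))
    (hL : liminf (fun n => F n (y n)) atTop ≠ ⊤) {m : ℕ} (hm : 0 < m) :
    Integrable (fun x => f x ^ 2 / (((toReal μ).rnDeriv volume x).toReal + (m * (b - a))⁻¹) ^ 2)
      (volume.restrict (Set.Icc a b)) ∧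
    ∫ x in Set.Icc a b, f x ^ 2 / (((toReal μ).rnDeriv volume x).toReal + (m * (b - a))⁻¹) ^ 2 ≤
      12 * (liminf (fun n => F n (y n)) atTop).toReal := by
  set L := (liminf (fun n => F n (y n)) atTop).toReal with hLdef
  have hba : 0 < b - a := by linarith
  have hm' : (0 : ℝ) < m := Nat.cast_pos.2 hm
  set κ := ((m : ℝ) * (b - a))⁻¹ with hκ
  have hκ0 : 0 < κ := by positivity
  set ρ : ℝ → ℝ := fun x => ((toReal μ).rnDeriv volume x).toReal with hρ
  have hρm : Measurable ρ := (Measure.measurable_rnDeriv _ _).ennreal_toReal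
  have hρ0 : ∀ x, 0 ≤ ρ x := fun x => ENNReal.toReal_nonneg
  have hw : ∀ x, ((ρ x + κ) ^ 2)⁻¹ ≤ (κ ^ 2)⁻¹ := fun x =>
    inv_anti₀ (by positivity) (pow_le_pow_left₀ hκ0.le (by linarith [hρ0 x]) 2)
  have hw0 : ∀ x, 0 ≤ ((ρ x + κ) ^ 2)⁻¹ := fun x => by positivity
  have hint : ∀ h : ℝ → ℝ, MemLp h 2 (volume.restrict (Set.Icc a b)) →
      Integrable (fun x => h x ^ 2 / (ρ x + κ) ^ 2) (volume.restrict (Set.Icc a b)) := by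
    intro h hh
    simp only [div_eq_mul_inv]
    refine hh.integrable_sq.mul_bdd (c := (κ ^ 2)⁻¹)
      (((hρm.add_const κ).pow_const 2).inv).aestronglyMeasurable (ae_of_all _ fun x => ?_)
    rw [Real.norm_of_nonneg (hw0 x)]; exact hw x
  refine ⟨hint f hf, ?_⟩
  have hii : ∀ h : ℝ → ℝ, ∫ x in a..b, h x = ∫ x in Set.Icc a b, h x := fun h => by
    rw [intervalIntegral.integral_of_le hab.le, integral_Icc_eq_integral_Ioc]
  -- the bound with the error terms
  have key : ∀ θ > 0, ∀ η > 0, ∫ x in Set.Icc a b, f x ^ 2 / (ρ x + κ) ^ 2 ≤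
      (1 + θ) * (12 * ((1 + θ) * L + (1 + θ⁻¹) * ((m * (b - a)) ^ 2 * (2 * η)))) +
        (1 + θ⁻¹) * (κ ^ 2)⁻¹ * η := by
    intro θ hθ η hη
    obtain ⟨g, hg, hgc, hgη⟩ := exists_continuous_integral_sub_sq_le hf hη
    have hgL := memLp_two_of_continuous (a := a) (b := b) hg
    have h1 : ∫ x in Set.Icc a b, g x ^ 2 / (ρ x + κ) ^ 2 ≤
        12 * ((1 + θ) * L + (1 + θ⁻¹) * ((m * (b - a)) ^ 2 * (2 * η))) := by
      refine integral_le_of_forall_continuous hab.le (toReal μ) hg hgc hκ0 fun ψ hψ hψ0 => ?_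
      have h2 := linear_bound_le_liminf hab hf hF hy hL hg hgc hψ hψ0 hm hθ
      have h3 : (1 + θ⁻¹) * ((m * (b - a)) ^ 2 * (2 * ∫ x in a..b, (f x - g x) ^ 2)) ≤
          (1 + θ⁻¹) * ((m * (b - a)) ^ 2 * (2 * η)) := by
        rw [hii]; gcongr
      linarith
    have hfg := (hf.sub hgL).integrable_sq
    simp only [Pi.sub_apply] at hfg
    calc ∫ x in Set.Icc a b, f x ^ 2 / (ρ x + κ) ^ 2
        ≤ ∫ x in Set.Icc a b, ((1 + θ) * (g x ^ 2 / (ρ x + κ) ^ 2) +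
            (1 + θ⁻¹) * (κ ^ 2)⁻¹ * (f x - g x) ^ 2) := by
          refine integral_mono (hint f hf) (((hint g hgL).const_mul _).add (hfg.const_mul _))
            fun x => ?_
          have e1 : f x ^ 2 ≤ (1 + θ) * g x ^ 2 + (1 + θ⁻¹) * (f x - g x) ^ 2 := by
            have h4 : 0 ≤ θ⁻¹ * (θ * g x - (f x - g x)) ^ 2 := by positivity
            have h5 : θ⁻¹ * (θ * g x - (f x - g x)) ^ 2 =
                θ * g x ^ 2 - 2 * g x * (f x - g x) + θ⁻¹ * (f x - g x) ^ 2 := by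
              field_simp; ring
            nlinarith
          simp only [div_eq_mul_inv]
          calc f x ^ 2 * ((ρ x + κ) ^ 2)⁻¹
              ≤ ((1 + θ) * g x ^ 2 + (1 + θ⁻¹) * (f x - g x) ^ 2) * ((ρ x + κ) ^ 2)⁻¹ := by
                gcongr
            _ = (1 + θ) * (g x ^ 2 * ((ρ x + κ) ^ 2)⁻¹) +
                (1 + θ⁻¹) * ((ρ x + κ) ^ 2)⁻¹ * (f x - g x) ^ 2 := by ring
            _ ≤ _ := by
                have := hw x
                gcongr
      _ = (1 + θ) * (∫ x in Set.Icc a b, g x ^ 2 / (ρ x + κ) ^ 2) +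
            (1 + θ⁻¹) * (κ ^ 2)⁻¹ * ∫ x in Set.Icc a b, (f x - g x) ^ 2 := by
          rw [integral_add ((hint g hgL).const_mul _) (hfg.const_mul _), integral_const_mul,
            integral_const_mul]
      _ ≤ _ := by gcongr
  -- `η` is multiplied by `1 + θ⁻¹`, so `η → 0` has to come before `θ → 0`.
  have key2 : ∀ θ > 0, ∫ x in Set.Icc a b, f x ^ 2 / (ρ x + κ) ^ 2 ≤
      (1 + θ) * (12 * ((1 + θ) * L)) := by
    intro θ hθ
    have hc : ContinuousWithinAt (fun η : ℝ => (1 + θ) * (12 * ((1 + θ) * L + (1 + θ⁻¹) *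
        ((m * (b - a)) ^ 2 * (2 * η)))) + (1 + θ⁻¹) * (κ ^ 2)⁻¹ * η) (Set.Ioi 0) 0 :=
      Continuous.continuousWithinAt (by fun_prop)
    have := ge_of_tendsto hc (by filter_upwards [self_mem_nhdsWithin] with η hη using key θ hθ η hη)
    simpa using this
  have hc : ContinuousWithinAt (fun θ : ℝ => (1 + θ) * (12 * ((1 + θ) * L))) (Set.Ioi 0) 0 :=
    Continuous.continuousWithinAt (by fun_prop)
  have := ge_of_tendsto hc (by filter_upwards [self_mem_nhdsWithin] with θ hθ using key2 θ hθ)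
  simpa using this

/-- The grid density `κ m` tends to zero as the grid gets sparser, and Fatou's lemma in `[0, +∞]`
removes it. -/
theorem limitFunctional_le_liminf (hab : a < b) (hf : MemLp f 2 (volume.restrict (Set.Icc a b)))
    (hF : IsPointBounded a b f F) (hy : Tendsto y atTop (𝓝 μ)) :
    limitFunctional a b f μ ≤ liminf (fun n => F n (y n)) atTop := by
  by_cases hL : liminf (fun n => F n (y n)) atTop = ⊤
  · rw [hL]; exact le_top
  set L := liminf (fun n => F n (y n)) atTop with hLdef
  set r := (toReal μ).rnDeriv volume with hr
  have hrm : Measurable r := Measure.measurable_rnDeriv _ _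
  have hba : 0 < b - a := by linarith
  have hrtop : ∀ᵐ x ∂(volume.restrict (Set.Icc a b)), r x < ⊤ :=
    ae_restrict_of_ae (Measure.rnDeriv_lt_top _ _)
  let κ : ℕ → ℝ := fun m => (((m + 1 : ℕ) : ℝ) * (b - a))⁻¹
  have hκ0 : ∀ m, 0 < κ m := fun m => by positivity
  have hκlim : Tendsto (fun m => ENNReal.ofReal (κ m)) atTop (𝓝 0) := by
    rw [← ENNReal.ofReal_zero]
    refine ENNReal.tendsto_ofReal (tendsto_inv_atTop_zero.comp ?_)
    exact ((tendsto_natCast_atTop_atTop).comp (tendsto_add_atTop_nat 1)).atTop_mul_const hba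
  have hm : ∀ m, ∫⁻ x in Set.Icc a b, ENNReal.ofReal (f x ^ 2) / (r x + ENNReal.ofReal (κ m)) ^ 2 ≤
      12 * L := by
    intro m
    obtain ⟨h1, h2⟩ := integral_div_sq_le_liminf hab hf hF hy hL (Nat.succ_pos m)
    have h3 : ∀ᵐ x ∂(volume.restrict (Set.Icc a b)),
        ENNReal.ofReal (f x ^ 2) / (r x + ENNReal.ofReal (κ m)) ^ 2 =
        ENNReal.ofReal (f x ^ 2 / ((r x).toReal + κ m) ^ 2) := by
      filter_upwards [hrtop] with x hx
      have h0 : 0 < (r x).toReal + κ m := add_pos_of_nonneg_of_pos ENNReal.toReal_nonneg (hκ0 m)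
      rw [ENNReal.ofReal_div_of_pos (by positivity), ENNReal.ofReal_pow h0.le,
        ENNReal.ofReal_add ENNReal.toReal_nonneg (hκ0 m).le, ENNReal.ofReal_toReal hx.ne]
    rw [lintegral_congr_ae h3, ← ofReal_integral_eq_lintegral_ofReal h1
      (ae_of_all _ fun x => by positivity)]
    refine (ENNReal.ofReal_le_ofReal h2).trans (le_of_eq ?_)
    rw [ENNReal.ofReal_mul (by norm_num), ENNReal.ofReal_toReal hL]
    norm_num
  have hfatou := lintegral_liminf_le' (u := atTop) (μ := volume.restrict (Set.Icc a b))
    (f := fun (m : ℕ) x => ENNReal.ofReal (f x ^ 2) / (r x + ENNReal.ofReal (κ m)) ^ 2)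
    (fun m => ((hf.1.aemeasurable.pow_const 2).ennreal_ofReal).div
      ((hrm.add_const _).pow_const 2).aemeasurable)
  -- Where `r x = 0` the limit is `+∞` if `f x ≠ 0` and `0` otherwise, which is the convention in
  -- the limit functional.
  have hpt : ∀ x, liminf (fun m : ℕ => ENNReal.ofReal (f x ^ 2) / (r x + ENNReal.ofReal (κ m)) ^ 2)
      atTop = ENNReal.ofReal (f x ^ 2) / r x ^ 2 := by
    intro x
    refine Tendsto.liminf_eq (ENNReal.Tendsto.const_div ?_ (Or.inr ENNReal.ofReal_ne_top))
    refine (ENNReal.continuous_pow 2).tendsto' _ _ rfl |>.comp ?_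
    simpa using (tendsto_const_nhds (x := r x)).add hκlim
  simp only [hpt] at hfatou
  have h12 : ∫⁻ x in Set.Icc a b, ENNReal.ofReal (f x ^ 2) / r x ^ 2 ≤ 12 * L :=
    hfatou.trans ((liminf_le_liminf (Eventually.of_forall hm)).trans (by simp))
  calc limitFunctional a b f μ ≤ 1 / 12 * (12 * L) := by
        unfold limitFunctional; gcongr
    _ = L := by
        rw [← mul_assoc, one_div, ENNReal.inv_mul_cancel (by norm_num) (by norm_num), one_mul]

end Liminf

/-! ### Both functionals satisfy the hypothesis of the liminf inequality -/

section PointBounded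

variable {a b : ℝ} {f : ℝ → ℝ}

theorem integral_toReal_smul_sum_dirac {ι : Type*} (s : Finset ι) (x : ι → Set.Icc a b)
    {μ : ProbabilityMeasure (Set.Icc a b)} {n : ℕ}
    (hμ : (μ : Measure (Set.Icc a b)) = (n : ℝ≥0∞)⁻¹ • ∑ i ∈ s, Measure.dirac (x i))
    (G : ℝ → ℝ) : ∫ x, G x ∂(toReal μ) = (n : ℝ)⁻¹ * ∑ i ∈ s, G (x i) := by
  rw [integral_toReal, hμ, integral_smul_measure, integral_finsetSum_measure]
  · simp
  · intro i _
    exact integrable_dirac (by simp)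

/-- Since `S.card ≤ n`, each point of `S` carries mass at least `n⁻¹`. -/
theorem isPointBounded_pointFunctional : IsPointBounded a b f (pointFunctional a b f) := by
  classical
  intro n hn μ c hc
  refine le_iInf fun S => le_iInf fun hS => ?_
  have h := hc (S.image Subtype.val) (by
    intro x hx
    obtain ⟨z, _, rfl⟩ := Finset.mem_image.1 hx
    exact z.2) fun G hG => ?_
  · simpa [pointCompliance] using h
  · rw [integral_toReal_smul_sum_dirac S id hS.2, Finset.sum_image Subtype.val_injective.injOn]
    rcases S.eq_empty_or_nonempty with rfl | hne
    · simp
    · have : (0 : ℝ) < S.card := Nat.cast_pos.2 hne.card_pos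
      have h0 : 0 ≤ ∑ i ∈ S, G (id i : Set.Icc a b) := Finset.sum_nonneg fun i _ => hG _
      refine mul_le_mul_of_nonneg_right (inv_anti₀ this (by exact_mod_cast hS.1)) h0

/-- Listing coincident points only once drops nonnegative terms from the sum. -/
theorem isPointBounded_multiPointFunctional :
    IsPointBounded a b f (multiPointFunctional a b f) := by
  classical
  intro n hn μ c hc
  refine le_iInf fun x => le_iInf fun hx => ?_
  have h := hc (Finset.univ.image fun i => (x i : ℝ)) (by
    intro y hy
    obtain ⟨i, _, rfl⟩ := Finset.mem_image.1 hy
    exact (x i).2) fun G hG => ?_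
  · have e : Subtype.val '' Set.range x = ↑(Finset.univ.image fun i => (x i : ℝ)) := by
      ext y; simp
    rw [pointCompliance, e]; exact h
  · rw [integral_toReal_smul_sum_dirac Finset.univ x hx]
    gcongr
    exact Finset.sum_image_le_of_nonneg (fun _ _ => hG _) 

end PointBounded

/-! ### Diagonal argument -/

/-- Recovery sequences exist as soon as nearly optimal competitors exist in every neighbourhood. -/
theorem exists_recovery_sequence {X : Type*} [TopologicalSpace X] [FirstCountableTopology X]
    {F : ℕ → X → ℝ≥0∞} {x : X} {c : ℝ≥0∞}
    (H : ∀ V ∈ 𝓝 x, ∀ c', c < c' → ∀ᶠ n in atTop, ∃ y ∈ V, F n y ≤ c') :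
    ∃ y : ℕ → X, Tendsto y atTop (𝓝 x) ∧ limsup (fun n => F n (y n)) atTop ≤ c := by
  classical
  by_cases hc : c = ⊤
  · exact ⟨fun _ => x, tendsto_const_nhds, hc ▸ le_top⟩
  obtain ⟨V, hV⟩ := (𝓝 x).exists_antitone_basis
  let d : ℕ → ℝ≥0∞ := fun k => c + ((k : ℝ≥0∞) + 1)⁻¹
  have hd : ∀ k, c < d k := fun k => ENNReal.lt_add_right hc (by simp)
  have hdanti : Antitone d := fun i j hij => by
    simp only [d]; gcongr
  have hdlim : Tendsto d atTop (𝓝 c) := by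
    have h1 : Tendsto (fun k : ℕ => ((k : ℝ≥0∞) + 1)⁻¹) atTop (𝓝 0) := by
      have := (ENNReal.tendsto_inv_nat_nhds_zero).comp (tendsto_add_atTop_nat 1)
      refine this.congr fun k => ?_
      simp
    simpa using (tendsto_const_nhds (x := c)).add h1
  let P : ℕ → ℕ → Prop := fun n k => ∃ y ∈ V k, F n y ≤ d k
  have hP : ∀ k, ∀ᶠ n in atTop, P n k := fun k => H (V k) (hV.mem k) (d k) (hd k)
  -- The finest level up to `n` that is attained at time `n`; it tends to infinity because each
  -- level is eventually attained.
  let K : ℕ → ℕ := fun n => Nat.findGreatest (P n) n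
  have hK : Tendsto K atTop atTop := by
    refine tendsto_atTop.2 fun k => ?_
    filter_upwards [hP k, eventually_ge_atTop k] with n h1 h2
    exact Nat.le_findGreatest h2 h1
  have hPK : ∀ᶠ n in atTop, P n (K n) := by
    filter_upwards [hP 0] with n h0
    exact Nat.findGreatest_spec (Nat.zero_le n) h0
  let y : ℕ → X := fun n => if h : P n (K n) then h.choose else x
  have hy : ∀ᶠ n in atTop, y n ∈ V (K n) ∧ F n (y n) ≤ d (K n) := by
    filter_upwards [hPK] with n h
    have : y n = h.choose := dif_pos h
    rw [this]; exact h.choose_spec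
  refine ⟨y, ?_, ?_⟩
  · refine hV.1.tendsto_right_iff.2 fun k _ => ?_
    filter_upwards [hy, hK.eventually_ge_atTop k] with n h1 h2
    exact hV.2 h2 h1.1
  · calc limsup (fun n => F n (y n)) atTop ≤ limsup (fun n => d (K n)) atTop :=
          limsup_le_limsup (hy.mono fun n h => h.2)
      _ = c := (hdlim.comp hK).limsup_eq

/-! ### Quantiles and the points they define -/

/-- The quantile function of a probability measure on an interval. -/
theorem exists_quantile {a b : ℝ} (hab : a ≤ b) (ν : Measure ℝ) [IsProbabilityMeasure ν]
    (hν : ν (Set.Icc a b) = 1) :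
    ∃ q : ℝ → ℝ, Monotone q ∧ (∀ s, q s ∈ Set.Icc a b) ∧
      (volume.restrict (Set.Ioc 0 1)).map q = ν := by
  set c := ProbabilityTheory.cdf ν with hc
  have hcm : Monotone c := ProbabilityTheory.monotone_cdf ν
  have hcb : c b = 1 := by
    have h1 : ν (Set.Iic b) = 1 := le_antisymm prob_le_one
      (hν ▸ measure_mono Set.Icc_subset_Iic_self)
    rw [hc, ProbabilityTheory.cdf_eq_real, measureReal_def, h1, ENNReal.toReal_one]
  have hca : ∀ x < a, c x = 0 := by
    intro x hx
    have h1 : ν (Set.Icc a b)ᶜ = 0 := by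
      rw [prob_compl_eq_zero_iff measurableSet_Icc]; exact hν
    have hsub : Set.Iic x ⊆ (Set.Icc a b)ᶜ := fun y hy h => by
      linarith [h.1, Set.mem_Iic.1 hy]
    have h2 : ν (Set.Iic x) = 0 := measure_mono_null hsub h1
    rw [hc, ProbabilityTheory.cdf_eq_real, measureReal_def, h2, ENNReal.toReal_zero]
  -- The alternative `x = b` keeps `A s` nonempty for every real `s`, so that `q` is monotone on all
  -- of `ℝ` with values in `[a, b]`.
  let A : ℝ → Set ℝ := fun s => {x | (x ∈ Set.Icc a b ∧ s ≤ c x) ∨ x = b}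
  have hAne : ∀ s, (A s).Nonempty := fun s => ⟨b, Or.inr rfl⟩
  have hAge : ∀ s, ∀ x ∈ A s, a ≤ x := by
    rintro s x (h | h)
    · exact h.1.1
    · rw [h]; exact hab
  have hAbdd : ∀ s, BddBelow (A s) := fun s => ⟨a, fun x hx => hAge s x hx⟩
  let q : ℝ → ℝ := fun s => sInf (A s)
  have hqm : Monotone q := fun s s' hss' => csInf_le_csInf (hAbdd s) (hAne s') (by
    rintro x (h | h)
    · exact Or.inl ⟨h.1, hss'.trans h.2⟩
    · exact Or.inr h)
  have hqab : ∀ s, q s ∈ Set.Icc a b := fun s =>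
    ⟨le_csInf (hAne s) (hAge s), csInf_le (hAbdd s) (Or.inr rfl)⟩
  -- The Galois connection between quantile and distribution function; the forward direction uses
  -- right continuity of the latter.
  have hgal : ∀ s ∈ Set.Ioc (0 : ℝ) 1, ∀ x, q s ≤ x ↔ s ≤ c x := by
    intro s hs x
    constructor
    · intro hx
      rcases le_or_gt b x with hbx | hbx
      · exact hs.2.trans (hcb ▸ hcm hbx)
      refine le_trans ?_ (hcm hx)
      have hqb : q s < b := hx.trans_lt hbx
      refine ge_of_tendsto ((c.right_continuous (q s)).tendsto.mono_left
        (nhdsWithin_mono _ Set.Ioi_subset_Ici_self)) ?_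
      filter_upwards [Ioo_mem_nhdsGT hqb] with z hz
      obtain ⟨y, hy, hyz⟩ := exists_lt_of_csInf_lt (hAne s) hz.1
      rcases hy with hy | hy
      · exact hy.2.trans (hcm hyz.le)
      · exact absurd (hy ▸ hyz) (not_lt.2 hz.2.le)
    · intro hx
      have hax : a ≤ x := by
        by_contra! h
        rw [hca x h] at hx; exact absurd hs.1 (not_lt.2 hx)
      rcases le_or_gt b x with hbx | hbx
      · exact (hqab s).2.trans hbx
      · exact csInf_le (hAbdd s) (Or.inl ⟨⟨hax, hbx.le⟩, hx⟩)
  refine ⟨q, hqm, hqab, ?_⟩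
  have hfin : IsFiniteMeasure ((volume.restrict (Set.Ioc (0 : ℝ) 1)).map q) :=
    Measure.isFiniteMeasure_map _ _
  refine Measure.ext_of_Iic _ _ fun x => ?_
  rw [Measure.map_apply hqm.measurable measurableSet_Iic,
    Measure.restrict_apply (hqm.measurable measurableSet_Iic), ← ProbabilityTheory.ofReal_cdf ν x]
  have hset : q ⁻¹' Set.Iic x ∩ Set.Ioc 0 1 = Set.Ioc 0 (c x) := by
    ext s
    constructor
    · rintro ⟨h1, h2⟩; exact ⟨h2.1, (hgal s h2 x).1 h1⟩
    · rintro ⟨h1, h2⟩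
      have : s ∈ Set.Ioc (0 : ℝ) 1 := ⟨h1, h2.trans (ProbabilityTheory.cdf_le_one ν x)⟩
      exact ⟨(hgal s this x).2 h2, this⟩
  rw [hset, Real.volume_Ioc, sub_zero]

/-- A finite family of points in an interval can be made injective by moving the points slightly,
without losing any of the original points. -/
theorem exists_injective_perturbation {a b η : ℝ} (hab : a < b) (hη : 0 < η) {n : ℕ}
    (t : Fin n → ℝ) (ht : ∀ i, t i ∈ Set.Icc a b) :
    ∃ y : Fin n → ℝ, Function.Injective y ∧ (∀ i, y i ∈ Set.Icc a b) ∧ (∀ i, |y i - t i| ≤ η) ∧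
      Set.range t ⊆ Set.range y := by
  classical
  have key : ∀ s : Finset (Fin n), ∃ y : Fin n → ℝ, Set.InjOn y s ∧ (∀ i ∈ s, y i ∈ Set.Icc a b) ∧
      (∀ i ∈ s, |y i - t i| ≤ η) ∧ t '' s ⊆ y '' s := by
    intro s
    induction s using Finset.induction_on with
    | empty => exact ⟨t, by simp, by simp, by simp, by simp⟩
    | insert i s hi ih =>
      obtain ⟨y, hy1, hy2, hy3, hy4⟩ := ih
      have hlt : max a (t i - η) < min b (t i + η) := by
        rw [max_lt_iff, lt_min_iff, lt_min_iff]
        have := ht i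
        exact ⟨⟨hab, by linarith [this.1]⟩, by linarith [this.2], by linarith⟩
      -- If the value `t i` is already taken, any free point nearby will do; otherwise `t i` itself
      -- is kept, so no original point is lost.
      have hex : ∃ z ∈ Set.Icc a b, |z - t i| ≤ η ∧ z ∉ y '' s ∧ (t i = z ∨ t i ∈ y '' s) := by
        by_cases h : t i ∈ y '' s
        · obtain ⟨z, hz1, hz2⟩ := (Set.Icc_infinite hlt).exists_notMem_finset (s.image y)
          refine ⟨z, ⟨(le_max_left _ _).trans hz1.1, hz1.2.trans (min_le_left _ _)⟩, ?_, by simpa using hz2,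
            Or.inr h⟩
          have h1 := (le_max_right _ _).trans hz1.1
          have h2 := hz1.2.trans (min_le_right _ _)
          rw [abs_le]; constructor <;> linarith
        · exact ⟨t i, ht i, by simpa using hη.le, h, Or.inl rfl⟩
      obtain ⟨z, hz1, hz2, hz3, hz4⟩ := hex
      have heq : Set.EqOn (Function.update y i z) y s := fun j hj =>
        Function.update_of_ne (fun h => hi (by rw [← h]; exact hj)) _ _
      have himg : Function.update y i z '' (insert i s : Finset (Fin n)) = insert z (y '' s) := by
        rw [Finset.coe_insert, Set.image_insert_eq, Function.update_self, heq.image_eq]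
      refine ⟨Function.update y i z, ?_, ?_, ?_, ?_⟩
      · rw [Finset.coe_insert, Set.injOn_insert (by simpa using hi)]
        refine ⟨heq.injOn_iff.2 hy1, ?_⟩
        rw [heq.image_eq, Function.update_self]; exact hz3
      · intro j hj
        rcases Finset.mem_insert.1 hj with rfl | hj
        · simpa using hz1
        · rw [heq hj]; exact hy2 j hj
      · intro j hj
        rcases Finset.mem_insert.1 hj with rfl | hj
        · simpa using hz2
        · rw [heq hj]; exact hy3 j hj
      · rw [himg, Finset.coe_insert, Set.image_insert_eq]
        refine Set.insert_subset ?_ (hy4.trans (Set.subset_insert _ _))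
        rcases hz4 with h | h
        · exact Or.inl h
        · exact Or.inr h
  obtain ⟨y, h1, h2, h3, h4⟩ := key Finset.univ
  exact ⟨y, by simpa using h1, fun i => h2 i (Finset.mem_univ i), fun i => h3 i (Finset.mem_univ i),
    by simpa using h4⟩

/-- The partition of `[a, b]` given by the values of `q` at the multiples of `1 / n`. -/
noncomputable def quantilePartition (a b : ℝ) (q : ℝ → ℝ) (n i : ℕ) : ℝ :=
  if i = 0 then a else if n ≤ i then b else q (i / n)

section QuantilePartition

variable {a b : ℝ} {q : ℝ → ℝ} {n : ℕ}

theorem quantilePartition_zero : quantilePartition a b q n 0 = a := if_pos rfl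

theorem quantilePartition_self (hn : 0 < n) : quantilePartition a b q n n = b := by
  simp [quantilePartition, hn.ne']

theorem quantilePartition_mem (hab : a ≤ b) (hq : ∀ s, q s ∈ Set.Icc a b) (i : ℕ) :
    quantilePartition a b q n i ∈ Set.Icc a b := by
  unfold quantilePartition
  split_ifs
  · exact ⟨le_rfl, hab⟩
  · exact ⟨hab, le_rfl⟩
  · exact hq _

theorem monotone_quantilePartition (hab : a ≤ b) (hqm : Monotone q)
    (hq : ∀ s, q s ∈ Set.Icc a b) : Monotone (quantilePartition a b q n) := by
  intro i j hij
  rcases Nat.eq_zero_or_pos i with rfl | hi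
  · rw [quantilePartition_zero]; exact (quantilePartition_mem hab hq j).1
  by_cases hj : n ≤ j
  · have : quantilePartition a b q n j = b := by
      unfold quantilePartition; rw [if_neg (by omega), if_pos hj]
    rw [this]; exact (quantilePartition_mem hab hq i).2
  · unfold quantilePartition
    rw [if_neg (by omega), if_neg (by omega), if_neg (by omega), if_neg hj]
    exact hqm (by gcongr)

theorem quantilePartition_le (hqm : Monotone q) (hq : ∀ s, q s ∈ Set.Icc a b) {i : ℕ}
    (hi : i < n) {s : ℝ} (hs : (i : ℝ) / n ≤ s) : quantilePartition a b q n i ≤ q s := by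
  unfold quantilePartition
  split_ifs with h0 h1
  · exact (hq s).1
  · omega
  · exact hqm hs

theorem le_quantilePartition (hqm : Monotone q) (hq : ∀ s, q s ∈ Set.Icc a b) {i : ℕ}
    {s : ℝ} (hs : s ≤ ((i + 1 : ℕ) : ℝ) / n) : q s ≤ quantilePartition a b q n (i + 1) := by
  unfold quantilePartition
  rw [if_neg (Nat.succ_ne_zero i)]
  split_ifs with h1
  · exact (hq s).2
  · exact hqm hs

/-- Parameters in `(0, 1]` that `q` sends into the open gap lie in `[i / n, (i + 1) / n]`. The gap
has to be open, as atoms at its ends may weigh more than `1 / n`. -/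
theorem measure_gap_quantilePartition_le (hn : 0 < n) (hqm : Monotone q)
    (hq : ∀ s, q s ∈ Set.Icc a b) {ν : Measure ℝ}
    (hν : (volume.restrict (Set.Ioc 0 1)).map q = ν) {i : ℕ} (hi : i < n) :
    ν (Set.Ioo (quantilePartition a b q n i) (quantilePartition a b q n (i + 1))) ≤
      ENNReal.ofReal (n : ℝ)⁻¹ := by
  have hn' : (0 : ℝ) < n := Nat.cast_pos.2 hn
  rw [← hν, Measure.map_apply hqm.measurable measurableSet_Ioo,
    Measure.restrict_apply (hqm.measurable measurableSet_Ioo)]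
  have hsub : q ⁻¹' Set.Ioo (quantilePartition a b q n i) (quantilePartition a b q n (i + 1)) ∩
      Set.Ioc 0 1 ⊆ Set.Icc ((i : ℝ) / n) (((i + 1 : ℕ) : ℝ) / n) := by
    rintro s ⟨⟨h1, h2⟩, h3⟩
    constructor
    · by_contra! h
      rcases Nat.eq_zero_or_pos i with rfl | hi0
      · simp at h; linarith [h3.1]
      · obtain ⟨j, rfl⟩ := Nat.exists_eq_succ_of_ne_zero hi0.ne'
        exact absurd h1 (not_lt.2 (le_quantilePartition hqm hq h.le))
    · by_contra! h
      rcases Nat.lt_or_ge (i + 1) n with hi1 | hi1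
      · exact absurd h2 (not_lt.2 (quantilePartition_le hqm hq hi1 h.le))
      · have : (1 : ℝ) ≤ ((i + 1 : ℕ) : ℝ) / n := by
          rw [le_div_iff₀ hn', one_mul]; exact_mod_cast hi1
        linarith [h3.2]
  refine (measure_mono hsub).trans ?_
  rw [Real.volume_Icc]
  refine ENNReal.ofReal_le_ofReal (le_of_eq ?_)
  push_cast; field_simp; ring

end QuantilePartition

/-! ### Upper bound for the energy of quantile partitions -/

/-- For `s > 0`, the tangent line to `r⁻²` at `r = s⁻¹`; times `r²`, the difference is `(1 - s r)²
(1 + 2 s r)`. -/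
theorem three_mul_sq_sub_le_inv_sq {r s : ℝ} (hr : 0 < r) (hs : 0 ≤ s) :
    3 * s ^ 2 - 2 * s ^ 3 * r ≤ (r ^ 2)⁻¹ := by
  rw [← one_div, le_div_iff₀ (by positivity)]
  nlinarith [mul_nonneg (sq_nonneg (1 - s * r)) (show 0 ≤ 1 + 2 * (s * r) by positivity)]

section EnergyUpperBound

variable {a b δ : ℝ} {ν : Measure ℝ} {f : ℝ → ℝ}

theorem integrable_div_sq_rnDeriv (hδ : 0 < δ)
    (hρ : ∀ᵐ x ∂(volume.restrict (Set.Icc a b)), δ ≤ (ν.rnDeriv volume x).toReal) {h : ℝ → ℝ}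
    (hh : Integrable h (volume.restrict (Set.Icc a b))) :
    Integrable (fun x => h x * ((ν.rnDeriv volume x).toReal ^ 2)⁻¹)
      (volume.restrict (Set.Icc a b)) := by
  refine hh.mul_bdd (c := (δ ^ 2)⁻¹)
    ((((Measure.measurable_rnDeriv _ _).ennreal_toReal).pow_const 2).inv).aestronglyMeasurable
    (hρ.mono fun x hx => ?_)
  rw [Real.norm_of_nonneg (by positivity)]
  exact inv_anti₀ (by positivity) (pow_le_pow_left₀ hδ.le hx 2)

/-- A gap of mass at most `n⁻¹` and density at least `δ` has length at most `(n δ)⁻¹`; this is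
stated separately because the convergence of the points needs it too. The energy is that of constant
loads `g (t i)`, bounded by Jensen's inequality, and the passages between `f` and `g (t i)` cost
multiples of `∫ (f - g (t i))²`. -/
theorem energy_le [IsFiniteMeasure ν] {t : ℕ → ℝ} {N : ℕ} {g : ℝ → ℝ} {r ω n θ : ℝ}
    (hf : MemLp f 2 (volume.restrict (Set.Icc a b))) (hg : Continuous g) (hδ : 0 < δ)
    (hρ : ∀ᵐ x ∂(volume.restrict (Set.Icc a b)), δ ≤ (ν.rnDeriv volume x).toReal)
    (ht : Monotone t) (h0 : t 0 = a) (hN : t N = b) (hn : 0 < n)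
    (hν : ∀ i < N, ν (Set.Ioo (t i) (t (i + 1))) ≤ ENNReal.ofReal n⁻¹)
    (hr : (n * δ)⁻¹ ≤ r) (hosc : ∀ x y, |x - y| ≤ r → |g x - g y| ≤ ω) (hθ : 0 < θ) :
    (∀ i < N, t (i + 1) - t i ≤ (n * δ)⁻¹) ∧
    n ^ 2 * ∑ i ∈ Finset.range N, gapEnergy f (t i) (t (i + 1)) ≤
      (1 + θ) ^ 2 * ((1 / 12) * ∫ x in a..b, f x ^ 2 * ((ν.rnDeriv volume x).toReal ^ 2)⁻¹) +
      ((1 + θ) * (1 + θ⁻¹) * (δ ^ 2)⁻¹ / 12 + (1 + θ⁻¹) * (δ ^ 2)⁻¹) *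
        (2 * (∫ x in a..b, (f x - g x) ^ 2) + 2 * ω ^ 2 * (b - a)) := by
  set ρ : ℝ → ℝ := fun x => (ν.rnDeriv volume x).toReal with hρdef
  have hρi : Integrable ρ volume := Measure.integrable_toReal_rnDeriv
  have hstep : ∀ i, t i ≤ t (i + 1) := fun i => ht (Nat.le_succ i)
  have hsub : ∀ i < N, Set.Ioc (t i) (t (i + 1)) ⊆ Set.Icc a b := fun i hi =>
    Set.Ioc_subset_Icc_self.trans (partition_mem ht h0 hN hi)
  have hρgap : ∀ i < N, ∀ᵐ x ∂(volume.restrict (Set.Ioc (t i) (t (i + 1)))), δ ≤ ρ x := fun i hi =>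
    ae_restrict_of_ae_restrict_of_subset (hsub i hi) hρ
  have hmass : ∀ i < N, ∫ x in t i..t (i + 1), ρ x ≤ n⁻¹ := by
    intro i hi
    rw [intervalIntegral.integral_of_le (hstep i), integral_Ioc_eq_integral_Ioo]
    refine (Measure.setIntegral_toReal_rnDeriv_le (measure_ne_top _ _)).trans ?_
    exact ENNReal.toReal_le_of_le_ofReal (by positivity) (hν i hi)
  have hlen : ∀ i < N, t (i + 1) - t i ≤ (n * δ)⁻¹ := by
    intro i hi
    have h1 : ∫ x in t i..t (i + 1), δ ≤ ∫ x in t i..t (i + 1), ρ x := by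
      rw [intervalIntegral.integral_of_le (hstep i), intervalIntegral.integral_of_le (hstep i)]
      exact integral_mono_ae (integrable_const _) (hρi.restrict) (hρgap i hi)
    rw [intervalIntegral.integral_const, smul_eq_mul] at h1
    have h2 := h1.trans (hmass i hi)
    rw [mul_inv, ← div_eq_mul_inv, le_div_iff₀ hδ]
    exact h2
  refine ⟨hlen, ?_⟩
  have hD := sum_integral_sub_const_sq_le hg hf ht h0 hN (fun i hi => (hlen i hi).trans hr) hosc
  have hfw : Integrable (fun x => f x ^ 2 * (ρ x ^ 2)⁻¹) (volume.restrict (Set.Icc a b)) :=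
    integrable_div_sq_rnDeriv hδ hρ hf.integrable_sq
  have hgap : ∀ i ∈ Finset.range N, n ^ 2 * gapEnergy f (t i) (t (i + 1)) ≤
      (1 + θ) ^ 2 * ((1 / 12) * ∫ x in t i..t (i + 1), f x ^ 2 * (ρ x ^ 2)⁻¹) +
      ((1 + θ) * (1 + θ⁻¹) * (δ ^ 2)⁻¹ / 12 + (1 + θ⁻¹) * (δ ^ 2)⁻¹) *
        ∫ x in t i..t (i + 1), (f x - g (t i)) ^ 2 := by
    intro i hi
    rw [Finset.mem_range] at hi
    have hfi := memLp_gap ht h0 hN hf hi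
    have h1 := gapEnergy_le_of_const (hstep i) hfi (g (t i)) hθ
    set c := g (t i) with hc
    set l := t (i + 1) - t i with hl
    set I := ∫ x in t i..t (i + 1), (f x - c) ^ 2 with hI
    have hl0 : 0 ≤ l := by have := hstep i; linarith
    have hI0 : 0 ≤ I := intervalIntegral.integral_nonneg (hstep i) fun _ _ => sq_nonneg _
    have hnl : (n * l) ^ 2 ≤ (δ ^ 2)⁻¹ := by
      rw [← inv_pow]
      refine pow_le_pow_left₀ (by positivity) ?_ 2
      calc n * l ≤ n * (n * δ)⁻¹ := by gcongr; exact hlen i hi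
        _ = δ⁻¹ := by field_simp
    have hfc : Integrable (fun x => (f x - c) ^ 2) (volume.restrict (Set.Ioc (t i) (t (i + 1)))) :=
      (hfi.sub (memLp_const c)).integrable_sq
    have hfwi : Integrable (fun x => f x ^ 2 * (ρ x ^ 2)⁻¹)
        (volume.restrict (Set.Ioc (t i) (t (i + 1)))) := IntegrableOn.mono_set hfw (hsub i hi)
    have hwi : Integrable (fun x => (ρ x ^ 2)⁻¹)
        (volume.restrict (Set.Ioc (t i) (t (i + 1)))) := by
      have := integrable_div_sq_rnDeriv (h := fun _ => 1) hδ hρ (integrable_const _)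
      simp only [one_mul] at this
      exact IntegrableOn.mono_set this (hsub i hi)
    -- Jensen's inequality for `1 / ρ²`
    have h2 : n ^ 2 * l ^ 3 ≤ ∫ x in t i..t (i + 1), (ρ x ^ 2)⁻¹ := by
      -- The tangent is taken at `1 / (n * l)`, an upper bound for the mean of `ρ` over a
      -- nondegenerate gap.
      have h3 : ∫ x in t i..t (i + 1), (3 * (n * l) ^ 2 - 2 * (n * l) ^ 3 * ρ x) ≤
          ∫ x in t i..t (i + 1), (ρ x ^ 2)⁻¹ := by
        rw [intervalIntegral.integral_of_le (hstep i), intervalIntegral.integral_of_le (hstep i)]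
        refine integral_mono_ae ((integrable_const _).sub (hρi.restrict.const_mul _)) hwi ?_
        filter_upwards [hρgap i hi] with x hx
        exact three_mul_sq_sub_le_inv_sq (hδ.trans_le hx) (by positivity)
      rw [intervalIntegral.integral_sub intervalIntegrable_const
        (hρi.intervalIntegrable.const_mul _),
        intervalIntegral.integral_const_mul (2 * (n * l) ^ 3), intervalIntegral.integral_const,
        smul_eq_mul, ← hl] at h3
      refine le_trans ?_ h3
      calc n ^ 2 * l ^ 3 = l * (3 * (n * l) ^ 2) - 2 * (n * l) ^ 3 * n⁻¹ := by
            field_simp; ring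
        _ ≤ _ := by
            have := hmass i hi
            gcongr
    have h4 : c ^ 2 * ∫ x in t i..t (i + 1), (ρ x ^ 2)⁻¹ ≤
        (1 + θ) * (∫ x in t i..t (i + 1), f x ^ 2 * (ρ x ^ 2)⁻¹) + (1 + θ⁻¹) * (δ ^ 2)⁻¹ * I := by
      rw [hI, ← intervalIntegral.integral_const_mul, ← intervalIntegral.integral_const_mul,
        ← intervalIntegral.integral_const_mul]
      simp only [intervalIntegral.integral_of_le (hstep i)]
      rw [← integral_add (hfwi.const_mul _) (hfc.const_mul _)]
      refine integral_mono_ae (hwi.const_mul _) ((hfwi.const_mul _).add (hfc.const_mul _)) ?_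
      filter_upwards [hρgap i hi] with x hx
      have hw0 : 0 ≤ (ρ x ^ 2)⁻¹ := by positivity
      have hw1 : (ρ x ^ 2)⁻¹ ≤ (δ ^ 2)⁻¹ :=
        inv_anti₀ (by positivity) (pow_le_pow_left₀ hδ.le hx 2)
      have e1 : c ^ 2 ≤ (1 + θ) * f x ^ 2 + (1 + θ⁻¹) * (f x - c) ^ 2 := by
        have h4 : 0 ≤ θ⁻¹ * (θ * f x + (f x - c)) ^ 2 := by positivity
        have h5 : θ⁻¹ * (θ * f x + (f x - c)) ^ 2 =
            θ * f x ^ 2 + 2 * f x * (f x - c) + θ⁻¹ * (f x - c) ^ 2 := by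
          field_simp; ring
        nlinarith
      calc c ^ 2 * (ρ x ^ 2)⁻¹
          ≤ ((1 + θ) * f x ^ 2 + (1 + θ⁻¹) * (f x - c) ^ 2) * (ρ x ^ 2)⁻¹ := by gcongr
        _ = (1 + θ) * (f x ^ 2 * (ρ x ^ 2)⁻¹) + (1 + θ⁻¹) * (ρ x ^ 2)⁻¹ * (f x - c) ^ 2 := by ring
        _ ≤ _ := by gcongr
    calc n ^ 2 * gapEnergy f (t i) (t (i + 1))
        ≤ n ^ 2 * ((1 + θ) * (c ^ 2 * l ^ 3 / 12) + (1 + θ⁻¹) * (l ^ 2 * I)) := by gcongr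
      _ = (1 + θ) / 12 * (c ^ 2 * (n ^ 2 * l ^ 3)) + (1 + θ⁻¹) * ((n * l) ^ 2 * I) := by ring
      _ ≤ (1 + θ) / 12 * (c ^ 2 * ∫ x in t i..t (i + 1), (ρ x ^ 2)⁻¹) +
            (1 + θ⁻¹) * ((δ ^ 2)⁻¹ * I) := by gcongr
      _ ≤ (1 + θ) / 12 * ((1 + θ) * (∫ x in t i..t (i + 1), f x ^ 2 * (ρ x ^ 2)⁻¹) +
            (1 + θ⁻¹) * (δ ^ 2)⁻¹ * I) + (1 + θ⁻¹) * ((δ ^ 2)⁻¹ * I) := by gcongr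
      _ = _ := by ring
  rw [Finset.mul_sum]
  refine (Finset.sum_le_sum hgap).trans ?_
  rw [Finset.sum_add_distrib, ← Finset.mul_sum, ← Finset.mul_sum, ← Finset.mul_sum,
    sum_integral_gaps ht h0 hN hfw]
  gcongr

end EnergyUpperBound

/-- Points of `S` beyond the interior partition points only lower the compliance. A second
partition, through all of `S`, provides the solvability that `compliance_mono` requires. -/
theorem compliance_finset_le {a b : ℝ} (hab : a < b) {f : ℝ → ℝ}
    (hf : MemLp f 2 (volume.restrict (Set.Icc a b))) {t : ℕ → ℝ} {N : ℕ} (ht : Monotone t)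
    (h0 : t 0 = a) (hN : t N = b) {S : Finset ℝ} (hS : ∀ x ∈ S, x ∈ Set.Icc a b)
    (htS : Set.range t ∩ Set.Ioo a b ⊆ S) :
    compliance (Set.Ioo a b \ S) f ≤
      ENNReal.ofReal (∑ i ∈ Finset.range N, gapEnergy f (t i) (t (i + 1))) := by
  classical
  obtain ⟨t', N', ht', h0', hN', hr', -⟩ := exists_partition_of_finset (a := a) (b := b)
    (insert a (insert b S)) (by simp) (by simp) (by
      intro x hx
      rcases Finset.mem_insert.1 hx with rfl | hx
      · exact ⟨le_rfl, hab.le⟩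
      rcases Finset.mem_insert.1 hx with rfl | hx
      · exact ⟨hab.le, le_rfl⟩
      · exact hS x hx)
  have hU : Set.Ioo a b \ Set.range t' = Set.Ioo a b \ S := by
    ext x
    simp only [hr', Set.mem_sdiff, Finset.coe_insert, Set.mem_insert_iff]
    constructor
    · rintro ⟨h1, h2⟩; exact ⟨h1, fun h => h2 (Or.inr (Or.inr h))⟩
    · rintro ⟨h1, h2⟩
      refine ⟨h1, ?_⟩
      rintro (h | h | h)
      · exact h1.1.ne' h
      · exact h1.2.ne h
      · exact h2 h
  obtain ⟨v, v', hv, -⟩ := exists_isWeakSolution ht' h0' hN' hf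
  rw [hU] at hv
  rw [← compliance_compl_range ht h0 hN hf]
  refine compliance_mono (fun x hx => ⟨hx.1, fun h => hx.2 (htS ⟨h, hx.1⟩)⟩) ?_ hv
  refine measure_mono_null (fun x hx => ?_) (S.finite_toSet.measure_zero volume)
  by_contra h
  exact hx.2 ⟨hx.1.1, h⟩

/-- `θ` is fixed first, because the error constant `K` blows up as `θ → 0`; then `ω` and `g` make
the errors small against `K`, and finally large `n` brings the mesh below the scale on which `g`
oscillates by `ω`. -/
theorem eventually_energy_le {a b δ : ℝ} (hab : a ≤ b) {ν : Measure ℝ} [IsFiniteMeasure ν]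
    {f q : ℝ → ℝ} (hf : MemLp f 2 (volume.restrict (Set.Icc a b))) (hδ : 0 < δ)
    (hρ : ∀ᵐ x ∂(volume.restrict (Set.Icc a b)), δ ≤ (ν.rnDeriv volume x).toReal)
    (hqm : Monotone q) (hq : ∀ s, q s ∈ Set.Icc a b)
    (hν : (volume.restrict (Set.Ioc 0 1)).map q = ν) {ε : ℝ} (hε : 0 < ε) :
    ∀ᶠ n : ℕ in atTop, (n : ℝ) ^ 2 * ∑ i ∈ Finset.range n,
        gapEnergy f (quantilePartition a b q n i) (quantilePartition a b q n (i + 1)) ≤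
      (1 / 12) * (∫ x in a..b, f x ^ 2 * ((ν.rnDeriv volume x).toReal ^ 2)⁻¹) + ε := by
  set X := (1 / 12) * (∫ x in a..b, f x ^ 2 * ((ν.rnDeriv volume x).toReal ^ 2)⁻¹) with hX
  obtain ⟨θ, hθ1, hθ⟩ : ∃ θ : ℝ, (1 + θ) ^ 2 * X < X + ε / 3 ∧ 0 < θ := by
    have hc : ContinuousWithinAt (fun θ : ℝ => (1 + θ) ^ 2 * X) (Set.Ioi 0) 0 :=
      Continuous.continuousWithinAt (by fun_prop)
    exact ((hc.eventually (gt_mem_nhds (by simp; linarith))).and self_mem_nhdsWithin).exists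
  set K := (1 + θ) * (1 + θ⁻¹) * (δ ^ 2)⁻¹ / 12 + (1 + θ⁻¹) * (δ ^ 2)⁻¹ with hK
  have hK0 : 0 < K := by positivity
  obtain ⟨ω, hω1, hω⟩ : ∃ ω : ℝ, K * (2 * ω ^ 2 * (b - a)) < ε / 3 ∧ 0 < ω := by
    have hc : ContinuousWithinAt (fun ω : ℝ => K * (2 * ω ^ 2 * (b - a))) (Set.Ioi 0) 0 :=
      Continuous.continuousWithinAt (by fun_prop)
    exact ((hc.eventually (gt_mem_nhds (by simp; linarith))).and self_mem_nhdsWithin).exists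
  obtain ⟨g, hg, hgc, hgη⟩ := exists_continuous_integral_sub_sq_le hf
    (η := ε / (6 * K)) (by positivity)
  have hgη' : K * (2 * ∫ x in a..b, (f x - g x) ^ 2) ≤ ε / 3 := by
    rw [intervalIntegral.integral_of_le hab, ← integral_Icc_eq_integral_Ioc]
    calc K * (2 * ∫ x in Set.Icc a b, (f x - g x) ^ 2) ≤ K * (2 * (ε / (6 * K))) := by gcongr
      _ = ε / 3 := by field_simp; norm_num
  obtain ⟨r, hr, hosc⟩ := Metric.uniformContinuous_iff.1 (hgc.uniformContinuous_of_continuous hg) ω hω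
  have hn : ∀ᶠ n : ℕ in atTop, ((n : ℝ) * δ)⁻¹ ≤ r / 2 := by
    have : Tendsto (fun n : ℕ => ((n : ℝ) * δ)⁻¹) atTop (𝓝 0) :=
      tendsto_inv_atTop_zero.comp (tendsto_natCast_atTop_atTop.atTop_mul_const hδ)
    exact (this.eventually (gt_mem_nhds (half_pos hr))).mono fun _ h => h.le
  filter_upwards [hn, eventually_gt_atTop 0] with n hn1 hn0
  have := (energy_le hf hg hδ hρ (monotone_quantilePartition (n := n) hab hqm hq)
    quantilePartition_zero (quantilePartition_self hn0) (Nat.cast_pos.2 hn0)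
    (fun i hi => measure_gap_quantilePartition_le hn0 hqm hq hν hi) hn1
    (fun x y hxy => (hosc (by rw [Real.dist_eq]; linarith)).le) hθ).2
  rw [← hX, ← hK, mul_add] at this
  linarith

/-- For `s` in `(i / n, (i + 1) / n]` the value `q s` lies in the `i`-th closed gap, hence within
`(n δ)⁻¹ + n⁻¹` of `x n i`. As `q` transports Lebesgue measure to `μ`, uniform continuity of the
integrand compares the two integrals cell by cell. -/
theorem tendsto_empirical {a b δ : ℝ} (hab : a ≤ b) {μ : ProbabilityMeasure (Set.Icc a b)}
    {q : ℝ → ℝ} (hqm : Monotone q) (hq : ∀ s, q s ∈ Set.Icc a b)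
    (hν : (volume.restrict (Set.Ioc 0 1)).map q = toReal μ) (hδ : 0 < δ)
    {y : ℕ → ProbabilityMeasure (Set.Icc a b)} {x : (n : ℕ) → Fin n → Set.Icc a b}
    (hmesh : ∀ n, 0 < n → ∀ i < n, quantilePartition a b q n (i + 1) - quantilePartition a b q n i ≤
      ((n : ℝ) * δ)⁻¹)
    (hx : ∀ n, ∀ i : Fin n, |(x n i : ℝ) - quantilePartition a b q n (i + 1)| ≤ (n : ℝ)⁻¹)
    (hy : ∀ n, 0 < n → (y n : Measure (Set.Icc a b)) =
      (n : ℝ≥0∞)⁻¹ • ∑ i, Measure.dirac (x n i)) :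
    Tendsto y atTop (𝓝 μ) := by
  rw [ProbabilityMeasure.tendsto_iff_forall_integral_tendsto]
  intro G₀
  set G : ℝ → ℝ := Set.IccExtend hab G₀ with hG
  have hGc : Continuous G := G₀.continuous.Icc_extend'
  have hGeq : ∀ z : Set.Icc a b, G z = G₀ z := fun z => Set.IccExtend_val hab _ z
  have hGu : UniformContinuous G :=
    (CompactSpace.uniformContinuous_of_continuous G₀.continuous).comp
      (LipschitzWith.projIcc hab).uniformContinuous
  have hint : ∫ z, G₀ z ∂(μ : Measure (Set.Icc a b)) = ∫ s in (0 : ℝ)..1, G (q s) := by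
    simp only [← hGeq]
    rw [← integral_toReal, ← hν, integral_map hqm.measurable.aemeasurable hGc.aestronglyMeasurable,
      intervalIntegral.integral_of_le zero_le_one]
  have hGb : ∃ C, ∀ z, |G z| ≤ C := ⟨‖G₀‖, fun z => G₀.norm_coe_le_norm _⟩
  obtain ⟨C, hC⟩ := hGb
  have hGqi : ∀ c d : ℝ, IntervalIntegrable (fun s => G (q s)) volume c d := fun c d => by
    rw [intervalIntegrable_iff]
    exact Integrable.of_bound (μ := volume.restrict (Set.Ioc (min c d) (max c d)))
      (hGc.measurable.comp hqm.measurable).aestronglyMeasurable C (ae_of_all _ fun s => hC _)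
  rw [Metric.tendsto_atTop']
  intro ε hε
  obtain ⟨r, hr, hosc⟩ := Metric.uniformContinuous_iff.1 hGu (ε / 2) (half_pos hε)
  have hlim : Tendsto (fun n : ℕ => ((n : ℝ) * δ)⁻¹ + (n : ℝ)⁻¹) atTop (𝓝 0) := by
    have h1 : Tendsto (fun n : ℕ => ((n : ℝ) * δ)⁻¹) atTop (𝓝 0) :=
      tendsto_inv_atTop_zero.comp (tendsto_natCast_atTop_atTop.atTop_mul_const hδ)
    simpa using h1.add (tendsto_inv_atTop_zero.comp tendsto_natCast_atTop_atTop)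
  obtain ⟨n₀, hn₀⟩ := ((hlim.eventually (gt_mem_nhds hr)).and (eventually_gt_atTop 0)).exists_forall_of_atTop
  refine ⟨n₀, fun n hn => ?_⟩
  obtain ⟨hn1, hn2⟩ := hn₀ n hn.le
  have hn' : (0 : ℝ) < n := Nat.cast_pos.2 hn2
  have hemp : ∫ z, G₀ z ∂(y n : Measure (Set.Icc a b)) = ∑ i ∈ Finset.range n,
      if h : i < n then (n : ℝ)⁻¹ * G (x n ⟨i, h⟩) else 0 := by
    simp only [← hGeq]
    rw [← integral_toReal, integral_toReal_smul_sum_dirac Finset.univ (x n) (hy n hn2),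
      Finset.sum_fin_eq_sum_range, Finset.mul_sum]
    refine Finset.sum_congr rfl fun i hi => ?_
    rw [dif_pos (Finset.mem_range.1 hi), dif_pos (Finset.mem_range.1 hi)]
  have hsplit : ∫ s in (0 : ℝ)..1, G (q s) = ∑ i ∈ Finset.range n,
      ∫ s in ((i : ℝ) / n)..(((i + 1 : ℕ) : ℝ) / n), G (q s) := by
    have := intervalIntegral.sum_integral_adjacent_intervals (μ := volume) (f := fun s => G (q s))
      (a := fun i : ℕ => (i : ℝ) / n) (n := n) (fun k _ => hGqi _ _)
    rw [this]
    simp [hn'.ne']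
  rw [hint, hemp, hsplit, Real.dist_eq, ← Finset.sum_sub_distrib]
  have hterm : ∀ i ∈ Finset.range n,
      |(if h : i < n then (n : ℝ)⁻¹ * G (x n ⟨i, h⟩) else 0) -
        ∫ s in ((i : ℝ) / n)..(((i + 1 : ℕ) : ℝ) / n), G (q s)| ≤ ε / 2 * (n : ℝ)⁻¹ := by
    intro i hi
    rw [Finset.mem_range] at hi
    have hlen : ((i + 1 : ℕ) : ℝ) / n - (i : ℝ) / n = (n : ℝ)⁻¹ := by
      push_cast; field_simp; ring
    have hle : (i : ℝ) / n ≤ ((i + 1 : ℕ) : ℝ) / n := by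
      have : 0 < (n : ℝ)⁻¹ := by positivity
      linarith
    rw [dif_pos hi]
    have e : (n : ℝ)⁻¹ * G (x n ⟨i, hi⟩) =
        ∫ s in ((i : ℝ) / n)..(((i + 1 : ℕ) : ℝ) / n), G (x n ⟨i, hi⟩) := by
      rw [intervalIntegral.integral_const, hlen, smul_eq_mul]
    rw [e, ← intervalIntegral.integral_sub intervalIntegrable_const (hGqi _ _)]
    have h2 := intervalIntegral.norm_integral_le_of_norm_le_const (a := (i : ℝ) / n)
      (b := ((i + 1 : ℕ) : ℝ) / n) (C := ε / 2) (f := fun s => G (x n ⟨i, hi⟩) - G (q s))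
      (fun s hs => ?_)
    · rwa [hlen, abs_of_pos (inv_pos.2 hn'), Real.norm_eq_abs] at h2
    · rw [Set.uIoc_of_le hle] at hs
      rw [← dist_eq_norm]
      refine (hosc ?_).le
      have h3 := quantilePartition_le hqm hq hi hs.1.le
      have h4 := le_quantilePartition hqm hq hs.2
      have h5 := hmesh n hn2 i hi
      have h6 := abs_le.1 (hx n ⟨i, hi⟩)
      rw [Real.dist_eq]
      refine lt_of_le_of_lt ?_ hn1
      rw [abs_le]
      constructor <;> linarith [h6.1, h6.2]
  calc _ ≤ ∑ i ∈ Finset.range n, ε / 2 * (n : ℝ)⁻¹ :=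
        (Finset.abs_sum_le_sum_abs _ _).trans (Finset.sum_le_sum hterm)
    _ = ε / 2 := by simp; field_simp
    _ < ε := half_lt_self hε

/-! ### Passing between measures on `[a, b]` and on `ℝ` -/

section OfMeasure

variable {a b : ℝ}

/-- A measure on `ℝ` giving mass one to `[a, b]`, as a probability measure on `[a, b]`. -/
noncomputable def ofMeasure (ν : Measure ℝ) (hν : ν (Set.Icc a b) = 1) :
    ProbabilityMeasure (Set.Icc a b) :=
  ⟨ν.comap Subtype.val, ⟨by
    rw [(MeasurableEmbedding.subtype_coe measurableSet_Icc).comap_apply, Set.image_univ,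
      Subtype.range_coe]
    exact hν⟩⟩

theorem toReal_ofMeasure (ν : Measure ℝ) (hν : ν (Set.Icc a b) = 1) :
    toReal (ofMeasure ν hν) = ν.restrict (Set.Icc a b) := by
  have := (MeasurableEmbedding.subtype_coe (measurableSet_Icc (a := a) (b := b))).map_comap ν
  rw [Subtype.range_coe] at this
  exact this

theorem toReal_injective : Function.Injective (toReal (a := a) (b := b)) := by
  intro μ ν h
  have := congrArg (Measure.comap (Subtype.val : Set.Icc a b → ℝ)) h
  unfold toReal at this
  rw [(MeasurableEmbedding.subtype_coe measurableSet_Icc).comap_map,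
    (MeasurableEmbedding.subtype_coe measurableSet_Icc).comap_map] at this
  exact ProbabilityMeasure.toMeasure_injective this

theorem toReal_Icc (μ : ProbabilityMeasure (Set.Icc a b)) : toReal μ (Set.Icc a b) = 1 := by
  rw [toReal_apply μ measurableSet_Icc]; simp

theorem toReal_restrict_Icc (μ : ProbabilityMeasure (Set.Icc a b)) :
    (toReal μ).restrict (Set.Icc a b) = toReal μ := by
  refine Measure.restrict_eq_self_of_ae_mem ?_
  rw [ae_iff]
  exact (prob_compl_eq_zero_iff measurableSet_Icc).2 (toReal_Icc μ)

end OfMeasure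

/-! ### Recovery sequences for densities bounded below -/

/-- Uniform mass on exactly `n` distinct points is admissible for both functionals. The quantiles
are still among these points after the perturbation, so the energy bound for the quantile partition
applies. -/
theorem exists_recovery_of_le_density {a b δ : ℝ} (hab : a < b) {f : ℝ → ℝ}
    (hf : MemLp f 2 (volume.restrict (Set.Icc a b))) (μ : ProbabilityMeasure (Set.Icc a b))
    (hδ : 0 < δ)
    (hρ : ∀ᵐ x ∂(volume.restrict (Set.Icc a b)), δ ≤ ((toReal μ).rnDeriv volume x).toReal) :
    ∃ y : ℕ → ProbabilityMeasure (Set.Icc a b), Tendsto y atTop (𝓝 μ) ∧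
      ∀ c, limitFunctional a b f μ < c → ∀ᶠ n in atTop,
        pointFunctional a b f n (y n) ≤ c ∧ multiPointFunctional a b f n (y n) ≤ c := by
  classical
  obtain ⟨q, hqm, hq, hqν⟩ := exists_quantile hab.le (toReal μ) (toReal_Icc μ)
  have hex : ∀ n : ℕ, ∃ x : Fin n → ℝ, Function.Injective x ∧ (∀ i, x i ∈ Set.Icc a b) ∧
      (∀ i : Fin n, |x i - quantilePartition a b q n (i + 1)| ≤ (n : ℝ)⁻¹) ∧
      Set.range (fun i : Fin n => quantilePartition a b q n (i + 1)) ⊆ Set.range x := by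
    intro n
    rcases Nat.eq_zero_or_pos n with rfl | hn
    · exact ⟨Fin.elim0, fun i => i.elim0, fun i => i.elim0, fun i => i.elim0,
        by rintro _ ⟨i, _⟩; exact i.elim0⟩
    · exact exists_injective_perturbation hab (by positivity) _
        fun i => quantilePartition_mem hab.le hq _
  choose x hx1 hx2 hx3 hx4 using hex
  let z : (n : ℕ) → Fin n → Set.Icc a b := fun n i => ⟨x n i, hx2 n i⟩
  have hzinj : ∀ n, Function.Injective (z n) := fun n i j hij =>
    hx1 n (congrArg Subtype.val hij)
  have hprob : ∀ n : ℕ, 0 < n → IsProbabilityMeasure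
      ((n : ℝ≥0∞)⁻¹ • ∑ i, Measure.dirac (z n i)) := fun n hn => ⟨by
    simp [ENNReal.inv_mul_cancel (Nat.cast_ne_zero.2 hn.ne') (ENNReal.natCast_ne_top n)]⟩
  let y : ℕ → ProbabilityMeasure (Set.Icc a b) := fun n =>
    if hn : 0 < n then ⟨(n : ℝ≥0∞)⁻¹ • ∑ i, Measure.dirac (z n i), hprob n hn⟩ else μ
  have hy : ∀ n, 0 < n → (y n : Measure (Set.Icc a b)) =
      (n : ℝ≥0∞)⁻¹ • ∑ i, Measure.dirac (z n i) := fun n hn => by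
    have : y n = ⟨_, hprob n hn⟩ := dif_pos hn
    rw [this]; rfl
  have hmesh : ∀ n, 0 < n → ∀ i < n, quantilePartition a b q n (i + 1) -
      quantilePartition a b q n i ≤ ((n : ℝ) * δ)⁻¹ := fun n hn =>
    -- Only the mesh bound is extracted, so `g`, `ω` and `θ` take arbitrary admissible values.
    (energy_le (ν := toReal μ) (g := fun _ => 0) (ω := 0) (θ := 1) hf continuous_const hδ hρ
      (monotone_quantilePartition (n := n) hab.le hqm hq) quantilePartition_zero
      (quantilePartition_self hn) (Nat.cast_pos.2 hn)
      (fun i hi => measure_gap_quantilePartition_le hn hqm hq hqν hi) le_rfl (by simp)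
      one_pos).1
  refine ⟨y, tendsto_empirical hab.le hqm hq hqν hδ hmesh (fun n i => hx3 n i) hy, fun c hc => ?_⟩
  -- the limit functional as a real integral
  set X := (1 / 12) * ∫ x in a..b, f x ^ 2 * (((toReal μ).rnDeriv volume x).toReal ^ 2)⁻¹ with hX
  have hlimit : limitFunctional a b f μ = ENNReal.ofReal X := by
    have hi := integrable_div_sq_rnDeriv hδ hρ hf.integrable_sq
    rw [hX, ENNReal.ofReal_mul (by norm_num), intervalIntegral.integral_of_le hab.le,
      ← integral_Icc_eq_integral_Ioc, ofReal_integral_eq_lintegral_ofReal hi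
        (ae_of_all _ fun x => by positivity), limitFunctional]
    congr 1
    · rw [ENNReal.ofReal_div_of_pos (by norm_num)]; norm_num
    · refine lintegral_congr_ae ?_
      filter_upwards [hρ, ae_restrict_of_ae (Measure.rnDeriv_lt_top (toReal μ) volume)] with x h1 h2
      have h3 : 0 < ((toReal μ).rnDeriv volume x).toReal := hδ.trans_le h1
      rw [← div_eq_mul_inv, ENNReal.ofReal_div_of_pos (by positivity), ENNReal.ofReal_pow h3.le,
        ENNReal.ofReal_toReal h2.ne]
  obtain ⟨ε, hε, hεc⟩ : ∃ ε > 0, ENNReal.ofReal (X + ε) ≤ c := by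
    rw [hlimit] at hc
    have hcont : ContinuousWithinAt (fun ε : ℝ => ENNReal.ofReal (X + ε)) (Set.Ioi 0) 0 :=
      (ENNReal.continuous_ofReal.comp
        (continuous_const.add continuous_id)).continuousWithinAt
    obtain ⟨ε, h1, h2⟩ := ((hcont.eventually (gt_mem_nhds (by simpa using hc))).and
      self_mem_nhdsWithin).exists
    exact ⟨ε, h2, h1.le⟩
  filter_upwards [eventually_energy_le hab.le hf hδ hρ hqm hq hqν hε, eventually_gt_atTop 0]
    with n hn hn0
  have hn' : (0 : ℝ) < n := Nat.cast_pos.2 hn0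
  set S : Finset (Set.Icc a b) := Finset.univ.image (z n) with hS
  have hcoe : (↑S : Set (Set.Icc a b)) = Set.range (z n) := by simp [hS]
  have hbound : (n : ℝ≥0∞) ^ 2 * pointCompliance a b f (↑S : Set (Set.Icc a b)) ≤ c := by
    have h1 := compliance_finset_le hab hf (monotone_quantilePartition (n := n) hab.le hqm hq)
      quantilePartition_zero (quantilePartition_self hn0) (S := S.image Subtype.val)
      (by
        intro w hw
        obtain ⟨w', _, rfl⟩ := Finset.mem_image.1 hw
        exact w'.2)
      (by
        rintro _ ⟨⟨i, rfl⟩, hi⟩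
        have hi0 : i ≠ 0 := by
          rintro rfl
          rw [quantilePartition_zero] at hi; exact lt_irrefl _ hi.1
        have hin : i < n := by
          by_contra! h
          have : quantilePartition a b q n i = b := by
            unfold quantilePartition; rw [if_neg hi0, if_pos h]
          rw [this] at hi; exact lt_irrefl _ hi.2
        obtain ⟨j, rfl⟩ := Nat.exists_eq_succ_of_ne_zero hi0
        obtain ⟨k, hk⟩ := hx4 n ⟨⟨j, by omega⟩, rfl⟩
        rw [Finset.coe_image, hcoe]
        exact ⟨z n k, ⟨k, rfl⟩, hk⟩)
    rw [Finset.coe_image] at h1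
    refine le_trans (mul_le_mul_right h1 _) (le_trans ?_ hεc)
    rw [← ENNReal.ofReal_natCast, ← ENNReal.ofReal_pow hn'.le, ← ENNReal.ofReal_mul (by positivity)]
    exact ENNReal.ofReal_le_ofReal hn
  constructor
  · refine iInf_le_of_le S (iInf_le_of_le ⟨?_, ?_⟩ hbound)
    · exact Finset.card_image_le.trans (by simp)
    · rw [hy n hn0, hS, Finset.card_image_of_injective _ (hzinj n),
        Finset.sum_image (hzinj n).injOn, Finset.card_univ, Fintype.card_fin]
  · refine iInf_le_of_le (z n) (iInf_le_of_le (hy n hn0) ?_)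
    rw [← hcoe]; exact hbound

/-! ### Reduction to densities bounded below -/

section Mixing

variable {a b : ℝ}

/-- The convex combination of `μ` and the uniform distribution. -/
theorem exists_mixture (hab : a < b) (μ : ProbabilityMeasure (Set.Icc a b)) {s : ℝ} (hs0 : 0 ≤ s)
    (hs1 : s ≤ 1) : ∃ μ' : ProbabilityMeasure (Set.Icc a b),
      toReal μ' = ENNReal.ofReal (1 - s) • toReal μ +
        ENNReal.ofReal (s * (b - a)⁻¹) • volume.restrict (Set.Icc a b) := by
  have hba : 0 < b - a := by linarith
  have h : (ENNReal.ofReal (1 - s) • toReal μ +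
      ENNReal.ofReal (s * (b - a)⁻¹) • volume.restrict (Set.Icc a b)) (Set.Icc a b) = 1 := by
    simp only [Measure.add_apply, Measure.smul_apply, toReal_Icc, smul_eq_mul, mul_one,
      Measure.restrict_apply_self, Real.volume_Icc]
    rw [← ENNReal.ofReal_mul (by positivity), ← ENNReal.ofReal_add (by linarith) (by positivity)]
    have : 1 - s + s * (b - a)⁻¹ * (b - a) = 1 := by field_simp; ring
    rw [this, ENNReal.ofReal_one]
  refine ⟨ofMeasure _ h, ?_⟩
  rw [toReal_ofMeasure, Measure.restrict_add, Measure.restrict_smul, Measure.restrict_smul,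
    toReal_restrict_Icc, Measure.restrict_restrict measurableSet_Icc, Set.inter_self]

theorem rnDeriv_mixture {μ μ' : ProbabilityMeasure (Set.Icc a b)} {s r : ℝ}
    (h : toReal μ' = ENNReal.ofReal s • toReal μ +
      ENNReal.ofReal r • volume.restrict (Set.Icc a b)) :
    ∀ᵐ x ∂(volume.restrict (Set.Icc a b)), (toReal μ').rnDeriv volume x =
      ENNReal.ofReal s * (toReal μ).rnDeriv volume x + ENNReal.ofReal r := by
  have : IsFiniteMeasure (ENNReal.ofReal s • toReal μ) :=
    Measure.smul_finite _ ENNReal.ofReal_ne_top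
  have : IsFiniteMeasure (ENNReal.ofReal r • (volume : Measure ℝ).restrict (Set.Icc a b)) :=
    Measure.smul_finite _ ENNReal.ofReal_ne_top
  have h1 := Measure.rnDeriv_add' (ENNReal.ofReal s • toReal μ)
    (ENNReal.ofReal r • volume.restrict (Set.Icc a b)) volume
  have h2 := Measure.rnDeriv_smul_left_of_ne_top' (toReal μ) volume
    (ENNReal.ofReal_ne_top (r := s))
  have h3 := Measure.rnDeriv_smul_left_of_ne_top' (volume.restrict (Set.Icc a b)) volume
    (ENNReal.ofReal_ne_top (r := r))
  have h4 := Measure.rnDeriv_restrict_self (volume : Measure ℝ) (measurableSet_Icc (a := a) (b := b))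
  rw [h]
  filter_upwards [ae_restrict_of_ae h1, ae_restrict_of_ae h2, ae_restrict_of_ae h3,
    ae_restrict_of_ae h4, ae_restrict_mem measurableSet_Icc] with x e1 e2 e3 e4 hx
  rw [e1, Pi.add_apply, e2, e3, Pi.smul_apply, Pi.smul_apply, e4, Set.indicator_of_mem hx]
  simp

/-- The density of the mixture is at least `s` times that of `μ`. -/
theorem limitFunctional_mixture_le {f : ℝ → ℝ} {μ μ' : ProbabilityMeasure (Set.Icc a b)} {s r : ℝ}
    (hs : 0 < s) (h : toReal μ' = ENNReal.ofReal s • toReal μ +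
      ENNReal.ofReal r • volume.restrict (Set.Icc a b)) :
    limitFunctional a b f μ' ≤ ENNReal.ofReal ((s ^ 2)⁻¹) * limitFunctional a b f μ := by
  unfold limitFunctional
  rw [mul_left_comm]
  gcongr
  rw [← lintegral_const_mul' _ _ ENNReal.ofReal_ne_top]
  refine lintegral_mono_ae ?_
  filter_upwards [rnDeriv_mixture h] with x hx
  rw [hx]
  set ρ := (toReal μ).rnDeriv volume x
  have hs' : ENNReal.ofReal s ≠ 0 := by simpa using hs
  calc ENNReal.ofReal (f x ^ 2) / (ENNReal.ofReal s * ρ + ENNReal.ofReal r) ^ 2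
      ≤ ENNReal.ofReal (f x ^ 2) / (ENNReal.ofReal s * ρ) ^ 2 := by
        gcongr; exact le_self_add
    _ = _ := by
        rw [mul_pow, div_eq_mul_inv, ENNReal.mul_inv (Or.inl (pow_ne_zero 2 hs'))
          (Or.inl (ENNReal.pow_ne_top ENNReal.ofReal_ne_top)), ENNReal.ofReal_inv_of_pos (by positivity),
          ENNReal.ofReal_pow hs.le, div_eq_mul_inv]
        ring

/-- A small admixture of the uniform measure stays in `V`, raises the limit functional by a factor
close to one, and bounds the density below. The recovery sequence of such a mixture eventually
enters `V`. -/
theorem eventually_exists_near_optimal (hab : a < b) {f : ℝ → ℝ}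
    (hf : MemLp f 2 (volume.restrict (Set.Icc a b))) (μ : ProbabilityMeasure (Set.Icc a b))
    {V : Set (ProbabilityMeasure (Set.Icc a b))} (hV : V ∈ 𝓝 μ) {c : ℝ≥0∞}
    (hc : limitFunctional a b f μ < c) :
    ∀ᶠ n in atTop, ∃ y ∈ V, pointFunctional a b f n y ≤ c ∧ multiPointFunctional a b f n y ≤ c := by
  have hba : 0 < b - a := by linarith
  -- The shift by `2` gives `s k < 1` for all `k`, so that `μ` keeps a positive weight.
  let s : ℕ → ℝ := fun k => 1 / ((k : ℝ) + 2)
  have hs0 : ∀ k, 0 < s k := fun k => by positivity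
  have hs1 : ∀ k, s k < 1 := fun k => by
    simp only [s]; rw [div_lt_one (by positivity)]; linarith [show (0 : ℝ) ≤ k from Nat.cast_nonneg k]
  have hslim : Tendsto s atTop (𝓝 0) :=
    tendsto_const_nhds.div_atTop (tendsto_natCast_atTop_atTop.atTop_add tendsto_const_nhds)
  choose μ' hμ' using fun k => exists_mixture hab μ (hs0 k).le (hs1 k).le
  have hlim : Tendsto μ' atTop (𝓝 μ) := by
    rw [ProbabilityMeasure.tendsto_iff_forall_integral_tendsto]
    intro G₀
    set G : ℝ → ℝ := Set.IccExtend hab.le G₀ with hG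
    have hGc : Continuous G := G₀.continuous.Icc_extend'
    have hGeq : ∀ z : Set.Icc a b, G z = G₀ z := fun z => Set.IccExtend_val hab.le _ z
    have hGb : ∀ z, ‖G z‖ ≤ ‖G₀‖ := fun z => G₀.norm_coe_le_norm _
    simp only [← hGeq]
    simp only [← integral_toReal, hμ']
    have e : ∀ k, ∫ x, G x ∂(ENNReal.ofReal (1 - s k) • toReal μ +
        ENNReal.ofReal (s k * (b - a)⁻¹) • volume.restrict (Set.Icc a b)) =
        (1 - s k) * (∫ x, G x ∂(toReal μ)) +
          (s k * (b - a)⁻¹) * ∫ x in Set.Icc a b, G x := by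
      intro k
      have i1 : Integrable G (toReal μ) :=
        Integrable.of_bound hGc.aestronglyMeasurable _ (ae_of_all _ hGb)
      have i2 : Integrable G (volume.restrict (Set.Icc a b)) :=
        Integrable.of_bound hGc.aestronglyMeasurable _ (ae_of_all _ hGb)
      rw [integral_add_measure (i1.smul_measure ENNReal.ofReal_ne_top)
        (i2.smul_measure ENNReal.ofReal_ne_top), integral_smul_measure, integral_smul_measure,
        ENNReal.toReal_ofReal (by linarith [hs1 k]),
        ENNReal.toReal_ofReal (mul_nonneg (hs0 k).le (by positivity))]
      rfl
    simp only [e]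
    have := ((tendsto_const_nhds (x := (1 : ℝ))).sub hslim).mul_const (∫ x, G x ∂(toReal μ)) |>.add
      ((hslim.mul_const (b - a)⁻¹).mul_const (∫ x in Set.Icc a b, G x))
    simpa using this
  have hFlim : ∀ᶠ k in atTop, limitFunctional a b f (μ' k) < c := by
    have h1 : Tendsto (fun k => ENNReal.ofReal (((1 - s k) ^ 2)⁻¹) * limitFunctional a b f μ) atTop
        (𝓝 (1 * limitFunctional a b f μ)) := by
      refine ENNReal.Tendsto.mul_const ?_ (Or.inr hc.ne_top)
      rw [← ENNReal.ofReal_one]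
      refine ENNReal.tendsto_ofReal ?_
      have := (((tendsto_const_nhds (x := (1 : ℝ))).sub hslim).pow 2).inv₀ (by norm_num)
      simpa using this
    rw [one_mul] at h1
    filter_upwards [h1.eventually (gt_mem_nhds hc)] with k hk
    exact (limitFunctional_mixture_le (by linarith [hs1 k]) (hμ' k)).trans_lt hk
  obtain ⟨k, hk1, hk2⟩ := ((hlim.eventually (eventually_mem_nhds_iff.2 hV)).and hFlim).exists
  have hδ : 0 < s k * (b - a)⁻¹ := mul_pos (hs0 k) (by positivity)
  obtain ⟨y, hy1, hy2⟩ := exists_recovery_of_le_density hab hf (μ' k) hδ (by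
    filter_upwards [rnDeriv_mixture (hμ' k),
      ae_restrict_of_ae (Measure.rnDeriv_lt_top (toReal (μ' k)) volume)] with x h1 h2
    rw [← ENNReal.ofReal_le_iff_le_toReal h2.ne, h1]
    exact le_add_self)
  filter_upwards [hy2 c hk2, hy1.eventually hk1] with n h1 h2
  exact ⟨y n, h2, h1⟩

end Mixing

/-! ### The unique minimizer -/

section Minimizer

theorem rpow_two_thirds_pow_three (y : ℝ) : (|y| ^ (2 / 3 : ℝ)) ^ 3 = y ^ 2 := by
  rw [← Real.rpow_natCast, ← Real.rpow_mul (abs_nonneg y), ← sq_abs y, ← Real.rpow_natCast]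
  norm_num

/-- Young's inequality for `t ^ 3 / ρ ^ 2 + 2 C ^ 3 ρ`. -/
theorem young_div_sq {C t : ℝ} (hC : 0 < C) (ht : 0 ≤ t) {ρ : ℝ≥0∞} (hρ : ρ ≠ ⊤) :
    ENNReal.ofReal (3 * C ^ 2 * t) ≤
      ENNReal.ofReal (t ^ 3) / ρ ^ 2 + ENNReal.ofReal (2 * C ^ 3) * ρ := by
  rcases eq_or_ne ρ 0 with rfl | h0
  · rcases ht.eq_or_lt with rfl | ht
    · simp
    · rw [zero_pow two_ne_zero, ENNReal.div_zero (by simpa using pow_pos ht 3)]; simp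
  obtain ⟨r, rfl⟩ : ∃ r : ℝ, ρ = ENNReal.ofReal r :=
    ⟨ρ.toReal, (ENNReal.ofReal_toReal hρ).symm⟩
  have hr : 0 < r := by simpa using h0
  rw [← ENNReal.ofReal_pow hr.le, ← ENNReal.ofReal_div_of_pos (by positivity),
    ← ENNReal.ofReal_mul (by positivity), ← ENNReal.ofReal_add (by positivity) (by positivity)]
  refine ENNReal.ofReal_le_ofReal ?_
  have h : t ^ 3 / r ^ 2 + 2 * C ^ 3 * r - 3 * C ^ 2 * t =
      (t - C * r) ^ 2 * (t + 2 * C * r) / r ^ 2 := by field_simp; ring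
  have : 0 ≤ (t - C * r) ^ 2 * (t + 2 * C * r) / r ^ 2 := by positivity
  linarith

/-- For `0 < r = ρ` the defect in Young's inequality is `(t - C r)² (t + 2 C r) / r²`; for `ρ = 0`
equality forces `t = 0`. -/
theorem eq_of_young_div_sq_eq {C t : ℝ} (hC : 0 < C) (ht : 0 ≤ t) {ρ : ℝ≥0∞} (hρ : ρ ≠ ⊤)
    (h : ENNReal.ofReal (3 * C ^ 2 * t) =
      ENNReal.ofReal (t ^ 3) / ρ ^ 2 + ENNReal.ofReal (2 * C ^ 3) * ρ) :
    ρ = ENNReal.ofReal (C⁻¹ * t) := by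
  rcases eq_or_ne ρ 0 with rfl | h0
  · rcases ht.eq_or_lt with rfl | ht
    · simp
    · rw [zero_pow two_ne_zero, ENNReal.div_zero (by simpa using pow_pos ht 3)] at h; simp at h
  obtain ⟨r, rfl⟩ : ∃ r : ℝ, ρ = ENNReal.ofReal r :=
    ⟨ρ.toReal, (ENNReal.ofReal_toReal hρ).symm⟩
  have hr : 0 < r := by simpa using h0
  rw [← ENNReal.ofReal_pow hr.le, ← ENNReal.ofReal_div_of_pos (by positivity),
    ← ENNReal.ofReal_mul (by positivity), ← ENNReal.ofReal_add (by positivity) (by positivity),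
    ENNReal.ofReal_eq_ofReal_iff (by positivity) (by positivity)] at h
  have h2 : (t - C * r) ^ 2 * (t + 2 * C * r) / r ^ 2 = 0 := by
    have : t ^ 3 / r ^ 2 + 2 * C ^ 3 * r - 3 * C ^ 2 * t =
      (t - C * r) ^ 2 * (t + 2 * C * r) / r ^ 2 := by field_simp; ring
    linarith
  have h3 : t + 2 * C * r ≠ 0 := by positivity
  have h4 : t - C * r = 0 := by simpa [hr.ne', h3] using h2
  congr 1
  field_simp
  linarith

variable {a b : ℝ} {f : ℝ → ℝ}

/-- With `t = |f|^(2/3)`, dominate by `t ≤ 1 + t³ = 1 + f²`. -/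
theorem integrable_rpow_two_thirds (hf : MemLp f 2 (volume.restrict (Set.Icc a b))) :
    Integrable (fun x => |f x| ^ (2 / 3 : ℝ)) (volume.restrict (Set.Icc a b)) := by
  refine Integrable.mono' ((integrable_const (1 : ℝ)).add hf.integrable_sq)
    (hf.aestronglyMeasurable.aemeasurable.norm.pow_const _).aestronglyMeasurable
    (ae_of_all _ fun x => ?_)
  have h0 : 0 ≤ |f x| ^ (2 / 3 : ℝ) := by positivity
  rw [Real.norm_of_nonneg h0, Pi.add_apply, ← rpow_two_thirds_pow_three]
  generalize |f x| ^ (2 / 3 : ℝ) = t at h0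
  nlinarith [mul_nonneg h0 (sq_nonneg (t - 1)), sq_nonneg (t - 1)]

theorem integral_rpow_two_thirds_pos (hf : MemLp f 2 (volume.restrict (Set.Icc a b)))
    (hf0 : ¬ f =ᵐ[volume.restrict (Set.Icc a b)] 0) :
    0 < ∫ t in Set.Icc a b, |f t| ^ (2 / 3 : ℝ) := by
  have hnn : ∀ x, 0 ≤ |f x| ^ (2 / 3 : ℝ) := fun x => by positivity
  refine (integral_nonneg hnn).lt_of_ne' fun h => hf0 ?_
  filter_upwards [(integral_eq_zero_iff_of_nonneg hnn (integrable_rpow_two_thirds hf)).1 h]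
    with x hx
  have : f x ^ 2 = 0 := by
    rw [← rpow_two_thirds_pow_three, show |f x| ^ (2 / 3 : ℝ) = 0 from hx]; norm_num
  simpa using this

theorem lintegral_ofReal_mul_rpow (hf : MemLp f 2 (volume.restrict (Set.Icc a b))) {r : ℝ}
    (hr : 0 ≤ r) : ∫⁻ x in Set.Icc a b, ENNReal.ofReal (r * |f x| ^ (2 / 3 : ℝ)) =
      ENNReal.ofReal (r * ∫ x in Set.Icc a b, |f x| ^ (2 / 3 : ℝ)) := by
  rw [← integral_const_mul, ofReal_integral_eq_lintegral_ofReal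
    ((integrable_rpow_two_thirds hf).const_mul r) (ae_of_all _ fun x => by positivity)]

theorem lintegral_rnDeriv_Icc_le (ν : ProbabilityMeasure (Set.Icc a b)) :
    ∫⁻ x in Set.Icc a b, (toReal ν).rnDeriv volume x ≤ 1 := by
  rw [← toReal_Icc ν]
  exact Measure.setLIntegral_rnDeriv_le _

theorem aemeasurable_div_rnDeriv_sq (hf : MemLp f 2 (volume.restrict (Set.Icc a b)))
    (ν : ProbabilityMeasure (Set.Icc a b)) :
    AEMeasurable (fun x => ENNReal.ofReal (f x ^ 2) / ((toReal ν).rnDeriv volume x) ^ 2)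
      (volume.restrict (Set.Icc a b)) :=
  (hf.aestronglyMeasurable.aemeasurable.pow_const 2).ennreal_ofReal.div
    ((Measure.measurable_rnDeriv _ _).pow_const 2).aemeasurable

theorem lintegral_young (hf : MemLp f 2 (volume.restrict (Set.Icc a b)))
    (ν : ProbabilityMeasure (Set.Icc a b)) (C : ℝ) :
    ∫⁻ x in Set.Icc a b, (ENNReal.ofReal (f x ^ 2) / ((toReal ν).rnDeriv volume x) ^ 2 +
        ENNReal.ofReal (2 * C ^ 3) * (toReal ν).rnDeriv volume x) ≤
      (∫⁻ x in Set.Icc a b, ENNReal.ofReal (f x ^ 2) / ((toReal ν).rnDeriv volume x) ^ 2) +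
        ENNReal.ofReal (2 * C ^ 3) := by
  rw [lintegral_add_left' (aemeasurable_div_rnDeriv_sq hf ν),
    lintegral_const_mul' _ _ ENNReal.ofReal_ne_top]
  gcongr
  exact mul_le_of_le_one_right' (lintegral_rnDeriv_Icc_le ν)

theorem ae_young (ν : ProbabilityMeasure (Set.Icc a b)) {C : ℝ} (hC : 0 < C) :
    ∀ᵐ x ∂(volume.restrict (Set.Icc a b)), ENNReal.ofReal (3 * C ^ 2 * |f x| ^ (2 / 3 : ℝ)) ≤
      ENNReal.ofReal (f x ^ 2) / ((toReal ν).rnDeriv volume x) ^ 2 +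
        ENNReal.ofReal (2 * C ^ 3) * (toReal ν).rnDeriv volume x := by
  filter_upwards [ae_restrict_of_ae (Measure.rnDeriv_lt_top (toReal ν) volume)] with x hx
  rw [← rpow_two_thirds_pow_three (f x)]
  exact young_div_sq hC (by positivity) hx.ne

/-- Young's inequality integrates to `3 C³ ≤ ∫ f² / ρ² + 2 C³`, because the absolutely continuous
part has mass at most one. -/
theorem le_lintegral_div_rnDeriv_sq (hf : MemLp f 2 (volume.restrict (Set.Icc a b)))
    (ν : ProbabilityMeasure (Set.Icc a b)) {C : ℝ} (hC : 0 < C)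
    (hCf : ∫ x in Set.Icc a b, |f x| ^ (2 / 3 : ℝ) = C) :
    ENNReal.ofReal (C ^ 3) ≤
      ∫⁻ x in Set.Icc a b, ENNReal.ofReal (f x ^ 2) / ((toReal ν).rnDeriv volume x) ^ 2 := by
  have h := (lintegral_mono_ae (ae_young (f := f) ν hC)).trans (lintegral_young hf ν C)
  rw [lintegral_ofReal_mul_rpow hf (by positivity), hCf,
    show 3 * C ^ 2 * C = C ^ 3 + 2 * C ^ 3 by ring,
    ENNReal.ofReal_add (by positivity) (by positivity)] at h
  exact (ENNReal.add_le_add_iff_right ENNReal.ofReal_ne_top).1 h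

/-- If the minimum is attained, the integrated Young inequality is an equality of finite integrals,
hence the pointwise one is an equality almost everywhere. -/
theorem rnDeriv_eq_of_lintegral_le (hf : MemLp f 2 (volume.restrict (Set.Icc a b)))
    (ν : ProbabilityMeasure (Set.Icc a b)) {C : ℝ} (hC : 0 < C)
    (hCf : ∫ x in Set.Icc a b, |f x| ^ (2 / 3 : ℝ) = C)
    (h : ∫⁻ x in Set.Icc a b, ENNReal.ofReal (f x ^ 2) / ((toReal ν).rnDeriv volume x) ^ 2 ≤
      ENNReal.ofReal (C ^ 3)) :
    ∀ᵐ x ∂(volume.restrict (Set.Icc a b)),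
      (toReal ν).rnDeriv volume x = ENNReal.ofReal (C⁻¹ * |f x| ^ (2 / 3 : ℝ)) := by
  have e := lintegral_ofReal_mul_rpow hf (r := 3 * C ^ 2) (by positivity)
  have heq := ae_eq_of_ae_le_of_lintegral_le (ae_young (f := f) ν hC)
    (by rw [e]; exact ENNReal.ofReal_ne_top)
    ((aemeasurable_div_rnDeriv_sq hf ν).add
      ((Measure.measurable_rnDeriv _ _).const_mul _).aemeasurable)
    ((lintegral_young hf ν C).trans (by
      rw [e, hCf, show 3 * C ^ 2 * C = C ^ 3 + 2 * C ^ 3 by ring,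
        ENNReal.ofReal_add (by positivity) (by positivity)]
      gcongr))
  filter_upwards [heq, ae_restrict_of_ae (Measure.rnDeriv_lt_top (toReal ν) volume)] with x h1 h2
  rw [← rpow_two_thirds_pow_three (f x)] at h1
  exact eq_of_young_div_sq_eq hC (by positivity) h2.ne h1

theorem exists_unique_minimizer (hf : MemLp f 2 (volume.restrict (Set.Icc a b)))
    (hf0 : ¬ f =ᵐ[volume.restrict (Set.Icc a b)] 0) :
    ∃ μopt : ProbabilityMeasure (Set.Icc a b),
      toReal μopt = (volume.restrict (Set.Icc a b)).withDensity (fun x =>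
        ENNReal.ofReal ((∫ t in Set.Icc a b, |f t| ^ (2 / 3 : ℝ))⁻¹ * |f x| ^ (2 / 3 : ℝ))) ∧
      (∀ ν, limitFunctional a b f μopt ≤ limitFunctional a b f ν) ∧
      (∀ ν, (∀ ν', limitFunctional a b f ν ≤ limitFunctional a b f ν') → ν = μopt) := by
  obtain ⟨C, hCf⟩ : ∃ C, ∫ t in Set.Icc a b, |f t| ^ (2 / 3 : ℝ) = C := ⟨_, rfl⟩
  have hC : 0 < C := hCf ▸ integral_rpow_two_thirds_pos hf hf0
  rw [hCf]
  set w : ℝ → ℝ≥0∞ := fun x => ENNReal.ofReal (C⁻¹ * |f x| ^ (2 / 3 : ℝ)) with hw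
  have hwm : AEMeasurable w (volume.restrict (Set.Icc a b)) :=
    ((hf.aestronglyMeasurable.aemeasurable.norm.pow_const _).const_mul _).ennreal_ofReal
  have hmass : ((volume.restrict (Set.Icc a b)).withDensity w) (Set.Icc a b) = 1 := by
    rw [withDensity_apply _ measurableSet_Icc, Measure.restrict_restrict measurableSet_Icc,
      Set.inter_self, lintegral_ofReal_mul_rpow hf (by positivity), hCf, inv_mul_cancel₀ hC.ne',
      ENNReal.ofReal_one]
  obtain ⟨μ, hμ⟩ : ∃ μ : ProbabilityMeasure (Set.Icc a b),
      toReal μ = (volume.restrict (Set.Icc a b)).withDensity w := by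
    refine ⟨ofMeasure _ hmass, ?_⟩
    rw [toReal_ofMeasure, restrict_withDensity measurableSet_Icc,
      Measure.restrict_restrict measurableSet_Icc, Set.inter_self]
  have hrn : ∀ᵐ x ∂(volume.restrict (Set.Icc a b)), (toReal μ).rnDeriv volume x = w x := by
    rw [hμ, ← withDensity_indicator measurableSet_Icc]
    filter_upwards [ae_restrict_of_ae (Measure.rnDeriv_withDensity₀ volume
      ((aemeasurable_indicator_iff measurableSet_Icc).2 hwm)), ae_restrict_mem measurableSet_Icc]
      with x h1 h2
    rw [h1, Set.indicator_of_mem h2]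
  have hval : ∫⁻ x in Set.Icc a b, ENNReal.ofReal (f x ^ 2) / ((toReal μ).rnDeriv volume x) ^ 2 ≤
      ENNReal.ofReal (C ^ 3) := by
    -- Pointwise `t³ / (t / C)² = C² t`, with `0 / 0 = 0` where `t = 0`; this integrates to `C² *
    -- C`.
    rw [show C ^ 3 = C ^ 2 * C by ring]
    nth_rewrite 2 [← hCf]
    rw [← lintegral_ofReal_mul_rpow hf (by positivity)]
    refine lintegral_mono_ae ?_
    filter_upwards [hrn] with x hx
    rw [hx, ← rpow_two_thirds_pow_three (f x)]
    simp only [hw]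
    have h0 : 0 ≤ |f x| ^ (2 / 3 : ℝ) := by positivity
    generalize |f x| ^ (2 / 3 : ℝ) = t at h0
    rcases h0.eq_or_lt with rfl | ht
    · simp
    · rw [← ENNReal.ofReal_pow (by positivity), ← ENNReal.ofReal_div_of_pos (by positivity)]
      refine ENNReal.ofReal_le_ofReal (le_of_eq ?_)
      field_simp
  refine ⟨μ, hμ, fun ν => ?_, fun ν hν => ?_⟩
  · unfold limitFunctional
    refine mul_le_mul_right ?_ _
    exact hval.trans (le_lintegral_div_rnDeriv_sq hf ν hC hCf)
  · have h1 : ∫⁻ x in Set.Icc a b, ENNReal.ofReal (f x ^ 2) /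
        ((toReal ν).rnDeriv volume x) ^ 2 ≤ ENNReal.ofReal (C ^ 3) := by
      refine le_trans ?_ hval
      have := hν μ
      unfold limitFunctional at this
      exact (ENNReal.mul_le_mul_iff_right (by simp) (by simp)).1 this
    -- A minimizer dominates its absolutely continuous part, which already has mass one, so it has
    -- no singular part.
    refine toReal_injective (Eq.symm (Measure.eq_of_le_of_isProbabilityMeasure ?_))
    rw [hμ, ← withDensity_congr_ae (rnDeriv_eq_of_lintegral_le hf ν hC hCf h1),
      ← restrict_withDensity measurableSet_Icc]
    exact Measure.restrict_le_self.trans (Measure.withDensity_rnDeriv_le _ _)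

end Minimizer

end DirichletPoints

/-! ### The theorem -/

theorem theorem5p2 (a b : ℝ) (hab : a < b) (f : ℝ → ℝ)
    (hf : MemLp f 2 (volume.restrict (Set.Icc a b))) :
    DirichletPoints.GammaConverges (DirichletPoints.pointFunctional a b f)
      (DirichletPoints.limitFunctional a b f) ∧
    DirichletPoints.GammaConverges (DirichletPoints.multiPointFunctional a b f)
      (DirichletPoints.limitFunctional a b f) ∧
    (¬ f =ᵐ[volume.restrict (Set.Icc a b)] 0 →
      ∃ μopt : ProbabilityMeasure (Set.Icc a b),
        DirichletPoints.toReal μopt =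
          (volume.restrict (Set.Icc a b)).withDensity (fun x =>
            ENNReal.ofReal ((∫ t in Set.Icc a b, |f t| ^ (2 / 3 : ℝ))⁻¹ * |f x| ^ (2 / 3 : ℝ))) ∧
        (∀ ν, DirichletPoints.limitFunctional a b f μopt ≤
          DirichletPoints.limitFunctional a b f ν) ∧
        (∀ ν, (∀ ν', DirichletPoints.limitFunctional a b f ν ≤
          DirichletPoints.limitFunctional a b f ν') → ν = μopt)) := by
  refine ⟨fun μ => ⟨fun y hy => ?_, ?_⟩, fun μ => ⟨fun y hy => ?_, ?_⟩,
    DirichletPoints.exists_unique_minimizer hf⟩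
  · exact DirichletPoints.limitFunctional_le_liminf hab hf
      (DirichletPoints.isPointBounded_pointFunctional) hy
  · refine DirichletPoints.exists_recovery_sequence fun V hV c hc => ?_
    filter_upwards [DirichletPoints.eventually_exists_near_optimal hab hf μ hV hc] with n hn
    obtain ⟨y, hyV, hy, _⟩ := hn
    exact ⟨y, hyV, hy⟩
  · exact DirichletPoints.limitFunctional_le_liminf hab hf
      (DirichletPoints.isPointBounded_multiPointFunctional) hy
  · refine DirichletPoints.exists_recovery_sequence fun V hV c hc => ?_
    filter_upwards [DirichletPoints.eventually_exists_near_optimal hab hf μ hV hc] with n hn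
    obtain ⟨y, hyV, _, hy⟩ := hn
    exact ⟨y, hyV, hy⟩
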